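/- **Setting.** Let $(\mathsf X,\mathcal X)$ and $(\mathsf Y,\mathcal Y)$ be measurable spaces, $Q$ a Markov kernel on $(\mathsf X,\mathcal X)$, $\nu$ a $\sigma$-finite measure on $(\mathsf Y,\mathcal Y)$ and $g:\mathsf X\times\mathsf Y\to[0,\infty)$ a measurable function with $\int g(x,y)\,\nu(dy)=1$ for all $x$ (a hidden Markov model with transition kernel $Q$ and observation density $g$). Write $g_y=g(\cdot,y)$, $\|f\|_\infty=\sup_x|f(x)|$, $\ln^+=\max(\ln,0)$, $\ln^-=\max(-\ln,0)$, $\ln^-0=\ln^+\infty=\infty$. For $y_k,\dots,y_m\in\mathsf Y$ let $$L\langle y_{k:m}\rangle(x_k,A)=\int\cdots\int \mathbf 1_A(x_{m+1})\prod_{\ell=k}^m g(x_\ell,y_\ell)\,Q(x_\ell,dx_{\ell+1}),$$ and $L\langle y_{k:m}\rangle(x,\cdot)=\delta_x$ if $k>m$. For a probability measure $\chi$ on $\mathsf X$ define the predictor and the filter distributions $$\phi_\chi\langle y_{0:n-1}\rangle(A)=\frac{\chi L\langle y_{0:n-1}\rangle\mathbf 1_A}{\chi L\langle y_{0:n-1}\rangle\mathbf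 1_{\mathsf X}},\qquad \tilde\phi_\chi\langle y_{0:n}\rangle(A)=\frac{\phi_\chi\langle y_{0:n-1}\rangle(\mathbf 1_A\,g_{y_n})}{\phi_\chi\langle y_{0:n-1}\rangle(g_{y_n})},$$ and the asymptotic variances of the bootstrap particle predictor and of the bootstrap particle filter $$\sigma^2_\chi\langle y_{0:n-1}\rangle(h)=\sum_{k=0}^n\phi_\chi\langle y_{0:k-1}\rangle\left(\frac{L\langle y_{k:n-1}\rangle h-\phi_\chi\langle y_{0:n-1}\rangle h\cdot L\langle y_{k:n-1}\rangle\mathbf 1_{\mathsf X}}{\phi_\chi\langle y_{0:k-1}\rangle L\langle y_{k:n-1}\rangle\mathbf 1_{\mathsf X}}\right)^2,$$ $$\tilde\sigma^2_\chi\langle y_{0:n}\rangle(h)=\frac{\sigma^2_\chi\langle y_{0:n-1}\rangle\bigl(g_{y_n}\{h-\tilde\phi_\chi\langle y_{0:n}\rangle h\}\bigr)}{(\phi_\chi\langle y_{0:n-1}\rangle g_{y_n})^2}.$$ For an integer $r\ge1$, a set $C\in\mathcal X$ is *$r$-local Doeblin* if there are positive functions $\epsilon_C^-,\epsilon_C^+:\mathsf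 Y^r\to(0,\infty)$, probability measures $\lambda_C\langle z\rangle$ with $\lambda_C\langle z\rangle(C)=1$, and positive functions $\varphi_C\langle z\rangle$ on $\mathsf X$ ($z\in\mathsf Y^r$) such that for all $z\in\mathsf Y^r$, $A\in\mathcal X$, $x\in C$, $$\epsilon_C^-\langle z\rangle\varphi_C\langle z\rangle(x)\lambda_C\langle z\rangle(A)\le L\langle z\rangle(x,A\cap C)\le\epsilon_C^+\langle z\rangle\varphi_C\langle z\rangle(x)\lambda_C\langle z\rangle(A).$$ Let $(Y_n)_{n\in\mathbb N}$ be a $\mathsf Y$-valued process on a probability space $(\Omega,\mathcal A,\mathbb P)$ (it need not come from the model). **(A1)** $(Y_n)$ is strictly stationary and ergodic, and there are an integer $r\ge1$ and a set $K\in\mathcal Y^{\otimes r}$ such that: (i) the process $(Z_n)$, $Z_n=Y_{nr:(n+1)r-1}$, is ergodic and $\mathbb P(Z_0\in K)>2/3$; (ii) for every $\eta>0$ there is an $r$-local Doeblin set $C$ (with functions $\epsilon_C^\pm$) such that $\sup_{x\in C^c}L\langle z\rangle(x,\mathsf X)\le\eta\,\|L\langle z\rangle(\cdot,\mathsf X)\|_\infty<\infty$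 for all $z\in K$, and $\inf_{z\in K}\epsilon_C^-\langle z\rangle/\epsilon_C^+\langle z\rangle>0$; (iii) there is a set $D\in\mathcal X$ with $\mathbb E\bigl[\ln^-\inf_{x\in D}L\langle Y_{0:r-1}\rangle(x,D)\bigr]<\infty$. **(A2)** $g(x,y)>0$ for all $(x,y)\in\mathsf X\times\mathsf Y$, and $\mathbb E[\ln^+\|g_{Y_0}\|_\infty]<\infty$. For $r$ and $D$ as in (A1), let $\mathcal M(D,r)$ be the set of probability measures $\chi$ on $\mathsf X$ such that $\mathbb E[\ln^-\chi L\langle Y_{0:\ell-1}\rangle\mathbf 1_D]<\infty$ for all $\ell\in\{0,\dots,r\}$. **Theorem.** Assume (A1)–(A2). Then for all $\chi\in\mathcal M(D,r)$ and all bounded measurable $h:\mathsf X\to\mathbb R$, the sequence of real random variables $(\tilde\sigma^2_\chi\langle Y_{0:n}\rangle(h))_{n\ge1}$ is tight: for every $\varepsilon>0$ there is $a\in\mathbb R$ such that $\mathbb P\bigl(\tilde\sigma^2_\chi\langle Y_{0:n}\rangle(h)\notin[-a,a]\bigr)\le\varepsilon$ for all $n\ge1$. -/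

import Mathlib

open MeasureTheory ProbabilityTheory
open scoped ENNReal

noncomputable section

namespace ParticleFilter

/-- A fully dominated hidden Markov model on `(𝒳, 𝒴)`: a Markov transition kernel `Q` of the state
sequence and a transition density `g` of the observation kernel
`G(x, A) = ∫_A g(x, y) ν(dy)` with respect to a `σ`-finite measure `ν`. -/
structure HMM (𝒳 𝒴 : Type*) [MeasurableSpace 𝒳] [MeasurableSpace 𝒴] where
  /-- transition kernel of the hidden chain -/
  Q : Kernel 𝒳 𝒳
  markov : IsMarkovKernel Q
  /-- reference measure on the observation space -/
  ν : Measure 𝒴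
  sigmaFinite : SigmaFinite ν
  /-- observation density -/
  g : 𝒳 → 𝒴 → ℝ
  measurable_g : Measurable (Function.uncurry g)
  g_nonneg : ∀ x y, 0 ≤ g x y
  lintegral_g : ∀ x, ∫⁻ y, ENNReal.ofReal (g x y) ∂ν = 1

attribute [instance] HMM.markov HMM.sigmaFinite

variable {𝒳 𝒴 Ω : Type*} [MeasurableSpace 𝒳] [MeasurableSpace 𝒴] [MeasurableSpace Ω]

/-- The unnormalized kernel `L⟨y⟩(x, dx') = g(x, y) Q(x, dx')`. -/
def HMM.step (M : HMM 𝒳 𝒴) (y : 𝒴) : Kernel 𝒳 𝒳 :=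
  M.Q.withDensity (fun x _ => ENNReal.ofReal (M.g x y))

/-- The unnormalized kernel `L⟨z₀, …, z_{n-1}⟩`,
`L⟨z⟩(x₀, A) = ∫⋯∫ 1_A(x_n) ∏_{ℓ < n} g(x_ℓ, z_ℓ) Q(x_ℓ, dx_{ℓ+1})`;
for the empty record it is the identity kernel `x ↦ δ_x`. -/
def HMM.L (M : HMM 𝒳 𝒴) : (n : ℕ) → (Fin n → 𝒴) → Kernel 𝒳 𝒳
  | 0, _ => Kernel.id
  | n + 1, z => (M.L n (Fin.tail z)) ∘ₖ (M.step (z 0))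

/-- The record `y_{k:m-1} = (y_k, …, y_{m-1})`, empty if `m ≤ k`. -/
def seg (y : ℕ → 𝒴) (k m : ℕ) : Fin (m - k) → 𝒴 := fun i => y (k + i)

/-- `Lseg y k m = L⟨y_{k:m-1}⟩`. -/
def HMM.Lseg (M : HMM 𝒳 𝒴) (y : ℕ → 𝒴) (k m : ℕ) : Kernel 𝒳 𝒳 := M.L (m - k) (seg y k m)

/-- The function `K f : x ↦ ∫ f(x') K(x, dx')`. -/
def act (K : Kernel 𝒳 𝒳) (f : 𝒳 → ℝ) (x : 𝒳) : ℝ := ∫ x', f x' ∂(K x)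

/-- The predictor `φ_χ⟨y_{0:n-1}⟩ = χ L⟨y_{0:n-1}⟩ / χ L⟨y_{0:n-1}⟩ 1`. -/
def HMM.pred (M : HMM 𝒳 𝒴) (χ : Measure 𝒳) (y : ℕ → 𝒴) (n : ℕ) : Measure 𝒳 :=
  (χ.bind (M.Lseg y 0 n) Set.univ)⁻¹ • χ.bind (M.Lseg y 0 n)

/-- The updating transformation `μ ↦ g(·, y) μ / μ g(·, y)`. -/
def HMM.update (M : HMM 𝒳 𝒴) (y : 𝒴) (μ : Measure 𝒳) : Measure 𝒳 :=
  (∫⁻ x, ENNReal.ofReal (M.g x y) ∂μ)⁻¹ • μ.withDensity (fun x => ENNReal.ofReal (M.g x y))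

/-- The filter distribution given the observations `y_{0:n}`. -/
def HMM.filt (M : HMM 𝒳 𝒴) (χ : Measure 𝒳) (y : ℕ → 𝒴) (n : ℕ) : Measure 𝒳 :=
  M.update (y n) (M.pred χ y n)

/-- The asymptotic variance `σ²_χ⟨y_{0:n-1}⟩(h)` of the bootstrap particle predictor. -/
def HMM.predVar (M : HMM 𝒳 𝒴) (χ : Measure 𝒳) (y : ℕ → 𝒴) (n : ℕ) (h : 𝒳 → ℝ) : ℝ :=
  ∑ k ∈ Finset.range (n + 1),
    ∫ x, ((act (M.Lseg y k n) h x
            - (∫ x', h x' ∂(M.pred χ y n)) * act (M.Lseg y k n) (fun _ => 1) x)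
          / ∫ x', act (M.Lseg y k n) (fun _ => 1) x' ∂(M.pred χ y k)) ^ 2 ∂(M.pred χ y k)

/-- The asymptotic variance `σ̃²_χ⟨y_{0:n}⟩(h)` of the bootstrap particle filter. -/
def HMM.filtVar (M : HMM 𝒳 𝒴) (χ : Measure 𝒳) (y : ℕ → 𝒴) (n : ℕ) (h : 𝒳 → ℝ) : ℝ :=
  M.predVar χ y n (fun x => M.g x (y n) * (h x - ∫ x', h x' ∂(M.filt χ y n)))
    / (∫ x, M.g x (y n) ∂(M.pred χ y n)) ^ 2

/-- `C` is an `r`-local Doeblin set, with lower and upper functions `εl` and `εu`. -/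
def HMM.IsLocalDoeblinWith (M : HMM 𝒳 𝒴) (r : ℕ) (C : Set 𝒳) (εl εu : (Fin r → 𝒴) → ℝ) : Prop :=
  MeasurableSet C ∧ (∀ z, 0 < εl z) ∧ (∀ z, 0 < εu z) ∧
    ∃ (lam : (Fin r → 𝒴) → Measure 𝒳) (φ : (Fin r → 𝒴) → 𝒳 → ℝ),
      (∀ z, IsProbabilityMeasure (lam z)) ∧ (∀ z x, 0 < φ z x) ∧ (∀ z, lam z C = 1) ∧
      ∀ (z : Fin r → 𝒴) (A : Set 𝒳), MeasurableSet A → ∀ x ∈ C,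
        ENNReal.ofReal (εl z * φ z x) * lam z A ≤ M.L r z x (A ∩ C) ∧
        M.L r z x (A ∩ C) ≤ ENNReal.ofReal (εu z * φ z x) * lam z A

/-- `ln⁺ a = max(ln a, 0)`, with `ln⁺ ∞ = ∞`. -/
def lnPos (a : ℝ≥0∞) : ℝ≥0∞ := (ENNReal.log a).toENNReal

/-- `ln⁻ a = max(-ln a, 0)`, with `ln⁻ 0 = ∞`. -/
def lnNeg (a : ℝ≥0∞) : ℝ≥0∞ := (-ENNReal.log a).toENNReal

/-- `f` is `μ`-almost everywhere measurable and `∫ f dμ < ∞`. -/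
def FiniteMean {α : Type*} [MeasurableSpace α] (μ : Measure α) (f : α → ℝ≥0∞) : Prop :=
  AEMeasurable f μ ∧ ∫⁻ a, f a ∂μ < ∞

/-- A process is strictly stationary and ergodic: the shift preserves the law of the process
and is ergodic under this law. -/
def IsStationaryErgodic {α : Type*} [MeasurableSpace α] (P : Measure Ω) (U : ℕ → Ω → α) : Prop :=
  Ergodic (fun (u : ℕ → α) (n : ℕ) => u (n + 1)) (P.map (fun ω n => U n ω))

/-- The blocks `Z_n = Y_{nr:(n+1)r-1}`. -/
def blockProc (Y : ℕ → Ω → 𝒴) (r : ℕ) (n : ℕ) (ω : Ω) : Fin r → 𝒴 := fun i => Y (n * r + i) ω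

/-- The law of `Y_{0:ℓ-1}`. -/
def initLaw (P : Measure Ω) (Y : ℕ → Ω → 𝒴) (ℓ : ℕ) : Measure (Fin ℓ → 𝒴) :=
  P.map (fun ω (i : Fin ℓ) => Y i ω)

/-- Assumption (A1), with its integer `r ≥ 1` and its set `D`. -/
def HMM.A1 (M : HMM 𝒳 𝒴) (P : Measure Ω) (Y : ℕ → Ω → 𝒴) (r : ℕ) (D : Set 𝒳) : Prop :=
  IsStationaryErgodic P Y ∧ 1 ≤ r ∧
  ∃ K : Set (Fin r → 𝒴), MeasurableSet K ∧
    -- (i)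
    (IsStationaryErgodic P (blockProc Y r) ∧ 2 / 3 < P {ω | blockProc Y r 0 ω ∈ K}) ∧
    -- (ii)
    (∀ η : ℝ, 0 < η → ∃ (C : Set 𝒳) (εl εu : (Fin r → 𝒴) → ℝ),
      M.IsLocalDoeblinWith r C εl εu ∧
      (∀ z ∈ K,
        (⨆ x ∈ Cᶜ, M.L r z x Set.univ) ≤ ENNReal.ofReal η * (⨆ x, M.L r z x Set.univ) ∧
        (⨆ x, M.L r z x Set.univ) < ∞) ∧
      0 < ⨅ z ∈ K, ENNReal.ofReal (εl z / εu z)) ∧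
    -- (iii)
    (MeasurableSet D ∧ FiniteMean (initLaw P Y r) (fun z => lnNeg (⨅ x ∈ D, M.L r z x D)))

/-- Assumption (A2). -/
def HMM.A2 (M : HMM 𝒳 𝒴) (P : Measure Ω) (Y : ℕ → Ω → 𝒴) : Prop :=
  (∀ x y, 0 < M.g x y) ∧
  FiniteMean (P.map (Y 0)) (fun y => lnPos (⨆ x, ENNReal.ofReal (M.g x y)))

/-- The class `ℳ(D, r)` of initial distributions `χ` with `E[ln⁻ χ L⟨Y_{0:ℓ-1}⟩ 1_D] < ∞` for all
`ℓ ∈ {0, …, r}`. -/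
def HMM.initClass (M : HMM 𝒳 𝒴) (P : Measure Ω) (Y : ℕ → Ω → 𝒴) (D : Set 𝒳) (r : ℕ) :
    Set (Measure 𝒳) :=
  {χ | IsProbabilityMeasure χ ∧
    ∀ ℓ ≤ r, FiniteMean (initLaw P Y ℓ) (fun z => lnNeg (χ.bind (M.L ℓ z) D))}

/-- A family of real random variables is tight: for every `ε > 0` there is a compact interval
`[-a, a]` such that every one of their laws gives its complement mass at most `ε`. -/
def IsTightFamily {ι : Type*} (P : Measure Ω) (V : ι → Ω → ℝ) : Prop :=
  (∀ i, AEMeasurable (V i) P) ∧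
  ∀ ε : ℝ, 0 < ε → ∃ a : ℝ, ∀ i, (P.map (V i)) (Set.Icc (-a) a)ᶜ ≤ ENNReal.ofReal ε

end ParticleFilter

end

/-!
Up to a normalization, the `k`-th term of the asymptotic variance is the variance, under the
predictor at time `k`, of a function that compares `L⟨Y_{k:n}⟩` applied to `h` and to `1`. It is
small as soon as these kernels have forgotten their initial state between the times `k` and `n`,
provided that masses seen from `D` and from anywhere else, and masses of the predictor on `D` and
on `𝒳`, do not differ too much.

Call a pair of successive blocks of length `r` good if both blocks lie in `K`. Two independent
copies of the chain that start and land in the Doeblin set `C` during the first block couple with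
a probability bounded below; if one of them leaves `C`, then the second block makes their weight
small. Over a pair of blocks this gives affine recursions for the ratios of masses and for the
oscillation of quotients of functions, whose coefficients are small at the good pairs and at most
exponentials of sums of `ln⁺ ‖g_{Y_i}‖∞ + ln⁻ inf_D L⟨Y_{i:i+r-1}⟩(·, D)` at the others.

Since `P(Z_0 ∈ K) > 2/3`, the ergodic theorem makes more than a third of the pairs good and
controls these sums, on every window `[j, n)`, up to a fluctuation `ε (n - j) + b` in which `b`
may be chosen uniformly in `n` outside an event of small probability. A bound that is uniform in
`n` needs the ergodic theorem for windows with a moving right end; this comes from the maximal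
ergodic theorem, after subtraction of a coboundary. For `ε` small enough the `k`-th term is then
at most `const · exp (-2 l (n - k))`, so that the variance is bounded by a constant that depends
on `b` only.
-/

noncomputable section

namespace ParticleFilter

section Ergodic

variable {α : Type*} {T : α → α}

/-- The largest sum of `w` along the orbit of `T` over a window `[j, n)`, the empty one included.
The right end is fixed, so that the maximum obeys a recursion in `n`. -/
def windowMax (T : α → α) (w : α → ℝ) : ℕ → α → ℝ
  | 0, _ => 0
  | n + 1, u => max 0 (windowMax T w n u + w (T^[n] u))

lemma windowMax_nonneg (w : α → ℝ) (n : ℕ) (u : α) : 0 ≤ windowMax T w n u := by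
  cases n with
  | zero => exact le_rfl
  | succ n => exact le_max_left _ _

lemma sum_Ico_le_windowMax (w : α → ℝ) (u : α) (n j : ℕ) :
    ∑ i ∈ Finset.Ico j n, w (T^[i] u) ≤ windowMax T w n u := by
  induction n with
  | zero => simp [windowMax]
  | succ n ih =>
    rcases le_or_gt j n with h | h
    · rw [Finset.sum_Ico_succ_top h]
      exact le_max_of_le_right (by linarith)
    · rw [Finset.Ico_eq_empty (by omega), Finset.sum_empty]
      exact windowMax_nonneg w (n + 1) u

lemma windowMax_comp_le (w : α → ℝ) (n : ℕ) (u : α) :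
    windowMax T w n (T u) ≤ windowMax T w (n + 1) u := by
  induction n with
  | zero => exact windowMax_nonneg w 1 u
  | succ n ih =>
    rw [windowMax, windowMax, ← Function.iterate_succ_apply]
    gcongr

lemma windowMax_succ_sub_le (w : α → ℝ) (n : ℕ) (u : α) :
    windowMax T w (n + 1) u - windowMax T w n u
      ≤ {u | 0 < windowMax T w (n + 1) u}.indicator (fun u => w (T^[n] u)) u := by
  by_cases hu : 0 < windowMax T w (n + 1) u
  · rw [Set.indicator_of_mem (by exact hu), sub_le_iff_le_add']
    rw [windowMax, lt_max_iff, lt_self_iff_false, false_or] at hu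
    exact max_le hu.le le_rfl
  · rw [Set.indicator_of_notMem (by exact hu)]
    linarith [windowMax_nonneg (T := T) w n u]

lemma sub_birkhoffAverage_eq_coboundary (f : α → ℝ) {n : ℕ} (hn : n ≠ 0) (u : α) :
    f u - birkhoffAverage ℝ T f n u
      = (n : ℝ)⁻¹ * ∑ i ∈ Finset.range n, birkhoffSum T f i u
        - (n : ℝ)⁻¹ * ∑ i ∈ Finset.range n, birkhoffSum T f i (T u) := by
  have hn' : (n : ℝ) ≠ 0 := Nat.cast_ne_zero.2 hn
  have h (i : ℕ) : birkhoffSum T f i u - birkhoffSum T f i (T u) = f u - f (T^[i] u) := by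
    rw [← neg_sub, birkhoffSum_apply_sub_birkhoffSum, neg_sub]
  rw [← mul_sub, ← Finset.sum_sub_distrib, Finset.sum_congr rfl fun i _ => h i,
    Finset.sum_sub_distrib, Finset.sum_const, Finset.card_range, nsmul_eq_mul, mul_sub,
    inv_mul_cancel_left₀ hn']
  rfl

lemma abs_birkhoffSum_le {f : α → ℝ} {B : ℝ} (hB : ∀ u, |f u| ≤ B) (n : ℕ) (u : α) :
    |birkhoffSum T f n u| ≤ n * B := by
  simpa [birkhoffSum] using (Finset.abs_sum_le_sum_abs _ _).trans
    (Finset.sum_le_sum fun i (_ : i ∈ Finset.range n) => hB (T^[i] u))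

lemma sum_Ico_coboundary (g : α → ℝ) (u : α) {j n : ℕ} (h : j ≤ n) :
    ∑ i ∈ Finset.Ico j n, (g (T^[i] u) - g (T (T^[i] u))) = g (T^[j] u) - g (T^[n] u) := by
  simp only [← Function.iterate_succ_apply' T, ← neg_sub (g (T^[_ + 1] u)), Finset.sum_neg_distrib]
  rw [Finset.sum_Ico_sub (fun i => g (T^[i] u)) h, neg_sub]

variable [MeasurableSpace α] {μ : Measure α}

lemma integral_comp_of_measurePreserving (hT : MeasurePreserving T μ μ) {f : α → ℝ}
    (hf : AEStronglyMeasurable f μ) : ∫ u, f (T u) ∂μ = ∫ u, f u ∂μ := by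
  rw [← integral_map hT.aemeasurable (by rwa [hT.map_eq]), hT.map_eq]

lemma integrable_iterate (hT : MeasurePreserving T μ μ) {f : α → ℝ} (hf : Integrable f μ) (n : ℕ) :
    Integrable (fun u => f (T^[n] u)) μ :=
  (hT.iterate n).integrable_comp_of_integrable hf

lemma integrable_windowMax (hT : MeasurePreserving T μ μ) {w : α → ℝ} (hw : Integrable w μ)
    (n : ℕ) : Integrable (windowMax T w n) μ := by
  induction n with
  | zero => exact integrable_zero _ _ _
  | succ n ih =>
    exact (integrable_zero α ℝ μ).sup (ih.add (integrable_iterate hT hw n))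

lemma nullMeasurableSet_windowMax_pos (hT : MeasurePreserving T μ μ) {w : α → ℝ}
    (hw : Integrable w μ) (n : ℕ) : NullMeasurableSet {u | 0 < windowMax T w n u} μ :=
  nullMeasurableSet_lt aemeasurable_const (integrable_windowMax hT hw n).aemeasurable

/-- The maximal ergodic theorem for windows with a fixed right end. -/
lemma setIntegral_windowMax_pos_nonneg (hT : MeasurePreserving T μ μ) {w : α → ℝ}
    (hw : Integrable w μ) (n : ℕ) :
    0 ≤ ∫ u in {u | 0 < windowMax T w (n + 1) u}, w (T^[n] u) ∂μ := by
  have hS := nullMeasurableSet_windowMax_pos hT hw (n + 1)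
  have hn := integrable_windowMax hT hw n
  have hn1 := integrable_windowMax hT hw (n + 1)
  calc 0 ≤ ∫ u, windowMax T w (n + 1) u ∂μ - ∫ u, windowMax T w n (T u) ∂μ :=
        sub_nonneg.2 <| integral_mono (hT.integrable_comp_of_integrable hn) hn1 <|
          windowMax_comp_le w n
    _ = ∫ u, (windowMax T w (n + 1) u - windowMax T w n u) ∂μ := by
        rw [integral_comp_of_measurePreserving hT hn.1, integral_sub hn1 hn]
    _ ≤ ∫ u, {u | 0 < windowMax T w (n + 1) u}.indicator (fun u => w (T^[n] u)) u ∂μ :=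
        integral_mono (hn1.sub hn)
          ((integrable_iterate hT hw n).indicator₀ hS)
          (windowMax_succ_sub_le w n)
    _ = _ := integral_indicator₀ hS

lemma mul_measureReal_windowMax_pos_le [IsProbabilityMeasure μ] (hT : MeasurePreserving T μ μ)
    {e : α → ℝ} (he : Integrable e μ) (he0 : ∀ u, 0 ≤ e u) {l : ℝ} (n : ℕ) :
    l * μ.real {u | 0 < windowMax T (fun u => e u - l) n u} ≤ ∫ u, e u ∂μ := by
  cases n with
  | zero => simpa [windowMax] using integral_nonneg he0
  | succ n =>
    set S := {u | 0 < windowMax T (fun u => e u - l) (n + 1) u}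
    have hen := integrable_iterate hT he n
    have h : 0 ≤ ∫ u in S, (e (T^[n] u) - l) ∂μ :=
      setIntegral_windowMax_pos_nonneg hT (he.sub (integrable_const l)) n
    rw [integral_sub hen.integrableOn (integrable_const l), setIntegral_const, smul_eq_mul] at h
    have hS : ∫ u in S, e (T^[n] u) ∂μ ≤ ∫ u, e (T^[n] u) ∂μ :=
      setIntegral_le_integral hen (.of_forall fun u => he0 _)
    rw [integral_comp_of_measurePreserving (hT.iterate n) he.1] at hS
    linarith

lemma measure_exists_sum_Ico_gt_le [IsProbabilityMeasure μ] (hT : MeasurePreserving T μ μ)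
    {e : α → ℝ} (he : Integrable e μ) (he0 : ∀ u, 0 ≤ e u) {l : ℝ} (hl : 0 < l) (n : ℕ) :
    μ {u | ∃ j ≤ n, l * (n - j : ℝ) < ∑ i ∈ Finset.Ico j n, e (T^[i] u)}
      ≤ ENNReal.ofReal ((∫ u, e u ∂μ) / l) := by
  have hsub : {u | ∃ j ≤ n, l * (n - j : ℝ) < ∑ i ∈ Finset.Ico j n, e (T^[i] u)}
      ⊆ {u | 0 < windowMax T (fun u => e u - l) n u} := by
    rintro u ⟨j, hj, hu⟩
    refine lt_of_lt_of_le ?_ (sum_Ico_le_windowMax _ u n j)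
    simp only [Finset.sum_sub_distrib, Finset.sum_const, Nat.card_Ico, nsmul_eq_mul,
      Nat.cast_sub hj]
    linarith
  refine (measure_mono hsub).trans ?_
  rw [← ofReal_measureReal]
  refine ENNReal.ofReal_le_ofReal ((le_div_iff₀' hl).2 ?_)
  exact mul_measureReal_windowMax_pos_le hT he he0 n

lemma integral_abs_sub_integral_le [IsProbabilityMeasure μ] {f : α → ℝ} (hf : Integrable f μ)
    (c : ℝ) : ∫ u, |f u - ∫ v, f v ∂μ| ∂μ ≤ 2 * ∫ u, |f u - c| ∂μ := by
  have hfc : Integrable (fun u => |f u - c|) μ := (hf.sub (integrable_const c)).abs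
  have hc : |c - ∫ v, f v ∂μ| ≤ ∫ u, |f u - c| ∂μ := by
    have h := abs_integral_le_integral_abs (μ := μ) (f := fun u => f u - c)
    rwa [integral_sub hf (integrable_const c), integral_const, probReal_univ, one_smul,
      abs_sub_comm] at h
  calc ∫ u, |f u - ∫ v, f v ∂μ| ∂μ ≤ ∫ u, (|f u - c| + |c - ∫ v, f v ∂μ|) ∂μ :=
        integral_mono (hf.sub (integrable_const _)).abs (hfc.add (integrable_const _))
          fun u => abs_sub_le _ _ _
    _ = ∫ u, |f u - c| ∂μ + |c - ∫ v, f v ∂μ| := by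
        rw [integral_add hfc (integrable_const _), integral_const, probReal_univ, one_smul]
    _ ≤ 2 * ∫ u, |f u - c| ∂μ := by linarith

lemma integral_abs_le_of_eLpNorm_le {f : α → ℝ} (hf : AEStronglyMeasurable f μ) {δ : ℝ}
    (hδ : 0 ≤ δ) (h : eLpNorm f 1 μ ≤ ENNReal.ofReal δ) : ∫ u, |f u| ∂μ ≤ δ := by
  have h1 : ∫ u, |f u| ∂μ = (eLpNorm f 1 μ).toReal := by
    rw [eLpNorm_one_eq_lintegral_enorm]
    exact integral_norm_eq_lintegral_enorm hf
  rw [h1]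
  exact ENNReal.toReal_le_of_le_ofReal hδ h

lemma coeFn_birkhoffAverage_compMeasurePreserving (hT : MeasurePreserving T μ μ) (F : Lp ℝ 2 μ)
    (n : ℕ) : ⇑(birkhoffAverage ℝ (Lp.compMeasurePreserving T hT) id n F)
      =ᵐ[μ] birkhoffAverage ℝ T F n := by
  have hiter (i : ℕ) : ⇑((Lp.compMeasurePreserving T hT)^[i] F) =ᵐ[μ] fun u => F (T^[i] u) := by
    rw [Lp.compMeasurePreserving_iterate hT i]
    exact Lp.coeFn_compMeasurePreserving F (hT.iterate i)
  have hsum : ⇑(birkhoffSum (Lp.compMeasurePreserving T hT) id n F) =ᵐ[μ] birkhoffSum T F n := by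
    induction n with
    | zero => exact Lp.coeFn_zero ℝ 2 μ
    | succ n ih =>
      rw [birkhoffSum_succ]
      filter_upwards [Lp.coeFn_add _ (id ((Lp.compMeasurePreserving T hT)^[n] F)), ih, hiter n]
        with u hadd hsum hn
      rw [hadd, Pi.add_apply, hsum, id, hn, birkhoffSum_succ]
  filter_upwards [hsum, Lp.coeFn_smul (n : ℝ)⁻¹
    (birkhoffSum (Lp.compMeasurePreserving T hT) id n F)] with u hu hsmul
  rw [birkhoffAverage, hsmul, Pi.smul_apply, hu, birkhoffAverage]

lemma exists_tendsto_birkhoffAverage_compMeasurePreserving [IsFiniteMeasure μ] (hT : Ergodic T μ)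
    (F : Lp ℝ 2 μ) : ∃ p : Lp ℝ 2 μ, (∃ c : ℝ, p =ᵐ[μ] Function.const α c) ∧
      Filter.Tendsto (fun n => birkhoffAverage ℝ
        (Lp.compMeasurePreserving T hT.toMeasurePreserving) id n F) Filter.atTop (nhds p) := by
  set U : Lp ℝ 2 μ →L[ℝ] Lp ℝ 2 μ :=
    (Lp.compMeasurePreservingₗᵢ ℝ T hT.toMeasurePreserving).toContinuousLinearMap
  set p := (U.eqLocus (1 : Lp ℝ 2 μ →L[ℝ] Lp ℝ 2 μ)).orthogonalProjectionOnto F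
  refine ⟨p, hT.ae_eq_const_of_ae_eq_comp_ae (Lp.aestronglyMeasurable _) ?_,
    U.tendsto_birkhoffAverage_orthogonalProjection
      (LinearIsometry.norm_toContinuousLinearMap_le _) F⟩
  have hfix : Lp.compMeasurePreserving T hT.toMeasurePreserving p = (p : Lp ℝ 2 μ) := p.2
  have h := Lp.coeFn_compMeasurePreserving (p : Lp ℝ 2 μ) hT.toMeasurePreserving
  rw [hfix] at h
  exact h.symm

lemma integrable_birkhoffAverage (hT : MeasurePreserving T μ μ) {f : α → ℝ} (hf : Integrable f μ)
    (n : ℕ) : Integrable (birkhoffAverage ℝ T f n) μ :=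
  (integrable_finsetSum _ fun i _ => integrable_iterate hT hf i).smul (n : ℝ)⁻¹

lemma integral_birkhoffAverage (hT : MeasurePreserving T μ μ) {f : α → ℝ} (hf : Integrable f μ)
    {n : ℕ} (hn : n ≠ 0) : ∫ u, birkhoffAverage ℝ T f n u ∂μ = ∫ u, f u ∂μ := by
  simp only [birkhoffAverage, birkhoffSum, smul_eq_mul]
  rw [integral_const_mul, integral_finsetSum _ fun i _ => integrable_iterate hT hf i]
  simp only [fun i => integral_comp_of_measurePreserving (hT.iterate i) hf.1]
  simp [hn]

/-- The mean ergodic theorem, transferred from `L²` to `L¹`. -/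
lemma exists_integral_abs_birkhoffAverage_sub_le [IsProbabilityMeasure μ] (hT : Ergodic T μ)
    {f : α → ℝ} (hf : MemLp f 2 μ) {δ : ℝ} (hδ : 0 < δ) :
    ∃ n ≠ 0, ∫ u, |birkhoffAverage ℝ T f n u - ∫ v, f v ∂μ| ∂μ ≤ δ := by
  have hTp := hT.toMeasurePreserving
  obtain ⟨p, ⟨c, hc⟩, hp⟩ :=
    exists_tendsto_birkhoffAverage_compMeasurePreserving hT (hf.toLp f)
  obtain ⟨n, hn, hdist⟩ := ((Filter.eventually_ne_atTop 0).and
    (Metric.tendsto_nhds.1 hp (δ / 2) (half_pos hδ))).exists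
  have hfi : Integrable f μ := hf.integrable (by norm_num)
  have hA := integrable_birkhoffAverage hTp hfi n
  have hclose : ∫ u, |birkhoffAverage ℝ T f n u - c| ∂μ ≤ δ / 2 := by
    refine integral_abs_le_of_eLpNorm_le (hA.sub (integrable_const c)).1 (by positivity) ?_
    have hae : ⇑(birkhoffAverage ℝ (Lp.compMeasurePreserving T hTp) id n (hf.toLp f) - p)
        =ᵐ[μ] fun u => birkhoffAverage ℝ T f n u - c := by
      filter_upwards [Lp.coeFn_sub (birkhoffAverage ℝ (Lp.compMeasurePreserving T hTp) id n
          (hf.toLp f)) p, coeFn_birkhoffAverage_compMeasurePreserving hTp (hf.toLp f) n, hc,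
        hTp.quasiMeasurePreserving.birkhoffAverage_ae_eq_of_ae_eq ℝ hf.coeFn_toLp n]
        with u hsub havg hpc hrep
      rw [hsub, Pi.sub_apply, havg, hpc, hrep, Function.const_apply]
    refine (eLpNorm_congr_ae hae.symm).trans_le ?_
    refine (eLpNorm_le_eLpNorm_of_exponent_le (q := 2) (by norm_num)
      (Lp.aestronglyMeasurable _)).trans ?_
    rw [← Lp.enorm_def, ← ofReal_norm, ← dist_eq_norm]
    exact ENNReal.ofReal_le_ofReal hdist.le
  refine ⟨n, hn, ?_⟩
  have h := integral_abs_sub_integral_le hA c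
  rw [integral_birkhoffAverage hTp hfi hn] at h
  linarith

lemma exists_coboundary_of_bounded [IsProbabilityMeasure μ] (hT : Ergodic T μ) {f : α → ℝ}
    (hf : Measurable f) {B : ℝ} (hB : ∀ u, |f u| ≤ B) {δ : ℝ} (hδ : 0 < δ) :
    ∃ g : α → ℝ, Measurable g ∧ (∃ B', ∀ u, |g u| ≤ B') ∧
      ∫ u, |f u - ∫ v, f v ∂μ - (g u - g (T u))| ∂μ ≤ δ := by
  obtain ⟨n, hn, hnδ⟩ := exists_integral_abs_birkhoffAverage_sub_le hT
    (MemLp.of_bound hf.aestronglyMeasurable B (.of_forall hB)) hδ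
  refine ⟨fun u => (n : ℝ)⁻¹ * ∑ i ∈ Finset.range n, birkhoffSum T f i u, ?_,
    ⟨(n : ℝ)⁻¹ * ∑ i ∈ Finset.range n, i * B, fun u => ?_⟩, ?_⟩
  · exact (Finset.measurable_fun_sum _ fun i _ => Finset.measurable_fun_sum _ fun l _ =>
      hf.comp (hT.measurable.iterate l)).const_mul _
  · rw [abs_mul, abs_of_nonneg (by positivity)]
    gcongr
    exact (Finset.abs_sum_le_sum_abs _ _).trans
      (Finset.sum_le_sum fun i _ => abs_birkhoffSum_le hB i u)
  · refine (integral_congr_ae (.of_forall fun u => ?_)).trans_le hnδ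
    simp only [← sub_birkhoffAverage_eq_coboundary f hn u]
    ring_nf

lemma exists_coboundary [IsProbabilityMeasure μ] (hT : Ergodic T μ) {f : α → ℝ}
    (hf : Integrable f μ) {δ : ℝ} (hδ : 0 < δ) :
    ∃ g : α → ℝ, Measurable g ∧ (∃ B', ∀ u, |g u| ≤ B') ∧
      ∫ u, |f u - ∫ v, f v ∂μ - (g u - g (T u))| ∂μ ≤ δ := by
  obtain ⟨f₁, hf₁, hf₁m⟩ := (memLp_one_iff_integrable.2 hf).exists_simpleFunc_eLpNorm_sub_lt
    (by norm_num) (ε := ENNReal.ofReal (δ / 3)) (by simpa using hδ)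
  have hf₁i : Integrable f₁ μ := memLp_one_iff_integrable.1 hf₁m
  obtain ⟨B, hB⟩ : ∃ B, ∀ u, |f₁ u| ≤ B := by
    obtain ⟨B, hB⟩ := (f₁.finite_range.image (fun x : ℝ => |x|)).bddAbove
    exact ⟨B, fun u => hB ⟨f₁ u, ⟨u, rfl⟩, rfl⟩⟩
  obtain ⟨g, hg, ⟨B', hB'⟩, hgδ⟩ := exists_coboundary_of_bounded hT f₁.measurable hB
    (show 0 < δ / 3 by positivity)
  have hgi : Integrable g μ := Integrable.of_bound hg.aestronglyMeasurable B' (.of_forall hB')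
  have hgT : Integrable (fun u => g (T u)) μ :=
    hT.toMeasurePreserving.integrable_comp_of_integrable hgi
  have hdiff : Integrable (fun u => |f u - f₁ u - ∫ v, (f v - f₁ v) ∂μ|) μ :=
    ((hf.sub hf₁i).sub (integrable_const _)).abs
  have herr : Integrable (fun u => |f₁ u - ∫ v, f₁ v ∂μ - (g u - g (T u))|) μ :=
    ((hf₁i.sub (integrable_const _)).sub (hgi.sub hgT)).abs
  have hclose : ∫ u, |f u - f₁ u - ∫ v, (f v - f₁ v) ∂μ| ∂μ ≤ 2 * (δ / 3) := by
    refine (integral_abs_sub_integral_le (hf.sub hf₁i) 0).trans ?_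
    simp only [Pi.sub_apply, sub_zero]
    gcongr
    exact integral_abs_le_of_eLpNorm_le (hf.sub hf₁i).1 (by positivity) hf₁.le
  refine ⟨g, hg, ⟨B', hB'⟩, ?_⟩
  calc ∫ u, |f u - ∫ v, f v ∂μ - (g u - g (T u))| ∂μ
      ≤ ∫ u, (|f u - f₁ u - ∫ v, (f v - f₁ v) ∂μ|
          + |f₁ u - ∫ v, f₁ v ∂μ - (g u - g (T u))|) ∂μ := by
        refine integral_mono ((hf.sub (integrable_const _)).sub (hgi.sub hgT)).abs
          (hdiff.add herr) fun u => ?_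
        refine le_of_eq_of_le (congrArg _ ?_) (abs_add_le _ _)
        rw [integral_sub hf hf₁i]
        ring
    _ = ∫ u, |f u - f₁ u - ∫ v, (f v - f₁ v) ∂μ| ∂μ
          + ∫ u, |f₁ u - ∫ v, f₁ v ∂μ - (g u - g (T u))| ∂μ := integral_add hdiff herr
    _ ≤ δ := by linarith

/-- The coboundary telescopes, and the maximal inequality bounds the sums of the error over all
windows at once. -/
theorem exists_window_sum_bound [IsProbabilityMeasure μ] (hT : Ergodic T μ) {f : α → ℝ}
    (hf : Integrable f μ) {ε θ : ℝ} (hε : 0 < ε) (hθ : 0 < θ) :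
    ∃ b : ℝ, ∀ n : ℕ, μ {u | ¬ ∀ j ≤ n,
      |∑ i ∈ Finset.Ico j n, f (T^[i] u) - (n - j) * ∫ v, f v ∂μ| ≤ ε * (n - j) + b}
      ≤ ENNReal.ofReal θ := by
  obtain ⟨g, hg, ⟨B, hB⟩, hgδ⟩ := exists_coboundary hT hf (mul_pos hε hθ)
  have hgi : Integrable g μ := Integrable.of_bound hg.aestronglyMeasurable B (.of_forall hB)
  have herr : Integrable (fun u => |f u - ∫ v, f v ∂μ - (g u - g (T u))|) μ :=
    ((hf.sub (integrable_const _)).sub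
      (hgi.sub (hT.toMeasurePreserving.integrable_comp_of_integrable hgi))).abs
  refine ⟨2 * B, fun n => (measure_mono fun u hu => ?_).trans
    ((measure_exists_sum_Ico_gt_le hT.toMeasurePreserving herr (fun u => abs_nonneg _) hε n).trans
      (ENNReal.ofReal_le_ofReal ((div_le_iff₀' hε).2 hgδ)))⟩
  simp only [Set.mem_ofPred_eq, not_forall, not_le] at hu ⊢
  obtain ⟨j, hj, hu⟩ := hu
  refine ⟨j, hj, ?_⟩
  have hsplit : ∑ i ∈ Finset.Ico j n, f (T^[i] u) - (n - j) * ∫ v, f v ∂μ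
      = ∑ i ∈ Finset.Ico j n, (f (T^[i] u) - ∫ v, f v ∂μ - (g (T^[i] u) - g (T (T^[i] u))))
        + (g (T^[j] u) - g (T^[n] u)) := by
    rw [← sum_Ico_coboundary g u hj, ← Finset.sum_add_distrib]
    simp [Finset.sum_sub_distrib, Nat.cast_sub hj]
  have hsum := Finset.abs_sum_le_sum_abs
    (fun i => f (T^[i] u) - ∫ v, f v ∂μ - (g (T^[i] u) - g (T (T^[i] u)))) (Finset.Ico j n)
  have hends : |g (T^[j] u) - g (T^[n] u)| ≤ 2 * B :=
    (abs_sub _ _).trans (by linarith [hB (T^[j] u), hB (T^[n] u)])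
  rw [hsplit] at hu
  linarith [abs_add_le (∑ i ∈ Finset.Ico j n,
    (f (T^[i] u) - ∫ v, f v ∂μ - (g (T^[i] u) - g (T (T^[i] u))))) (g (T^[j] u) - g (T^[n] u))]

end Ergodic

section Lact

variable {α β γ : Type*} [MeasurableSpace α] [MeasurableSpace β] [MeasurableSpace γ]
  {κ : Kernel α β} {F G : β → ℝ≥0∞} {c : ℝ≥0∞}

/-- The function `κ F : x ↦ ∫ F(x') κ(x, dx')` for `F` with values in `[0, ∞]`; it replaces `act`
wherever integrability should not be an issue. -/
def lact (κ : Kernel α β) (F : β → ℝ≥0∞) (x : α) : ℝ≥0∞ := ∫⁻ x', F x' ∂(κ x)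

lemma measurable_lact (κ : Kernel α β) (hF : Measurable F) : Measurable (lact κ F) :=
  hF.lintegral_kernel

lemma lact_mono (h : ∀ x, F x ≤ G x) (x : α) : lact κ F x ≤ lact κ G x :=
  lintegral_mono h

lemma lact_const_mul (κ : Kernel α β) (c : ℝ≥0∞) (hF : Measurable F) (x : α) :
    lact κ (fun x => c * F x) x = c * lact κ F x :=
  lintegral_const_mul c hF

lemma lact_le_const_mul {c : ℝ≥0∞} (hG : Measurable G) (h : ∀ x, F x ≤ c * G x) (x : α) :
    lact κ F x ≤ c * lact κ G x :=
  (lact_mono h x).trans_eq (lact_const_mul κ c hG x)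

lemma lact_one (κ : Kernel α β) (x : α) : lact κ 1 x = κ x Set.univ :=
  lintegral_one

lemma lact_indicator_one (κ : Kernel α β) {D : Set β} (hD : MeasurableSet D) (x : α) :
    lact κ (D.indicator 1) x = κ x D :=
  lintegral_indicator_one hD

lemma lact_id (hF : Measurable F) : lact Kernel.id F = F :=
  funext fun x => by rw [lact, Kernel.id_apply, lintegral_dirac' _ hF]

lemma lact_comp (κ₁ : Kernel β γ) (κ₀ : Kernel α β) {F : γ → ℝ≥0∞} (hF : Measurable F) :
    lact (κ₁ ∘ₖ κ₀) F = lact κ₀ (lact κ₁ F) :=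
  funext fun x => Kernel.lintegral_comp _ _ x hF

lemma lact_le (h : ∀ x, F x ≤ c) (x : α) : lact κ F x ≤ κ x Set.univ * c := by
  refine (lintegral_mono h).trans ?_
  rw [lintegral_const, mul_comm]

lemma mul_measure_le_lact {D : Set β} (hD : MeasurableSet D) (h : ∀ x ∈ D, c ≤ F x) (x : α) :
    c * κ x D ≤ lact κ F x := by
  rw [← setLIntegral_const]
  exact (setLIntegral_mono_ae' hD (.of_forall h)).trans (setLIntegral_le_lintegral _ _)

lemma lintegral_bind_kernel (κ : Kernel α β) (μ : Measure α) (hF : Measurable F) :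
    ∫⁻ x, F x ∂(μ.bind κ) = ∫⁻ x, lact κ F x ∂μ :=
  Measure.lintegral_bind κ.aemeasurable hF.aemeasurable

end Lact

section Window

variable {𝒳 𝒴 : Type*} [MeasurableSpace 𝒳] [MeasurableSpace 𝒴]

lemma HMM.measurable_ofReal_g (M : HMM 𝒳 𝒴) (y : 𝒴) :
    Measurable fun x => ENNReal.ofReal (M.g x y) :=
  (M.measurable_g.comp (measurable_id.prodMk measurable_const)).ennreal_ofReal

lemma HMM.measurable_uncurry_ofReal_g (M : HMM 𝒳 𝒴) (y : 𝒴) :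
    Measurable (Function.uncurry fun (x : 𝒳) (_ : 𝒳) => ENNReal.ofReal (M.g x y)) :=
  (M.measurable_ofReal_g y).comp measurable_fst

lemma HMM.lact_step (M : HMM 𝒳 𝒴) (y : 𝒴) (F : 𝒳 → ℝ≥0∞) (x : 𝒳) :
    lact (M.step y) F x = ENNReal.ofReal (M.g x y) * lact M.Q F x := by
  rw [lact, HMM.step, Kernel.withDensity_apply _ (M.measurable_uncurry_ofReal_g y),
    withDensity_const, lintegral_smul_measure, smul_eq_mul, lact]

instance HMM.isSFiniteKernel_step (M : HMM 𝒳 𝒴) (y : 𝒴) : IsSFiniteKernel (M.step y) :=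
  Kernel.IsSFiniteKernel.withDensity _ fun _ _ => ENNReal.ofReal_ne_top

instance HMM.isSFiniteKernel_L (M : HMM 𝒳 𝒴) : ∀ (n : ℕ) (z : Fin n → 𝒴), IsSFiniteKernel (M.L n z)
  | 0, _ => inferInstanceAs (IsSFiniteKernel Kernel.id)
  | n + 1, z =>
    have := M.isSFiniteKernel_L n (Fin.tail z)
    inferInstanceAs (IsSFiniteKernel (M.L n (Fin.tail z) ∘ₖ M.step (z 0)))

/-- The kernel `L⟨y_t, …, y_{t+l-1}⟩`, indexed by the length of the record rather than by its end,
so that `M.Lseg y t n = M.window y t (n - t)` by definition. -/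
def HMM.window (M : HMM 𝒳 𝒴) (y : ℕ → 𝒴) (t l : ℕ) : Kernel 𝒳 𝒳 := M.L l fun i => y (t + i)

instance (M : HMM 𝒳 𝒴) (y : ℕ → 𝒴) (t l : ℕ) : IsSFiniteKernel (M.window y t l) :=
  M.isSFiniteKernel_L l _

lemma HMM.window_zero (M : HMM 𝒳 𝒴) (y : ℕ → 𝒴) (t : ℕ) : M.window y t 0 = Kernel.id := rfl

lemma HMM.window_succ (M : HMM 𝒳 𝒴) (y : ℕ → 𝒴) (t l : ℕ) :
    M.window y t (l + 1) = M.window y (t + 1) l ∘ₖ M.step (y t) := by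
  rw [HMM.window, HMM.L, HMM.window]
  congr 2
  ext i
  rw [Fin.tail, Fin.val_succ, add_right_comm, add_assoc]

lemma HMM.window_add (M : HMM 𝒳 𝒴) (y : ℕ → 𝒴) (t a b : ℕ) :
    M.window y t (a + b) = M.window y (t + a) b ∘ₖ M.window y t a := by
  induction a generalizing t with
  | zero => rw [zero_add, add_zero, M.window_zero, Kernel.comp_id]
  | succ a ih =>
    rw [Nat.add_right_comm, M.window_succ, ih, M.window_succ, Kernel.comp_assoc,
      Nat.add_right_comm, add_assoc t a 1]

lemma HMM.lact_window_add (M : HMM 𝒳 𝒴) (y : ℕ → 𝒴) (t a b : ℕ) {F : 𝒳 → ℝ≥0∞}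
    (hF : Measurable F) : lact (M.window y t (a + b)) F
      = lact (M.window y t a) (lact (M.window y (t + a) b) F) := by
  rw [M.window_add, lact_comp _ _ hF]

lemma HMM.lact_window_succ (M : HMM 𝒳 𝒴) (y : ℕ → 𝒴) (t l : ℕ) {F : 𝒳 → ℝ≥0∞} (hF : Measurable F)
    (x : 𝒳) : lact (M.window y t (l + 1)) F x
      = ENNReal.ofReal (M.g x (y t)) * lact M.Q (lact (M.window y (t + 1) l) F) x := by
  rw [M.window_succ, lact_comp _ _ hF, M.lact_step]

lemma HMM.window_one_univ (M : HMM 𝒳 𝒴) (y : ℕ → 𝒴) (t : ℕ) (x : 𝒳) :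
    M.window y t 1 x Set.univ = ENNReal.ofReal (M.g x (y t)) := by
  rw [← lact_one, M.lact_window_succ y t 0 measurable_one, M.window_zero, lact_id measurable_one,
    lact_one, measure_univ, mul_one]

lemma HMM.lact_window_g (M : HMM 𝒳 𝒴) (y : ℕ → 𝒴) (t l : ℕ) (x : 𝒳) :
    lact (M.window y t l) (fun x => ENNReal.ofReal (M.g x (y (t + l)))) x
      = M.window y t (l + 1) x Set.univ := by
  rw [← lact_one, M.lact_window_add y t l 1 measurable_one]
  congr
  exact funext fun x => ((lact_one _ _).trans (M.window_one_univ _ _ _)).symm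

lemma HMM.lact_window_pos (M : HMM 𝒳 𝒴) (hg : ∀ x y, 0 < M.g x y) (y : ℕ → 𝒴) (t l : ℕ)
    {F : 𝒳 → ℝ≥0∞} (hF : Measurable F) (hF0 : ∀ x, 0 < F x) (x : 𝒳) :
    0 < lact (M.window y t l) F x := by
  induction l generalizing t x with
  | zero => rw [M.window_zero, lact_id hF]; exact hF0 x
  | succ l ih =>
    rw [M.lact_window_succ _ _ _ hF]
    refine ENNReal.mul_pos (ENNReal.ofReal_pos.2 (hg x (y t))).ne' (ne_of_gt ?_)
    have hsupp : Function.support (lact (M.window y (t + 1) l) F) = Set.univ :=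
      Set.eq_univ_of_forall fun x' => (ih (t + 1) x').ne'
    rw [lact, lintegral_pos_iff_support (measurable_lact _ hF), hsupp, measure_univ]
    exact zero_lt_one

lemma HMM.measurable_lact_window_prod (M : HMM 𝒳 𝒴) {β : Type*} [MeasurableSpace β]
    {y : β → ℕ → 𝒴} (hy : ∀ i, Measurable fun b => y b i) (t l : ℕ) {F : β × 𝒳 → ℝ≥0∞}
    (hF : Measurable F) :
    Measurable fun p : β × 𝒳 => lact (M.window (y p.1) t l) (fun x => F (p.1, x)) p.2 := by
  have hF' : ∀ b, Measurable fun x => F (b, x) := fun b => hF.comp measurable_prodMk_left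
  induction l generalizing t with
  | zero => simpa only [M.window_zero, lact_id (hF' _)] using hF
  | succ l ih =>
    simp only [M.lact_window_succ _ _ _ (hF' _)]
    refine (M.measurable_g.comp
      (measurable_snd.prodMk ((hy t).comp measurable_fst))).ennreal_ofReal.mul ?_
    exact Measurable.lintegral_kernel_prod_right' (κ := M.Q.comap Prod.snd measurable_snd)
      (f := fun q : (β × 𝒳) × 𝒳 =>
        lact (M.window (y q.1.1) (t + 1) l) (fun x => F (q.1.1, x)) q.2)
      ((ih (t + 1)).comp ((measurable_fst.comp measurable_fst).prodMk measurable_snd))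

/-- The factor by which the bounds `exp (a i)` of the densities accumulate over the times
`t ≤ i < s`. -/
def expSum (a : ℕ → ℝ) (t s : ℕ) : ℝ := Real.exp (∑ i ∈ Finset.Ico t s, a i)

lemma expSum_pos (a : ℕ → ℝ) (t s : ℕ) : 0 < expSum a t s := Real.exp_pos _

lemma expSum_mul (a : ℕ → ℝ) {t s m : ℕ} (h : t ≤ s) (h' : s ≤ m) :
    expSum a t s * expSum a s m = expSum a t m := by
  rw [expSum, expSum, expSum, ← Real.exp_add, Finset.sum_Ico_consecutive _ h h']

lemma ofReal_expSum_mul (a : ℕ → ℝ) {t s m : ℕ} (h : t ≤ s) (h' : s ≤ m) :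
    ENNReal.ofReal (expSum a t s) * ENNReal.ofReal (expSum a s m)
      = ENNReal.ofReal (expSum a t m) := by
  rw [← ENNReal.ofReal_mul (expSum_pos _ _ _).le, expSum_mul a h h']

lemma one_le_expSum {a : ℕ → ℝ} (ha : ∀ i, 0 ≤ a i) (t s : ℕ) : 1 ≤ expSum a t s :=
  Real.one_le_exp (Finset.sum_nonneg fun i _ => ha i)

lemma HMM.window_univ_le (M : HMM 𝒳 𝒴) {y : ℕ → 𝒴} {a : ℕ → ℝ}
    (ha : ∀ i x, M.g x (y i) ≤ Real.exp (a i)) (t l : ℕ) (x : 𝒳) :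
    M.window y t l x Set.univ ≤ ENNReal.ofReal (expSum a t (t + l)) := by
  induction l generalizing t x with
  | zero => simp [M.window_zero, Kernel.id_apply, expSum]
  | succ l ih =>
    have hstep : expSum a t (t + (l + 1))
        = Real.exp (a t) * expSum a (t + 1) (t + 1 + l) := by
      rw [expSum, Finset.sum_eq_sum_Ico_succ_bot (by omega), Real.exp_add, expSum,
        Nat.add_right_comm, add_assoc]
    rw [← lact_one, M.lact_window_succ _ _ _ measurable_one, hstep,
      ENNReal.ofReal_mul (Real.exp_pos _).le]
    gcongr
    · exact ha t x
    · refine (lact_le (fun x' => (lact_one _ x').trans_le (ih (t + 1) x')) x).trans ?_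
      rw [measure_univ, one_mul]

end Window

section Coupling

variable {β : Type*} [MeasurableSpace β] {π σ : Measure β} {S : Set β} {F F' G : β → ℝ≥0∞}
  {a b b' e ρ : ℝ≥0∞}

lemma lintegral_le_of_ae_le_add (hF' : Measurable F') (hG : Measurable G)
    (h : ∀ᵐ p ∂π, F p ≤ F' p + a * G p + b) :
    ∫⁻ p, F p ∂π ≤ ∫⁻ p, F' p ∂π + a * ∫⁻ p, G p ∂π + b * π Set.univ := by
  refine (lintegral_mono_ae h).trans_eq ?_
  rw [lintegral_add_right _ measurable_const, lintegral_add_left hF', lintegral_const_mul _ hG,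
    lintegral_const]

/-- Here `σ` is the part of `π` on which the coupling succeeds. -/
lemma setLIntegral_le_of_coupling [IsFiniteMeasure σ] (hS : MeasurableSet S)
    (hF' : Measurable F') (hG : Measurable G) (hσ : σ ≤ π.restrict S)
    (hFσ : ∫⁻ p, F p ∂σ = ∫⁻ p, F' p ∂σ) (hGσ : ∫⁻ p, G p ∂σ ≠ ∞)
    (he : e * ∫⁻ p in S, G p ∂π ≤ ∫⁻ p, G p ∂σ) (hρ : ρ + e = 1)
    (h : ∀ p ∈ S, F p ≤ F' p + a * G p + b) :
    ∫⁻ p in S, F p ∂π ≤ ∫⁻ p in S, F' p ∂π + ρ * a * ∫⁻ p in S, G p ∂π + b * π S := by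
  set k := π.restrict S - σ
  have hk : π.restrict S = k + σ := (Measure.sub_add_cancel_of_le hσ).symm
  have hsplit (H : β → ℝ≥0∞) : ∫⁻ p in S, H p ∂π = ∫⁻ p, H p ∂k + ∫⁻ p, H p ∂σ := by
    rw [hk, lintegral_add_measure]
  have hkS : k ≤ π.restrict S := Measure.sub_le
  have hle : ∫⁻ p, F p ∂k ≤ ∫⁻ p, F' p ∂k + a * ∫⁻ p, G p ∂k + b * k Set.univ :=
    lintegral_le_of_ae_le_add hF' hG
      (hkS.absolutelyContinuous.ae_le (ae_restrict_of_forall_mem hS h))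
  have hGk : ∫⁻ p, G p ∂k ≤ ρ * ∫⁻ p in S, G p ∂π := by
    refine ENNReal.le_of_add_le_add_right hGσ ?_
    rw [← hsplit]
    calc ∫⁻ p in S, G p ∂π = ρ * ∫⁻ p in S, G p ∂π + e * ∫⁻ p in S, G p ∂π := by
          rw [← add_mul, hρ, one_mul]
      _ ≤ ρ * ∫⁻ p in S, G p ∂π + ∫⁻ p, G p ∂σ := by gcongr
  calc ∫⁻ p in S, F p ∂π
      ≤ ∫⁻ p, F' p ∂k + a * ∫⁻ p, G p ∂k + b * k Set.univ + ∫⁻ p, F' p ∂σ := by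
        rw [hsplit, hFσ]
        gcongr
    _ = ∫⁻ p in S, F' p ∂π + a * ∫⁻ p, G p ∂k + b * k Set.univ := by rw [hsplit]; ring
    _ ≤ ∫⁻ p in S, F' p ∂π + a * (ρ * ∫⁻ p in S, G p ∂π) + b * π S := by
        have hkS' : k Set.univ ≤ π S := (hkS Set.univ).trans_eq (Measure.restrict_apply_univ S)
        exact add_le_add (add_le_add le_rfl (mul_le_mul_right hGk a)) (mul_le_mul_right hkS' b)
    _ = _ := by ring

lemma lintegral_le_of_coupling [IsFiniteMeasure σ] (hS : MeasurableSet S) (hF' : Measurable F')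
    (hG : Measurable G) (hσ : σ ≤ π.restrict S) (hFσ : ∫⁻ p, F p ∂σ = ∫⁻ p, F' p ∂σ)
    (hGσ : ∫⁻ p, G p ∂σ ≠ ∞) (he : e * ∫⁻ p in S, G p ∂π ≤ ∫⁻ p, G p ∂σ) (hρ : ρ + e = 1)
    (h : ∀ p ∈ S, F p ≤ F' p + a * G p + b) (h' : ∀ p ∉ S, F p ≤ F' p + ρ * a * G p + b') :
    ∫⁻ p, F p ∂π
      ≤ ∫⁻ p, F' p ∂π + ρ * a * ∫⁻ p, G p ∂π + (b + b') * π Set.univ := by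
  have hon := setLIntegral_le_of_coupling hS hF' hG hσ hFσ hGσ he hρ h
  have hoff : ∫⁻ p in Sᶜ, F p ∂π
      ≤ ∫⁻ p in Sᶜ, F' p ∂π + ρ * a * ∫⁻ p in Sᶜ, G p ∂π + b' * π Sᶜ := by
    simpa using lintegral_le_of_ae_le_add (π := π.restrict Sᶜ) hF' hG
      (ae_restrict_of_forall_mem hS.compl h')
  rw [← lintegral_add_compl F hS, ← lintegral_add_compl F' hS, ← lintegral_add_compl G hS]
  calc ∫⁻ p in S, F p ∂π + ∫⁻ p in Sᶜ, F p ∂π ≤ _ := add_le_add hon hoff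
    _ = ∫⁻ p in S, F' p ∂π + ∫⁻ p in Sᶜ, F' p ∂π
        + ρ * a * (∫⁻ p in S, G p ∂π + ∫⁻ p in Sᶜ, G p ∂π) + (b * π S + b' * π Sᶜ) := by ring
    _ ≤ _ := by
        rw [add_mul]
        gcongr <;> exact Set.subset_univ _

end Coupling

section Doeblin

variable {𝒳 : Type*} [MeasurableSpace 𝒳] {κ κ₀ κ₁ : Kernel 𝒳 𝒳} {C D : Set 𝒳}
  {e η ρ N N₀ N₁ : ℝ≥0∞}

/-- On `C`, the restriction of `κ` to `C` is comparable, up to the factor `e`, to multiples of one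
finite measure. -/
def IsDoeblinOn (κ : Kernel 𝒳 𝒳) (C : Set 𝒳) (e : ℝ≥0∞) : Prop :=
  ∃ (lam : Measure 𝒳) (c : 𝒳 → ℝ≥0∞), IsFiniteMeasure lam ∧ (∀ x, c x ≠ ∞) ∧
    ∀ x ∈ C, (e * c x) • lam ≤ (κ x).restrict C ∧ (κ x).restrict C ≤ c x • lam

/-- The masses of `κ` are at most `N`, and at most `η N` off `C`. -/
def IsSmallOff (κ : Kernel 𝒳 𝒳) (C : Set 𝒳) (η N : ℝ≥0∞) : Prop :=
  (∀ x, κ x Set.univ ≤ N) ∧ ∀ x ∉ C, κ x Set.univ ≤ η * N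

/-- Two successive kernels that are small off `C`, the first of which satisfies the Doeblin
condition on `C`. A pair of points moved by `κ₀` couples if it starts and lands in `C × C`; if it
lands elsewhere then `κ₁` makes its weight small. -/
structure IsDoeblinPair (κ₀ κ₁ : Kernel 𝒳 𝒳) (C : Set 𝒳) (e η N₀ N₁ : ℝ≥0∞) : Prop where
  measurableSet : MeasurableSet C
  doeblin : IsDoeblinOn κ₀ C e
  small₀ : IsSmallOff κ₀ C η N₀
  small₁ : IsSmallOff κ₁ C η N₁

lemma IsSmallOff.mul_le (h : IsSmallOff κ C η N) {p : 𝒳 × 𝒳} (hp : p ∉ C ×ˢ C) :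
    κ p.1 Set.univ * κ p.2 Set.univ ≤ η * N ^ 2 := by
  rw [sq, Set.mem_prod, not_and_or] at *
  rcases hp with hp | hp
  · exact (mul_le_mul' (h.2 _ hp) (h.1 _)).trans_eq (mul_assoc _ _ _)
  · exact (mul_le_mul' (h.1 _) (h.2 _ hp)).trans_eq (mul_left_comm _ _ _)

lemma prod_apply_univ (μ μ' : Measure 𝒳) [SFinite μ'] :
    (μ.prod μ') Set.univ = μ Set.univ * μ' Set.univ := by
  rw [← Set.univ_prod_univ, Measure.prod_prod]

lemma mass_mul_mass_le (hN : ∀ x, κ x Set.univ ≤ N) (x y : 𝒳) :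
    κ x Set.univ * κ y Set.univ ≤ N ^ 2 :=
  (mul_le_mul' (hN x) (hN y)).trans_eq (sq N).symm

/-- Two functions can be exchanged in a product `κ f (x) · κ f' (y)`, up to the factor `a` and
an additive error `b`. -/
def SwapBound (κ : Kernel 𝒳 𝒳) (a b : ℝ≥0∞) : Prop :=
  ∀ ⦃f f' : 𝒳 → ℝ≥0∞⦄ ⦃F F' : ℝ≥0∞⦄, Measurable f → Measurable f' → (∀ x, f x ≤ F) →
    (∀ x, f' x ≤ F') → ∀ x y,
    lact κ f x * lact κ f' y ≤ a * (lact κ f' x * lact κ f y) + b * (F * F')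

lemma lact_mul_lact_le {f f' : 𝒳 → ℝ≥0∞} {F F' : ℝ≥0∞} (hF : ∀ x, f x ≤ F) (hF' : ∀ x, f' x ≤ F')
    (x y : 𝒳) :
    lact κ f x * lact κ f' y ≤ κ x Set.univ * κ y Set.univ * (F * F') :=
  (mul_le_mul' (lact_le hF x) (lact_le hF' y)).trans_eq (mul_mul_mul_comm _ _ _ _)

lemma swapBound_of_le (hN : ∀ x, κ x Set.univ ≤ N) (a : ℝ≥0∞) : SwapBound κ a (N ^ 2) := by
  intro f f' F F' _ _ hF hF' x y
  refine (lact_mul_lact_le hF hF' x y).trans (le_trans ?_ le_add_self)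
  gcongr
  exact mass_mul_mass_le hN x y

lemma IsDoeblinOn.setLIntegral_mul_le (h : IsDoeblinOn κ C e) (he0 : e ≠ 0) (he : e ≠ ∞)
    (w w' : 𝒳 → ℝ≥0∞) {x y : 𝒳} (hx : x ∈ C) (hy : y ∈ C) :
    (∫⁻ a in C, w a ∂κ x) * ∫⁻ b in C, w' b ∂κ y
      ≤ e⁻¹ ^ 2 * (lact κ w' x * lact κ w y) := by
  obtain ⟨lam, c, -, -, hlam⟩ := h
  have hup (w : 𝒳 → ℝ≥0∞) {a : 𝒳} (ha : a ∈ C) : ∫⁻ b in C, w b ∂κ a ≤ c a * ∫⁻ b, w b ∂lam :=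
    (lintegral_mono' (hlam a ha).2 le_rfl).trans_eq (lintegral_smul_measure _ _)
  have hlow (w : 𝒳 → ℝ≥0∞) {a : 𝒳} (ha : a ∈ C) : e * c a * ∫⁻ b, w b ∂lam ≤ lact κ w a :=
    (lintegral_smul_measure _ _).symm.trans_le
      ((lintegral_mono' (hlam a ha).1 le_rfl).trans (setLIntegral_le_lintegral C w))
  calc (∫⁻ a in C, w a ∂κ x) * ∫⁻ b in C, w' b ∂κ y
      ≤ (c x * ∫⁻ b, w b ∂lam) * (c y * ∫⁻ b, w' b ∂lam) := mul_le_mul' (hup w hx) (hup w' hy)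
    _ = (e⁻¹ * e) ^ 2 * ((c x * ∫⁻ b, w b ∂lam) * (c y * ∫⁻ b, w' b ∂lam)) := by
        rw [ENNReal.inv_mul_cancel he0 he, one_pow, one_mul]
    _ = e⁻¹ ^ 2 * ((e * c x * ∫⁻ b, w' b ∂lam) * (e * c y * ∫⁻ b, w b ∂lam)) := by ring
    _ ≤ _ := by gcongr <;> apply hlow <;> assumption

lemma IsDoeblinPair.swapBound [IsSFiniteKernel κ₀] (h : IsDoeblinPair κ₀ κ₁ C e η N₀ N₁)
    (he0 : e ≠ 0) (he : e ≠ ∞) :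
    SwapBound (κ₁ ∘ₖ κ₀) (e⁻¹ ^ 2) (η * (N₀ * N₁) ^ 2) := by
  intro f f' F F' hf hf' hF hF' x y
  have hS : MeasurableSet (C ×ˢ C) := h.measurableSet.prod h.measurableSet
  have hw := measurable_lact κ₁ hf
  have hw' := measurable_lact κ₁ hf'
  have hle (p : 𝒳 × 𝒳) : lact κ₁ f p.1 * lact κ₁ f' p.2
      ≤ κ₁ p.1 Set.univ * κ₁ p.2 Set.univ * (F * F') := lact_mul_lact_le hF hF' _ _
  rw [lact_comp _ _ hf, lact_comp _ _ hf']
  set π := (κ₀ x).prod (κ₀ y)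
  have hπ : π Set.univ = κ₀ x Set.univ * κ₀ y Set.univ := prod_apply_univ _ _
  have hprod : lact κ₀ (lact κ₁ f) x * lact κ₀ (lact κ₁ f') y
      = ∫⁻ p, lact κ₁ f p.1 * lact κ₁ f' p.2 ∂π :=
    (lintegral_prod_mul hw.aemeasurable hw'.aemeasurable).symm
  by_cases hxy : (x, y) ∈ C ×ˢ C
  · rw [hprod, ← lintegral_add_compl _ hS]
    refine add_le_add ?_ ?_
    · rw [← Measure.prod_restrict, lintegral_prod_mul hw.aemeasurable hw'.aemeasurable]
      exact h.doeblin.setLIntegral_mul_le he0 he _ _ hxy.1 hxy.2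
    · calc ∫⁻ p in (C ×ˢ C)ᶜ, lact κ₁ f p.1 * lact κ₁ f' p.2 ∂π
          ≤ ∫⁻ _ in (C ×ˢ C)ᶜ, η * N₁ ^ 2 * (F * F') ∂π :=
            setLIntegral_mono measurable_const fun _ hp =>
              (hle _).trans (mul_le_mul_left (h.small₁.mul_le hp) _)
        _ ≤ η * N₁ ^ 2 * (F * F') * N₀ ^ 2 := by
            rw [setLIntegral_const]
            gcongr
            exact (measure_mono (Set.subset_univ _)).trans
              (hπ.trans_le (mass_mul_mass_le h.small₀.1 x y))
        _ = _ := by ring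
  · rw [hprod]
    refine le_trans ?_ le_add_self
    calc ∫⁻ p, lact κ₁ f p.1 * lact κ₁ f' p.2 ∂π ≤ ∫⁻ _, N₁ ^ 2 * (F * F') ∂π :=
          lintegral_mono fun p =>
            (hle p).trans (mul_le_mul_left (mass_mul_mass_le h.small₁.1 _ _) _)
      _ ≤ N₁ ^ 2 * (F * F') * (η * N₀ ^ 2) := by
          rw [lintegral_const, hπ]
          exact mul_le_mul_right (h.small₀.mul_le hxy) _
      _ = _ := by ring

end Doeblin

section PairBound

variable {𝒳 : Type*} {u v : 𝒳 → ℝ≥0∞} {α α' β β' : ℝ≥0∞}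

/-- The cross products of `u` and `v` are symmetric up to an error. If `v > 0` then `u / v`
oscillates by at most `α` plus a remainder. -/
def PairBound (u v : 𝒳 → ℝ≥0∞) (α β : ℝ≥0∞) : Prop :=
  ∀ x x', u x * v x' ≤ u x' * v x + α * (v x * v x') + β

lemma PairBound.mono (h : PairBound u v α β) (hα : α ≤ α') (hβ : β ≤ β') : PairBound u v α' β' :=
  fun x x' => (h x x').trans (by gcongr)

variable [MeasurableSpace 𝒳] {κ κ₀ κ₁ : Kernel 𝒳 𝒳} {C : Set 𝒳} {e η ρ N N₀ N₁ V : ℝ≥0∞}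

lemma PairBound.lintegral_mul_le (h : PairBound u v α β) (hu : Measurable u) (hv : Measurable v)
    (μ μ' : Measure 𝒳) [SFinite μ] [SFinite μ'] :
    (∫⁻ x, u x ∂μ) * (∫⁻ x, v x ∂μ')
      ≤ (∫⁻ x, u x ∂μ') * (∫⁻ x, v x ∂μ) + α * ((∫⁻ x, v x ∂μ) * ∫⁻ x, v x ∂μ')
        + β * (μ Set.univ * μ' Set.univ) := by
  have hle := lintegral_le_of_ae_le_add (π := μ.prod μ') (F := fun p => u p.1 * v p.2)
    (F' := fun p => v p.1 * u p.2) (G := fun p => v p.1 * v p.2) (by fun_prop) (by fun_prop)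
    (.of_forall fun p => (h p.1 p.2).trans_eq (by rw [mul_comm (u p.2)]))
  rwa [lintegral_prod_mul hu.aemeasurable hv.aemeasurable,
    lintegral_prod_mul hv.aemeasurable hu.aemeasurable,
    lintegral_prod_mul hv.aemeasurable hv.aemeasurable, prod_apply_univ,
    mul_comm (∫⁻ x, v x ∂μ) (∫⁻ x, u x ∂μ')] at hle

lemma PairBound.lact [IsSFiniteKernel κ] (h : PairBound u v α β) (hu : Measurable u)
    (hv : Measurable v) (hN : ∀ x, κ x Set.univ ≤ N) :
    PairBound (lact κ u) (lact κ v) α (N ^ 2 * β) := fun x x' =>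
  (h.lintegral_mul_le hu hv (κ x) (κ x')).trans
    (add_le_add_right ((mul_le_mul_right (mass_mul_mass_le hN x x') β).trans_eq (mul_comm _ _)) _)

/-- The pairs of points that both follow the common measure of the Doeblin condition are
exchangeable, hence couple. -/
lemma PairBound.lact_mul_lact_le_of_doeblin [IsSFiniteKernel κ] (hC : MeasurableSet C)
    (hd : IsDoeblinOn κ C e) (hρ : ρ + e ^ 2 = 1) (hu : Measurable u) (hv : Measurable v)
    (hV : V ≠ ∞) (hvV : ∀ x, v x ≤ V) (h : PairBound u v α β)
    (h' : ∀ p ∉ C ×ˢ C, u p.1 * v p.2 ≤ u p.2 * v p.1 + ρ * α * (v p.1 * v p.2) + β')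
    {x x' : 𝒳} (hx : x ∈ C) (hx' : x' ∈ C) :
    ParticleFilter.lact κ u x * ParticleFilter.lact κ v x'
      ≤ ParticleFilter.lact κ u x' * ParticleFilter.lact κ v x
        + ρ * α * (ParticleFilter.lact κ v x * ParticleFilter.lact κ v x')
        + (β + β') * (κ x Set.univ * κ x' Set.univ) := by
  obtain ⟨lam, c, hfin, hc, hlam⟩ := hd
  have he : e ≠ ∞ := by rintro rfl; simp at hρ
  have hfin' (x : 𝒳) : IsFiniteMeasure ((e * c x) • lam) :=
    lam.smul_finite (ENNReal.mul_ne_top he (hc x))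
  have hvlam : ∫⁻ a, v a ∂lam ≠ ∞ := by
    refine ne_top_of_le_ne_top (ENNReal.mul_ne_top hV (measure_ne_top lam Set.univ)) ?_
    exact (lintegral_mono hvV).trans_eq (lintegral_const V)
  set σ := ((e * c x) • lam).prod ((e * c x') • lam)
  have hσ (f f' : 𝒳 → ℝ≥0∞) (hf : Measurable f) (hf' : Measurable f') :
      ∫⁻ p, f p.1 * f' p.2 ∂σ
        = e ^ 2 * ((c x * ∫⁻ a, f a ∂lam) * (c x' * ∫⁻ a, f' a ∂lam)) := by
    rw [lintegral_prod_mul hf.aemeasurable hf'.aemeasurable, lintegral_smul_measure,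
      lintegral_smul_measure, smul_eq_mul, smul_eq_mul]
    ring
  have hup {a : 𝒳} (ha : a ∈ C) : ∫⁻ b in C, v b ∂κ a ≤ c a * ∫⁻ b, v b ∂lam :=
    (lintegral_mono' (hlam a ha).2 le_rfl).trans_eq (lintegral_smul_measure _ _)
  have hle := lintegral_le_of_coupling (π := (κ x).prod (κ x')) (σ := σ) (e := e ^ 2)
    (F := fun p => u p.1 * v p.2) (F' := fun p => v p.1 * u p.2) (G := fun p => v p.1 * v p.2)
    (hC.prod hC) (by fun_prop) (by fun_prop)
    ((Measure.prod_mono (hlam x hx).1 (hlam x' hx').1).trans_eq (Measure.prod_restrict C C))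
    (by rw [hσ u v hu hv, hσ v u hv hu]; ring)
    (by
      rw [hσ v v hv hv]
      exact ENNReal.mul_ne_top (ENNReal.pow_ne_top he)
        (ENNReal.mul_ne_top (ENNReal.mul_ne_top (hc x) hvlam)
          (ENNReal.mul_ne_top (hc x') hvlam)))
    (by
      rw [hσ v v hv hv, ← Measure.prod_restrict,
        lintegral_prod_mul hv.aemeasurable hv.aemeasurable]
      exact mul_le_mul_right (mul_le_mul' (hup hx) (hup hx')) _)
    hρ (fun p _ => (h p.1 p.2).trans_eq (by rw [mul_comm (u p.2)]))
    (fun p hp => (h' p hp).trans_eq (by rw [mul_comm (u p.2)]))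
  rwa [lintegral_prod_mul hu.aemeasurable hv.aemeasurable,
    lintegral_prod_mul hv.aemeasurable hu.aemeasurable,
    lintegral_prod_mul hv.aemeasurable hv.aemeasurable, prod_apply_univ,
    mul_comm (∫⁻ x, v x ∂κ x) (∫⁻ x, u x ∂κ x')] at hle

lemma PairBound.comp_of_doeblin [IsSFiniteKernel κ₀] [IsSFiniteKernel κ₁]
    (hκ : IsDoeblinPair κ₀ κ₁ C e η N₀ N₁) (hρ : ρ + e ^ 2 = 1) (hN₁ : N₁ ≠ ∞)
    (hu : Measurable u) (hv : Measurable v) (hV : V ≠ ∞) (hvV : ∀ x, v x ≤ V)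
    (h : PairBound u v α β) (h' : PairBound u v (ρ * α) β') :
    PairBound (ParticleFilter.lact (κ₁ ∘ₖ κ₀) u) (ParticleFilter.lact (κ₁ ∘ₖ κ₀) v) (ρ * α)
      ((N₀ * N₁) ^ 2 * (β + η * β')) := by
  rw [lact_comp _ _ hu, lact_comp _ _ hv]
  have hu' := measurable_lact κ₁ hu
  have hv' := measurable_lact κ₁ hv
  intro x x'
  by_cases hxx : (x, x') ∈ C ×ˢ C
  · refine ((h.lact hu hv hκ.small₁.1).lact_mul_lact_le_of_doeblin (β' := N₁ ^ 2 * (η * β'))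
      hκ.measurableSet hκ.doeblin hρ hu' hv' (ENNReal.mul_ne_top hN₁ hV)
      (fun a => (lact_le hvV a).trans (mul_le_mul_left (hκ.small₁.1 a) V))
      (fun p hp => (h'.lintegral_mul_le hu hv (κ₁ p.1) (κ₁ p.2)).trans (add_le_add_right
        ((mul_le_mul_right (hκ.small₁.mul_le hp) β').trans_eq (by ring)) _))
      hxx.1 hxx.2).trans (add_le_add_right ?_ _)
    refine (mul_le_mul_right (mass_mul_mass_le hκ.small₀.1 x x') _).trans_eq ?_
    ring
  · refine ((h'.lact hu hv hκ.small₁.1).lintegral_mul_le hu' hv' (κ₀ x) (κ₀ x')).trans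
      (add_le_add_right ?_ _)
    calc N₁ ^ 2 * β' * (κ₀ x Set.univ * κ₀ x' Set.univ) ≤ N₁ ^ 2 * β' * (η * N₀ ^ 2) :=
          mul_le_mul_right (hκ.small₀.mul_le hxx) _
      _ = (N₀ * N₁) ^ 2 * (η * β') := by ring
      _ ≤ _ := mul_le_mul_right le_add_self _

end PairBound

section Ratio

variable {𝒳 : Type*} [MeasurableSpace 𝒳] {κ : Kernel 𝒳 𝒳} {D : Set 𝒳} {v : 𝒳 → ℝ≥0∞}
  {a b q R X : ℝ≥0∞}

/-- The ratio of `⨆ v` to `⨅ v` over `D` is at most `R`. -/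
def RatioBound (D : Set 𝒳) (v : 𝒳 → ℝ≥0∞) (R : ℝ≥0∞) : Prop :=
  ∀ x, ∀ y ∈ D, v x ≤ R * v y

/-- The masses of `κ` are at most `q`, and from a point of `D` a mass at least `1 / q` returns
to `D`. -/
structure IsReturnBound (κ : Kernel 𝒳 𝒳) (D : Set 𝒳) (q : ℝ≥0∞) : Prop where
  measurableSet : MeasurableSet D
  univ_le : ∀ x, κ x Set.univ ≤ q
  one_le : ∀ y ∈ D, 1 ≤ q * κ y D

lemma IsReturnBound.one_le_mul_univ (h : IsReturnBound κ D q) {y : 𝒳} (hy : y ∈ D) :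
    1 ≤ q * κ y Set.univ :=
  (h.one_le y hy).trans (by gcongr; exact Set.subset_univ D)

lemma RatioBound.le_lact (hv : RatioBound D v R) (hvm : Measurable v) (h : IsReturnBound κ D q)
    (x : 𝒳) {y : 𝒳} (hy : y ∈ D) : v x ≤ q * R * lact κ v y := by
  calc v x ≤ v x * (q * κ y D) := le_mul_of_one_le_right' (h.one_le y hy)
    _ = q * (v x * κ y D) := mul_left_comm _ _ _
    _ ≤ q * lact κ (fun z => R * v z) y := by
        gcongr
        exact mul_measure_le_lact h.measurableSet (fun z hz => hv x z hz) y
    _ = q * R * lact κ v y := by rw [lact_const_mul _ _ hvm, mul_assoc]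

lemma RatioBound.lact (hv : RatioBound D v R) (hvm : Measurable v) (h : IsReturnBound κ D q)
    (hs : SwapBound κ a b) :
    RatioBound D (lact κ v) (a * q ^ 2 + b * q ^ 2 * R) := by
  intro x y hy
  have hswap := hs hvm measurable_one (fun z => hv.le_lact hvm h z hy) (fun _ => le_refl 1) x y
  rw [lact_one, lact_one] at hswap
  calc ParticleFilter.lact κ v x
      ≤ ParticleFilter.lact κ v x * (q * κ y Set.univ) :=
        le_mul_of_one_le_right' (h.one_le_mul_univ hy)
    _ = q * (ParticleFilter.lact κ v x * κ y Set.univ) := mul_left_comm _ _ _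
    _ ≤ q * (a * (q * ParticleFilter.lact κ v y)
          + b * (q * R * ParticleFilter.lact κ v y * 1)) := by
        refine mul_le_mul_right (hswap.trans ?_) _
        gcongr
        exact h.univ_le x
    _ = _ := by ring

lemma IsReturnBound.measure_le_bind (h : IsReturnBound κ D q) (μ : Measure 𝒳) :
    μ D ≤ q * μ.bind κ D := by
  rw [Measure.bind_apply h.measurableSet κ.aemeasurable,
    ← lintegral_const_mul _ (κ.measurable_coe h.measurableSet)]
  calc μ D = ∫⁻ _ in D, 1 ∂μ := (setLIntegral_one D).symm
    _ ≤ ∫⁻ x in D, q * κ x D ∂μ := setLIntegral_mono_ae' h.measurableSet (.of_forall h.one_le)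
    _ ≤ _ := setLIntegral_le_lintegral _ _

lemma IsReturnBound.bind_univ_le (h : IsReturnBound κ D q) (hs : SwapBound κ a b)
    (hD : D.Nonempty) {μ : Measure 𝒳} (hμ : μ Set.univ ≤ X * μ D) :
    μ.bind κ Set.univ ≤ (a * q ^ 2 + b * q ^ 2 * X) * μ.bind κ D := by
  obtain ⟨y, hy⟩ := hD
  have hle (x : 𝒳) : κ x Set.univ ≤ a * q ^ 2 * κ x D + q * b := by
    have hswap := hs (F := 1) (F' := 1) measurable_one
      (measurable_one.indicator h.measurableSet) (fun _ => le_refl 1)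
      (Set.indicator_le_self' fun _ _ => zero_le_one) x y
    rw [lact_one, lact_one, lact_indicator_one _ h.measurableSet,
      lact_indicator_one _ h.measurableSet] at hswap
    calc κ x Set.univ ≤ κ x Set.univ * (q * κ y D) := le_mul_of_one_le_right' (h.one_le y hy)
      _ = q * (κ x Set.univ * κ y D) := mul_left_comm _ _ _
      _ ≤ q * (a * (κ x D * q) + b * (1 * 1)) := by
          refine mul_le_mul_right (hswap.trans ?_) _
          gcongr
          exact h.univ_le y
      _ = _ := by ring
  calc μ.bind κ Set.univ ≤ ∫⁻ x, (a * q ^ 2 * κ x D + q * b) ∂μ :=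
        (Measure.bind_apply .univ κ.aemeasurable).trans_le (lintegral_mono hle)
    _ = a * q ^ 2 * μ.bind κ D + q * b * μ Set.univ := by
        rw [lintegral_add_right _ measurable_const, lintegral_const,
          lintegral_const_mul _ (κ.measurable_coe h.measurableSet),
          Measure.bind_apply h.measurableSet κ.aemeasurable]
    _ ≤ a * q ^ 2 * μ.bind κ D + q * b * (X * (q * μ.bind κ D)) := by
        gcongr
        exact hμ.trans (by gcongr; exact h.measure_le_bind μ)
    _ = _ := by ring

end Ratio

section Record

variable {𝒳 𝒴 : Type*} [MeasurableSpace 𝒳] [MeasurableSpace 𝒴]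

/-- Bounds for the densities and kernels along a record `y`: `a` bounds the logarithms of the
densities from above, and minus the logarithms of the return masses to `D`; the blocks of length `r`
that start at a time of `S` satisfy the Doeblin condition on `C` with ratio `e` and are smaller
off `C` by the factor `exp (-2Θ)`. The factor is a square because the forgetting of the initial
state spends one half of it on the decay of the coupling term. -/
structure HMM.Record (M : HMM 𝒳 𝒴) (y : ℕ → 𝒴) (r : ℕ) (C D : Set 𝒳) (e Θ : ℝ) (a : ℕ → ℝ)
    (S : Set ℕ) : Prop where
  measC : MeasurableSet C
  measD : MeasurableSet D
  nonempty : D.Nonempty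
  one_le : 1 ≤ r
  nonneg : ∀ i, 0 ≤ a i
  g_le : ∀ i x, M.g x (y i) ≤ Real.exp (a i)
  le_return : ∀ i, ∀ x ∈ D, ENNReal.ofReal (Real.exp (-a i)) ≤ M.window y i r x D
  doeblin : ∀ i ∈ S, IsDoeblinOn (M.window y i r) C (ENNReal.ofReal e)
  small : ∀ i ∈ S, ∀ x ∉ C, M.window y i r x Set.univ
    ≤ ENNReal.ofReal (Real.exp (-Θ)) ^ 2 * ENNReal.ofReal (expSum a i (i + r))

/-- The factor that a pair of successive blocks gains by being small off `C`. -/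
def pairCoeff (S : Set ℕ) (r : ℕ) (Θ : ℝ) (t : ℕ) : ℝ :=
  open Classical in if t ∈ S ∧ t + r ∈ S then Real.exp (-Θ) ^ 2 else 1

lemma pairCoeff_pos (S : Set ℕ) (r : ℕ) (Θ : ℝ) (t : ℕ) : 0 < pairCoeff S r Θ t := by
  rw [pairCoeff]
  split_ifs <;> positivity

lemma ofReal_expSum_two_mul (a : ℕ → ℝ) (t r : ℕ) :
    ENNReal.ofReal (expSum a t (t + r)) * ENNReal.ofReal (expSum a (t + r) (t + r + r))
      = ENNReal.ofReal (expSum a t (t + 2 * r)) := by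
  rw [ofReal_expSum_mul a (by omega) (by omega), two_mul, add_assoc]

variable {M : HMM 𝒳 𝒴} {y : ℕ → 𝒴} {r : ℕ} {C D : Set 𝒳} {e Θ : ℝ} {a : ℕ → ℝ} {S : Set ℕ}

lemma HMM.window_two_mul (M : HMM 𝒳 𝒴) (y : ℕ → 𝒴) (r t : ℕ) :
    M.window y t (2 * r) = M.window y (t + r) r ∘ₖ M.window y t r := by
  rw [two_mul, M.window_add]

namespace HMM.Record

lemma window_univ_le (h : M.Record y r C D e Θ a S) (t l : ℕ) (x : 𝒳) :
    M.window y t l x Set.univ ≤ ENNReal.ofReal (expSum a t (t + l)) :=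
  M.window_univ_le h.g_le t l x

lemma one_le_expSum (h : M.Record y r C D e Θ a S) (t s : ℕ) : 1 ≤ expSum a t s :=
  ParticleFilter.one_le_expSum h.nonneg t s

lemma isSmallOff (h : M.Record y r C D e Θ a S) {t : ℕ} (ht : t ∈ S) :
    IsSmallOff (M.window y t r) C (ENNReal.ofReal (Real.exp (-Θ)) ^ 2)
      (ENNReal.ofReal (expSum a t (t + r))) :=
  ⟨h.window_univ_le t r, h.small t ht⟩

lemma isDoeblinPair (h : M.Record y r C D e Θ a S) {t : ℕ} (ht : t ∈ S) (ht' : t + r ∈ S) :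
    IsDoeblinPair (M.window y t r) (M.window y (t + r) r) C (ENNReal.ofReal e)
      (ENNReal.ofReal (Real.exp (-Θ)) ^ 2) (ENNReal.ofReal (expSum a t (t + r)))
      (ENNReal.ofReal (expSum a (t + r) (t + r + r))) :=
  ⟨h.measC, h.doeblin t ht, h.isSmallOff ht, h.isSmallOff ht'⟩

lemma swapBound (he : 0 < e) (h : M.Record y r C D e Θ a S) (t : ℕ) :
    SwapBound (M.window y t (2 * r)) ((ENNReal.ofReal e)⁻¹ ^ 2)
      (ENNReal.ofReal (pairCoeff S r Θ t) * ENNReal.ofReal (expSum a t (t + 2 * r)) ^ 2) := by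
  rw [pairCoeff]
  split_ifs with hS
  · rw [M.window_two_mul, ← ofReal_expSum_two_mul a t r, ENNReal.ofReal_pow (Real.exp_pos _).le]
    exact (h.isDoeblinPair hS.1 hS.2).swapBound (ENNReal.ofReal_pos.2 he).ne'
      ENNReal.ofReal_ne_top
  · rw [ENNReal.ofReal_one, one_mul]
    exact swapBound_of_le (h.window_univ_le t (2 * r)) _

lemma le_return_two (h : M.Record y r C D e Θ a S) (t : ℕ) {x : 𝒳} (hx : x ∈ D) :
    ENNReal.ofReal (Real.exp (-(a t + a (t + r)))) ≤ M.window y t (2 * r) x D := by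
  rw [neg_add_rev, Real.exp_add, ENNReal.ofReal_mul (Real.exp_pos _).le, M.window_two_mul,
    ← lact_indicator_one _ h.measD, lact_comp _ _ (measurable_one.indicator h.measD)]
  exact (mul_le_mul_right (h.le_return t x hx) _).trans (mul_measure_le_lact h.measD
    (fun z hz => (h.le_return (t + r) z hz).trans_eq (lact_indicator_one _ h.measD z).symm) x)

lemma add_le_sum (h : M.Record y r C D e Θ a S) (t : ℕ) :
    a t + a (t + r) ≤ ∑ i ∈ Finset.Ico t (t + 2 * r), a i := by
  have hr := h.one_le
  rw [← Finset.sum_pair (f := a) (show t ≠ t + r by omega)]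
  refine Finset.sum_le_sum_of_subset_of_nonneg (fun i hi => ?_) fun i _ _ => h.nonneg i
  simp only [Finset.mem_insert, Finset.mem_singleton] at hi
  rw [Finset.mem_Ico]
  omega

lemma isReturnBound (h : M.Record y r C D e Θ a S) (t : ℕ) :
    IsReturnBound (M.window y t (2 * r)) D (ENNReal.ofReal (expSum a t (t + 2 * r))) where
  measurableSet := h.measD
  univ_le := h.window_univ_le t (2 * r)
  one_le x hx := by
    have hE : 1 ≤ expSum a t (t + 2 * r) * Real.exp (-(a t + a (t + r))) := by
      rw [expSum, ← Real.exp_add]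
      exact Real.one_le_exp (by linarith [h.add_le_sum t])
    calc (1 : ℝ≥0∞) ≤ ENNReal.ofReal (expSum a t (t + 2 * r))
          * ENNReal.ofReal (Real.exp (-(a t + a (t + r)))) := by
          rw [← ENNReal.ofReal_mul (expSum_pos _ _ _).le]
          exact ENNReal.one_le_ofReal.2 hE
      _ ≤ _ := mul_le_mul_right (h.le_return_two t hx) _

end HMM.Record

lemma ofReal_step_coeff (he : 0 < e) {p E R : ℝ} (hp : 0 ≤ p) (hE : 0 ≤ E) (hR : 0 ≤ R) :
    ENNReal.ofReal (e⁻¹ ^ 2 * E ^ 2 + p * E ^ 4 * R)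
      = (ENNReal.ofReal e)⁻¹ ^ 2 * ENNReal.ofReal E ^ 2
        + ENNReal.ofReal p * ENNReal.ofReal E ^ 2 * ENNReal.ofReal E ^ 2 * ENNReal.ofReal R := by
  rw [ENNReal.ofReal_add (by positivity) (by positivity), ENNReal.ofReal_mul (by positivity),
    ENNReal.ofReal_mul (by positivity), ENNReal.ofReal_mul (by positivity),
    ENNReal.ofReal_pow (by positivity), ENNReal.ofReal_pow hE, ENNReal.ofReal_pow hE,
    ENNReal.ofReal_inv_of_pos he]
  ring

lemma HMM.Record.ratioBound_step (he : 0 < e) (h : M.Record y r C D e Θ a S) (t : ℕ)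
    {v : 𝒳 → ℝ≥0∞} (hv : Measurable v) {R : ℝ} (hR : 0 ≤ R)
    (hvR : RatioBound D v (ENNReal.ofReal R)) :
    RatioBound D (lact (M.window y t (2 * r)) v) (ENNReal.ofReal (e⁻¹ ^ 2
      * expSum a t (t + 2 * r) ^ 2 + pairCoeff S r Θ t * expSum a t (t + 2 * r) ^ 4 * R)) := by
  rw [ofReal_step_coeff he (pairCoeff_pos _ _ _ _).le (expSum_pos _ _ _).le hR]
  exact hvR.lact hv (h.isReturnBound t) (h.swapBound he t)

/-- The unnormalized predictor `χ L⟨y_0, …, y_{k-1}⟩`. -/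
def HMM.unnormPred (M : HMM 𝒳 𝒴) (χ : Measure 𝒳) (y : ℕ → 𝒴) (k : ℕ) : Measure 𝒳 :=
  χ.bind (M.window y 0 k)

lemma HMM.unnormPred_add (M : HMM 𝒳 𝒴) (χ : Measure 𝒳) (y : ℕ → 𝒴) (k l : ℕ) :
    M.unnormPred χ y (k + l) = (M.unnormPred χ y k).bind (M.window y k l) := by
  rw [HMM.unnormPred, M.window_add, zero_add, HMM.unnormPred,
    Measure.bind_bind (Kernel.aemeasurable _) (Kernel.aemeasurable _)]
  rfl

lemma HMM.Record.unnormPred_step (he : 0 < e) (h : M.Record y r C D e Θ a S) {χ : Measure 𝒳}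
    (t : ℕ) {X : ℝ} (hX : 0 ≤ X)
    (hχX : M.unnormPred χ y t Set.univ ≤ ENNReal.ofReal X * M.unnormPred χ y t D) :
    M.unnormPred χ y (t + 2 * r) Set.univ ≤ ENNReal.ofReal (e⁻¹ ^ 2
        * expSum a t (t + 2 * r) ^ 2 + pairCoeff S r Θ t * expSum a t (t + 2 * r) ^ 4 * X)
      * M.unnormPred χ y (t + 2 * r) D := by
  rw [ofReal_step_coeff he (pairCoeff_pos _ _ _ _).le (expSum_pos _ _ _).le hX,
    M.unnormPred_add]
  exact (h.isReturnBound t).bind_univ_le (h.swapBound he t) h.nonempty hχX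

/-- The number of pairs of blocks, among the first `N` after time `t`, with both starting times
in `S`. -/
def goodPairs (S : Set ℕ) (r t N : ℕ) : ℕ :=
  open Classical in ∑ l ∈ Finset.range N, if t + 2 * r * l ∈ S ∧ t + 2 * r * l + r ∈ S then 1 else 0

lemma goodPairs_succ (S : Set ℕ) (r t N : ℕ) : goodPairs S r t (N + 1)
    = goodPairs S r (t + 2 * r) N + open Classical in if t ∈ S ∧ t + r ∈ S then 1 else 0 := by
  rw [goodPairs, Finset.sum_range_succ', goodPairs]
  congr 1
  refine Finset.sum_congr rfl fun l _ => ?_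
  rw [show t + 2 * r * (l + 1) = t + 2 * r + 2 * r * l by ring]

section Forgetting

variable {𝒳 : Type*} {θ ρ B V E W : ℝ≥0∞} {u v : 𝒳 → ℝ≥0∞} {g p : ℕ}

/-- Bound for the asymmetry of `u` and `v` after `g` good pairs: the choice of `p` trades the
contraction `ρ ^ p` of the main term for the growth `θ⁻¹ ^ p` of the remainder. -/
def TradeBound (u v : 𝒳 → ℝ≥0∞) (θ ρ B W : ℝ≥0∞) (g p : ℕ) : Prop :=
  PairBound u v (B * ρ ^ p) (B * ((2 * θ) ^ g * θ⁻¹ ^ p * W ^ 2))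

lemma TradeBound.zero (hθ : θ ≤ 1) (huv : ∀ x, u x ≤ B * v x) (hvV : ∀ x, v x ≤ V) (p : ℕ) :
    TradeBound u v θ ρ B V 0 p := by
  intro x x'
  refine le_trans ?_ le_add_self
  calc u x * v x' ≤ B * V * V := by
        gcongr
        · exact (huv x).trans (by gcongr; exact hvV x)
        · exact hvV x'
    _ = B * ((2 * θ) ^ 0 * 1 * V ^ 2) := by ring
    _ ≤ _ := by
        gcongr
        exact one_le_pow₀ (ENNReal.one_le_inv.2 hθ)

lemma TradeBound.zero_right (huv : ∀ x, u x ≤ B * v x) (g : ℕ) : TradeBound u v θ ρ B W g 0 := by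
  intro x x'
  refine le_trans ?_ (le_add_self.trans le_self_add)
  rw [pow_zero, mul_one, ← mul_assoc]
  exact mul_le_mul_left (huv x) _

variable [MeasurableSpace 𝒳]

lemma TradeBound.lact {κ : Kernel 𝒳 𝒳} [IsSFiniteKernel κ] (h : TradeBound u v θ ρ B W g p)
    (hu : Measurable u) (hv : Measurable v) (hE : ∀ x, κ x Set.univ ≤ E) :
    TradeBound (lact κ u) (lact κ v) θ ρ B (E * W) g p :=
  (PairBound.lact h hu hv hE).mono le_rfl (by rw [mul_pow E]; exact (by ring : _ = _).le)

lemma TradeBound.comp_of_doeblin {κ₀ κ₁ : Kernel 𝒳 𝒳} [IsSFiniteKernel κ₀] [IsSFiniteKernel κ₁]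
    {C : Set 𝒳} {c N₀ N₁ : ℝ≥0∞} (hκ : IsDoeblinPair κ₀ κ₁ C c (θ ^ 2) N₀ N₁) (hρ : ρ + c ^ 2 = 1)
    (hN₁ : N₁ ≠ ∞) (hθ0 : θ ≠ 0) (hθ : θ ≤ 1) (hu : Measurable u) (hv : Measurable v)
    (hV : V ≠ ∞) (hvV : ∀ x, v x ≤ V) (h : TradeBound u v θ ρ B W g p)
    (h' : TradeBound u v θ ρ B W g (p + 1)) :
    TradeBound (ParticleFilter.lact (κ₁ ∘ₖ κ₀) u) (ParticleFilter.lact (κ₁ ∘ₖ κ₀) v) θ ρ B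
      (N₀ * N₁ * W) (g + 1) (p + 1) := by
  have hρp : B * ρ ^ (p + 1) = ρ * (B * ρ ^ p) := by ring
  have hcancel : θ * θ⁻¹ = 1 :=
    ENNReal.mul_inv_cancel hθ0 (ne_top_of_le_ne_top ENNReal.one_ne_top hθ)
  rw [TradeBound] at h h' ⊢
  rw [hρp] at h' ⊢
  refine (PairBound.comp_of_doeblin hκ hρ hN₁ hu hv hV hvV h h').mono le_rfl ?_
  calc (N₀ * N₁) ^ 2 * (B * ((2 * θ) ^ g * θ⁻¹ ^ p * W ^ 2)
        + θ ^ 2 * (B * ((2 * θ) ^ g * θ⁻¹ ^ (p + 1) * W ^ 2)))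
      = B * ((2 * θ) ^ g * θ⁻¹ ^ p * (N₀ * N₁ * W) ^ 2) * (1 + θ * (θ * θ⁻¹)) := by ring
    _ ≤ B * ((2 * θ) ^ g * θ⁻¹ ^ p * (N₀ * N₁ * W) ^ 2) * (1 + 1 * 1) := by
        rw [hcancel]
        gcongr
    _ = B * ((2 * θ) ^ g * θ⁻¹ ^ p * (N₀ * N₁ * W) ^ 2) * 2 * (θ * θ⁻¹) := by
        rw [hcancel, mul_one, mul_one, one_add_one_eq_two]
    _ = B * ((2 * θ) ^ (g + 1) * θ⁻¹ ^ (p + 1) * (N₀ * N₁ * W) ^ 2) := by ring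

end Forgetting

lemma HMM.Record.tradeBound_step (h : M.Record y r C D e Θ a S) (hΘ : 0 ≤ Θ) {ρ B V W : ℝ≥0∞}
    (hρ : ρ + ENNReal.ofReal e ^ 2 = 1) (hV : V ≠ ∞) {u v : 𝒳 → ℝ≥0∞} (hu : Measurable u)
    (hv : Measurable v) (huv : ∀ x, u x ≤ B * v x) (hvV : ∀ x, v x ≤ V) {g : ℕ}
    (hg : ∀ p, TradeBound u v (ENNReal.ofReal (Real.exp (-Θ))) ρ B W g p) (t p : ℕ) :
    TradeBound (lact (M.window y t (2 * r)) u) (lact (M.window y t (2 * r)) v)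
      (ENNReal.ofReal (Real.exp (-Θ))) ρ B (ENNReal.ofReal (expSum a t (t + 2 * r)) * W)
      (g + open Classical in if t ∈ S ∧ t + r ∈ S then 1 else 0) p := by
  split_ifs with hS
  · cases p with
    | zero =>
      refine TradeBound.zero_right (lact_le_const_mul hv huv) _
    | succ p =>
      rw [← ofReal_expSum_two_mul a t r, M.window_two_mul]
      exact (hg p).comp_of_doeblin (h.isDoeblinPair hS.1 hS.2) hρ ENNReal.ofReal_ne_top
        (ENNReal.ofReal_pos.2 (Real.exp_pos _)).ne'
        (ENNReal.ofReal_le_one.2 (Real.exp_le_one_iff.2 (neg_nonpos.2 hΘ))) hu hv hV hvV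
        (hg (p + 1))
  · exact (hg p).lact hu hv (h.window_univ_le t (2 * r))

lemma HMM.Record.tradeBound (h : M.Record y r C D e Θ a S) (hΘ : 0 ≤ Θ) {ρ B V : ℝ≥0∞}
    (hρ : ρ + ENNReal.ofReal e ^ 2 = 1) (hV : V ≠ ∞) {u v : 𝒳 → ℝ≥0∞} (hu : Measurable u)
    (hv : Measurable v) (huv : ∀ x, u x ≤ B * v x) (hvV : ∀ x, v x ≤ V) (N t p : ℕ) :
    TradeBound (lact (M.window y t (2 * r * N)) u) (lact (M.window y t (2 * r * N)) v)
      (ENNReal.ofReal (Real.exp (-Θ))) ρ B (ENNReal.ofReal (expSum a t (t + 2 * r * N)) * V)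
      (goodPairs S r t N) p := by
  induction N generalizing t p with
  | zero =>
    simpa [M.window_zero, lact_id hu, lact_id hv, expSum, goodPairs] using
      TradeBound.zero (ENNReal.ofReal_le_one.2 (Real.exp_le_one_iff.2 (neg_nonpos.2 hΘ))) huv hvV p
  | succ N ih =>
    have hE : ENNReal.ofReal (expSum a t (t + 2 * r * (N + 1))) * V
        = ENNReal.ofReal (expSum a t (t + 2 * r))
          * (ENNReal.ofReal (expSum a (t + 2 * r) (t + 2 * r + 2 * r * N)) * V) := by
      rw [← mul_assoc, ofReal_expSum_mul a (by omega) (by omega), mul_add_one, add_assoc,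
        add_comm (2 * r)]
    rw [hE, goodPairs_succ, mul_add_one, add_comm (2 * r * N), M.lact_window_add _ _ _ _ hu,
      M.lact_window_add _ _ _ _ hv]
    refine h.tradeBound_step hΘ hρ
      (ENNReal.mul_ne_top ENNReal.ofReal_ne_top hV)
      (measurable_lact _ hu) (measurable_lact _ hv) (lact_le_const_mul hv huv)
      (fun x => (lact_le hvV x).trans (mul_le_mul_left (h.window_univ_le _ _ x) _))
      (ih (t + 2 * r)) t p

end Record

section Recursion

/-- The rate `l` in `1 - e ^ 2 = exp (-l)`, at which couplings with Doeblin ratio `e` succeed. -/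
def mixRate (e : ℝ) : ℝ := -Real.log (1 - e ^ 2)

lemma mixRate_pos {e : ℝ} (he : 0 < e) (he1 : e < 1) : 0 < mixRate e :=
  neg_pos.2 (Real.log_neg (by nlinarith) (by nlinarith))

lemma exp_neg_mixRate {e : ℝ} (he : 0 < e) (he1 : e < 1) : Real.exp (-mixRate e) = 1 - e ^ 2 := by
  rw [mixRate, neg_neg, Real.exp_log (by nlinarith)]

/-- Constants for which the recursions over pairs of blocks contract: the gain `Θ` off the Doeblin
set beats the mean `c` of the bounds along the record, and the slope `ε` of the fluctuations is
small compared to the rates of decay that this leaves. -/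
structure IsAdmissible (r : ℕ) (e Θ c ε : ℝ) : Prop where
  one_le : 1 ≤ r
  pos : 0 < e
  lt_one : e < 1
  mean_nonneg : 0 ≤ c
  slope_pos : 0 < ε
  mean_le_gain : 2 * (1 + 3 * (12 * r * c + 1)) ≤ Θ
  slope_le_ratio : ε * ((2 * Θ + 6) * (2 * r)) ≤ 1 / 2
  slope_le_mixed : ε * (mixRate e / 2 + 2 * (2 * Θ + 6)) ≤ mixRate e / (24 * r)
  slope_le_small : ε * (3 * (12 * r * c + 1) + 2 * (2 * Θ + 6) + 6) ≤ 1 / (4 * r)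

lemma exists_pos_mul_le {A d : ℝ} (hA : 0 ≤ A) (hd : 0 < d) :
    ∃ δ : ℝ, 0 < δ ∧ ∀ ε, ε ≤ δ → ε * A ≤ d := by
  refine ⟨d / (A + 1), by positivity, fun ε hε => ?_⟩
  calc ε * A ≤ d / (A + 1) * (A + 1) := by gcongr; linarith
    _ = d := div_mul_cancel₀ d (by linarith)

lemma IsAdmissible.gain_nonneg {r : ℕ} {e Θ c ε : ℝ} (A : IsAdmissible r e Θ c ε) : 0 ≤ Θ := by
  have := A.mean_nonneg
  exact le_trans (by positivity) A.mean_le_gain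

lemma exists_isAdmissible {r : ℕ} {e Θ c : ℝ} (hr : 1 ≤ r) (he : 0 < e) (he1 : e < 1) (hc : 0 ≤ c)
    (hΘ : 2 * (1 + 3 * (12 * r * c + 1)) ≤ Θ) : ∃ ε, IsAdmissible r e Θ c ε := by
  have hΘ0 : 0 ≤ Θ := le_trans (by positivity) hΘ
  have hl := mixRate_pos he he1
  obtain ⟨δ₁, hδ₁, h₁⟩ := exists_pos_mul_le (A := (2 * Θ + 6) * (2 * r)) (d := 1 / 2)
    (by positivity) (by positivity)
  obtain ⟨δ₂, hδ₂, h₂⟩ := exists_pos_mul_le (A := mixRate e / 2 + 2 * (2 * Θ + 6))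
    (d := mixRate e / (24 * r)) (by positivity) (by positivity)
  obtain ⟨δ₃, hδ₃, h₃⟩ := exists_pos_mul_le
    (A := 3 * (12 * r * c + 1) + 2 * (2 * Θ + 6) + 6) (d := 1 / (4 * r))
    (by positivity) (by positivity)
  exact ⟨min δ₁ (min δ₂ δ₃), hr, he, he1, hc, by positivity, hΘ, h₁ _ (min_le_left _ _),
    h₂ _ ((min_le_right _ _).trans (min_le_left _ _)),
    h₃ _ ((min_le_right _ _).trans (min_le_right _ _))⟩

lemma exists_bound_of_affine_recursion {P : ℕ → ℝ → Prop} {α β : ℕ → ℝ} {N : ℕ} {x H τ : ℝ}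
    (hα : ∀ i, 0 ≤ α i) (hβ : ∀ i, 0 ≤ β i)
    (step : ∀ i < N, ∀ x, 0 ≤ x → P (i + 1) x → P i (α i + β i * x))
    (hx : 0 ≤ x) (hP : P N x) (hτ0 : 0 ≤ τ) (hτ : τ < 1) (hH : 0 ≤ H)
    (h1 : ∀ i < N, (∏ l ∈ Finset.range i, β l) * α i ≤ H * τ ^ i)
    (h2 : (∏ l ∈ Finset.range N, β l) * x ≤ H * τ ^ N) :
    ∃ x' ≤ H / (1 - τ), P 0 x' := by
  suffices key : ∀ j i, i + j = N → ∃ x', 0 ≤ x' ∧ P i x' ∧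
      (∏ l ∈ Finset.range i, β l) * x' ≤ H * ∑ l ∈ Finset.Ico i (N + 1), τ ^ l by
    obtain ⟨x', -, hPx, hb⟩ := key N 0 (by omega)
    rw [Finset.prod_range_zero, one_mul, ← Finset.range_eq_Ico] at hb
    refine ⟨x', hb.trans ?_, hPx⟩
    rw [div_eq_mul_inv, ← tsum_geometric_of_lt_one hτ0 hτ]
    exact mul_le_mul_of_nonneg_left ((summable_geometric_of_lt_one hτ0 hτ).sum_le_tsum _
      fun i _ => pow_nonneg hτ0 i) hH
  intro j
  induction j with
  | zero =>
    intro i hi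
    obtain rfl : i = N := by omega
    exact ⟨x, hx, hP, by simpa using h2⟩
  | succ j ih =>
    intro i hi
    obtain ⟨x', hx', hPx, hb⟩ := ih (i + 1) (by omega)
    refine ⟨α i + β i * x', add_nonneg (hα i) (mul_nonneg (hβ i) hx'),
      step i (by omega) x' hx' hPx, ?_⟩
    rw [Finset.sum_eq_sum_Ico_succ_bot (show i < N + 1 by omega)]
    rw [Finset.prod_range_succ] at hb
    linarith [h1 i (by omega)]

/-- Bounds, with the fluctuation `ε * (n - j) + b`, for the sums of `a` over the windows `[j, k)`
and for the number of blocks after time `j` that do not start in `S`, up to the time `n`. -/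
structure WindowBound (r n : ℕ) (c ε b : ℝ) (a : ℕ → ℝ) (S : Set ℕ) : Prop where
  nonneg : 0 ≤ b
  sum_le : ∀ j k, j ≤ k → k ≤ n → ∑ i ∈ Finset.Ico j k, a i ≤ c * (k - j) + (ε * (n - j) + b)
  bad_le : ∀ j N, j + N * r ≤ n →
    (∑ i ∈ Finset.range N, open Classical in if j + i * r ∈ S then (0 : ℝ) else 1)
      ≤ N / 3 + (ε * (n - j) + b)

lemma sub_bad_le_goodPairs (S : Set ℕ) (r t N : ℕ) : (N : ℝ)
    - (∑ i ∈ Finset.range (2 * N), open Classical in if t + i * r ∈ S then (0 : ℝ) else 1)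
      ≤ goodPairs S r t N := by
  classical
  induction N generalizing t with
  | zero => simp [goodPairs]
  | succ N ih =>
    have hsum : (∑ i ∈ Finset.range (2 * N), if t + (i + 1 + 1) * r ∈ S then (0 : ℝ) else 1)
        = ∑ i ∈ Finset.range (2 * N), if t + 2 * r + i * r ∈ S then (0 : ℝ) else 1 :=
      Finset.sum_congr rfl fun i _ => by rw [show t + (i + 1 + 1) * r = t + 2 * r + i * r by ring]
    rw [goodPairs_succ, show 2 * (N + 1) = 2 * N + 1 + 1 by ring, Finset.sum_range_succ',
      Finset.sum_range_succ', hsum, zero_mul, add_zero, zero_add, one_mul]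
    have := ih (t + 2 * r)
    push_cast
    by_cases h0 : t ∈ S <;> by_cases h1 : t + r ∈ S <;> simp [h0, h1] <;> linarith

lemma prod_pairCoeff (S : Set ℕ) (r : ℕ) (Θ : ℝ) (t N : ℕ) :
    ∏ l ∈ Finset.range N, pairCoeff S r Θ (t + 2 * r * l)
      = (Real.exp (-Θ) ^ 2) ^ goodPairs S r t N := by
  classical
  rw [goodPairs, ← Finset.prod_pow_eq_pow_sum]
  refine Finset.prod_congr rfl fun l _ => ?_
  rw [pairCoeff]
  split_ifs <;> simp

lemma prod_expSum (a : ℕ → ℝ) (r t N : ℕ) :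
    ∏ l ∈ Finset.range N, expSum a (t + 2 * r * l) (t + 2 * r * l + 2 * r)
      = expSum a t (t + 2 * r * N) := by
  induction N with
  | zero => simp [expSum]
  | succ N ih =>
    rw [Finset.prod_range_succ, ih, expSum_mul a (by omega) (by omega), mul_add_one, add_assoc]

/-- The coefficient of the recursions over the pair of blocks that starts at time `t`. -/
def recCoeff (S : Set ℕ) (r : ℕ) (Θ : ℝ) (a : ℕ → ℝ) (t : ℕ) : ℝ :=
  pairCoeff S r Θ t * expSum a t (t + 2 * r) ^ 4

lemma recCoeff_pos (S : Set ℕ) (r : ℕ) (Θ : ℝ) (a : ℕ → ℝ) (t : ℕ) : 0 < recCoeff S r Θ a t :=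
  mul_pos (pairCoeff_pos S r Θ t) (pow_pos (expSum_pos _ _ _) 4)

namespace WindowBound

variable {r n : ℕ} {e Θ c ε b : ℝ} {a : ℕ → ℝ} {S : Set ℕ}

lemma goodPairs_ge (h : WindowBound r n c ε b a S) {t N : ℕ} (htN : t + 2 * r * N ≤ n) :
    (N : ℝ) / 3 - (ε * (n - t) + b) ≤ goodPairs S r t N := by
  have h1 := h.bad_le t (2 * N) (by nlinarith)
  have h2 := sub_bad_le_goodPairs S r t N
  push_cast at h1
  linarith

lemma expSum_le (h : WindowBound r n c ε b a S) {j k : ℕ} (hjk : j ≤ k) (hk : k ≤ n) :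
    expSum a j k ≤ Real.exp (c * (k - j) + (ε * (n - j) + b)) :=
  Real.exp_le_exp.2 (h.sum_le j k hjk hk)

/-- A third of the pairs gain `exp (-2Θ)` each, which outweighs the growth of `expSum a`. -/
lemma prod_recCoeff_le (h : WindowBound r n c ε b a S) (A : IsAdmissible r e Θ c ε)
    {t N : ℕ} (htN : t + 2 * r * N ≤ n) :
    ∏ l ∈ Finset.range N, recCoeff S r Θ a (t + 2 * r * l)
      ≤ Real.exp (-N + (2 * Θ + 4) * (ε * (n - t) + b)) := by
  simp only [recCoeff]
  rw [Finset.prod_mul_distrib, prod_pairCoeff, Finset.prod_pow, prod_expSum]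
  have hgood := h.goodPairs_ge htN
  have hsum := h.expSum_le (show t ≤ t + 2 * r * N by omega) htN
  calc (Real.exp (-Θ) ^ 2) ^ goodPairs S r t N * expSum a t (t + 2 * r * N) ^ 4
      ≤ (Real.exp (-Θ) ^ 2) ^ goodPairs S r t N
        * Real.exp (c * ((t + 2 * r * N : ℕ) - t) + (ε * (n - t) + b)) ^ 4 := by
        have := expSum_pos a t (t + 2 * r * N)
        gcongr
    _ = Real.exp (-(2 * Θ * goodPairs S r t N) + 4 * (c * (2 * r * N) + (ε * (n - t) + b))) := by
        rw [← pow_mul, ← Real.exp_nat_mul, ← Real.exp_nat_mul, ← Real.exp_add]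
        push_cast
        ring_nf
    _ ≤ Real.exp (-N + (2 * Θ + 4) * (ε * (n - t) + b)) := by
        refine Real.exp_le_exp.2 ?_
        have hgain := mul_le_mul_of_nonneg_left hgood A.gain_nonneg
        have hΘ := mul_le_mul_of_nonneg_right A.mean_le_gain (Nat.cast_nonneg (α := ℝ) N)
        have hrc : 0 ≤ r * c * N := by
          have := A.mean_nonneg
          positivity
        nlinarith

lemma expSum_sq_le (h : WindowBound r n c ε b a S) (hε : 0 ≤ ε) {k t i : ℕ}
    (hk : k ≤ t + 2 * r * (i + 1)) (ht : t + 2 * r ≤ n) :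
    expSum a t (t + 2 * r) ^ 2
      ≤ Real.exp (4 * r * c + 2 * (ε * (n - k) + b + ε * (2 * r * (i + 1)))) := by
  have hk' : (k : ℝ) ≤ t + 2 * r * (i + 1) := by exact_mod_cast hk
  refine (pow_le_pow_left₀ (expSum_pos _ _ _).le (h.expSum_le (by omega) ht) 2).trans ?_
  rw [← Real.exp_nat_mul, Real.exp_le_exp]
  have := mul_le_mul_of_nonneg_left hk' hε
  push_cast
  linarith

lemma prod_recCoeff_mul_le (h : WindowBound r n c ε b a S) (A : IsAdmissible r e Θ c ε)
    {k t i : ℕ} (hk : k ≤ t + 2 * r * i) (ht : t + 2 * r * i ≤ n) {x : ℝ}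
    (hx : x ≤ e⁻¹ ^ 2 * Real.exp (4 * r * c + 2 * (ε * (n - k) + b + ε * (2 * r * (i + 1))))) :
    (∏ l ∈ Finset.range i, recCoeff S r Θ a (t + 2 * r * l)) * x
      ≤ e⁻¹ ^ 2 * Real.exp (4 * r * c + 1 + (2 * Θ + 6) * (ε * (n - k) + b))
        * Real.exp (-(1 / 2)) ^ i := by
  have hε := A.slope_pos.le
  have hk' : (k : ℝ) ≤ t + 2 * r * i := by exact_mod_cast hk
  have hΘ := A.gain_nonneg
  have hW : ε * (n - t) + b ≤ ε * (n - k) + b + ε * (2 * r * i) := by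
    have := mul_le_mul_of_nonneg_left hk' hε
    linarith
  have hprod := (h.prod_recCoeff_le A ht).trans (Real.exp_le_exp.2 (add_le_add_right
    (mul_le_mul_of_nonneg_left hW (by positivity : 0 ≤ 2 * Θ + 4)) _))
  calc (∏ l ∈ Finset.range i, recCoeff S r Θ a (t + 2 * r * l)) * x
      ≤ Real.exp (-i + (2 * Θ + 4) * (ε * (n - k) + b + ε * (2 * r * i)))
        * (e⁻¹ ^ 2 * Real.exp (4 * r * c
          + 2 * (ε * (n - k) + b + ε * (2 * r * (i + 1))))) :=
        mul_le_mul_of_nonneg hprod hx (Finset.prod_nonneg fun _ _ => (recCoeff_pos ..).le)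
          (by positivity)
    _ = e⁻¹ ^ 2 * Real.exp (4 * r * c + (2 * Θ + 6) * (ε * (n - k) + b)
          + ε * ((2 * Θ + 6) * (2 * r)) * i + 4 * (ε * r) - i) := by
        rw [mul_left_comm, ← Real.exp_add]
        congr 2
        ring
    _ ≤ e⁻¹ ^ 2 * Real.exp (4 * r * c + 1 + (2 * Θ + 6) * (ε * (n - k) + b)
          + i * -(1 / 2)) := by
        refine mul_le_mul_of_nonneg_left (Real.exp_le_exp.2 ?_) (by positivity)
        have hslope := A.slope_le_ratio
        have hi := mul_le_mul_of_nonneg_right hslope (Nat.cast_nonneg (α := ℝ) i)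
        have hεr : 0 ≤ ε * r := by positivity
        nlinarith [mul_nonneg hεr hΘ]
    _ = _ := by rw [Real.exp_add, Real.exp_nat_mul, ← mul_assoc]

end WindowBound

end Recursion

section Bounds

variable {𝒳 𝒴 : Type*} [MeasurableSpace 𝒳] [MeasurableSpace 𝒴]
variable {M : HMM 𝒳 𝒴} {y : ℕ → 𝒴} {r : ℕ} {C D : Set 𝒳} {e Θ : ℝ} {a : ℕ → ℝ} {S : Set ℕ}
  {n : ℕ} {c ε b : ℝ}

lemma HMM.Record.ratioBound_window_of_le (h : M.Record y r C D e Θ a S) (t : ℕ) {l : ℕ}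
    (hl : l ≤ 2 * r) :
    RatioBound D (lact (M.window y t l) 1) (ENNReal.ofReal (expSum a t (t + 2 * r) ^ 2)) := by
  intro x x' hx'
  set E := ENNReal.ofReal (expSum a t (t + 2 * r)) with hE
  set E₁ := ENNReal.ofReal (expSum a t (t + l)) with hE₁
  set E₂ := ENNReal.ofReal (expSum a (t + l) (t + 2 * r)) with hE₂
  have hmass : M.window y t (2 * r) x' Set.univ ≤ lact (M.window y t l) 1 x' * E₂ := by
    rw [lact_one, ← lact_one, ← Nat.add_sub_of_le hl, M.lact_window_add _ _ _ _ measurable_one]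
    refine lact_le (fun z => (lact_one _ z).trans_le ((h.window_univ_le _ _ z).trans_eq ?_)) x'
    rw [hE₂, add_assoc, Nat.add_sub_of_le hl]
  calc lact (M.window y t l) 1 x ≤ E₁ := (lact_one _ x).trans_le (h.window_univ_le t l x)
    _ ≤ E₁ * (E * M.window y t (2 * r) x' Set.univ) :=
        le_mul_of_one_le_right' ((h.isReturnBound t).one_le_mul_univ hx')
    _ ≤ E₁ * (E * (lact (M.window y t l) 1 x' * E₂)) := by gcongr
    _ = E₁ * E₂ * E * lact (M.window y t l) 1 x' := by ring
    _ = ENNReal.ofReal (expSum a t (t + 2 * r) ^ 2) * lact (M.window y t l) 1 x' := by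
        rw [hE₁, hE₂, ofReal_expSum_mul a (by omega) (by omega), ← hE, ← sq,
          ENNReal.ofReal_pow (expSum_pos _ _ _).le]

/-- The constant in the bounds of the ratios of masses. -/
def ratioConst (r : ℕ) (c e : ℝ) : ℝ :=
  e⁻¹ ^ 2 * Real.exp (4 * r * c + 1) / (1 - Real.exp (-(1 / 2)))

lemma exp_neg_half_lt_one : Real.exp (-(1 / 2)) < 1 := by
  rw [Real.exp_lt_one_iff]
  norm_num

lemma ratioConst_nonneg (r : ℕ) (c e : ℝ) : 0 ≤ ratioConst r c e := by
  have := sub_pos.2 exp_neg_half_lt_one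
  rw [ratioConst]
  positivity

lemma ratioConst_mul_exp (r : ℕ) (c e w : ℝ) :
    e⁻¹ ^ 2 * Real.exp (4 * r * c + 1 + w) / (1 - Real.exp (-(1 / 2)))
      = ratioConst r c e * Real.exp w := by
  rw [ratioConst, Real.exp_add _ w]
  ring

lemma WindowBound.exists_bound_of_recursion (h : WindowBound r n c ε b a S)
    (A : IsAdmissible r e Θ c ε) {P : ℕ → ℝ → Prop} {T : ℕ → ℕ} {N k : ℕ} {x : ℝ}
    (step : ∀ i < N, ∀ x, 0 ≤ x → P (i + 1) x →
      P i (e⁻¹ ^ 2 * expSum a (T i) (T i + 2 * r) ^ 2 + recCoeff S r Θ a (T i) * x))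
    (hx : 0 ≤ x) (hP : P N x)
    (hxN : x ≤ e⁻¹ ^ 2 * Real.exp (4 * r * c + 2 * (ε * (n - k) + b + ε * (2 * r * (N + 1)))))
    (hT : ∀ i < N, k ≤ T i + 2 * r * (i + 1) ∧ T i + 2 * r ≤ n)
    (hprod : ∀ i ≤ N, ∃ t, k ≤ t + 2 * r * i ∧ t + 2 * r * i ≤ n ∧
      ∏ l ∈ Finset.range i, recCoeff S r Θ a (T l)
        = ∏ l ∈ Finset.range i, recCoeff S r Θ a (t + 2 * r * l)) :
    ∃ x' ≤ ratioConst r c e * Real.exp ((2 * Θ + 6) * (ε * (n - k) + b)), P 0 x' := by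
  simp only [← ratioConst_mul_exp]
  have key : ∀ i ≤ N, ∀ x, x ≤ e⁻¹ ^ 2
      * Real.exp (4 * r * c + 2 * (ε * (n - k) + b + ε * (2 * r * (i + 1)))) →
      (∏ l ∈ Finset.range i, recCoeff S r Θ a (T l)) * x
        ≤ e⁻¹ ^ 2 * Real.exp (4 * r * c + 1 + (2 * Θ + 6) * (ε * (n - k) + b))
          * Real.exp (-(1 / 2)) ^ i := by
    intro i hi x hx
    obtain ⟨t, hkt, htn, ht⟩ := hprod i hi
    rw [ht]
    exact h.prod_recCoeff_mul_le A hkt htn hx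
  refine exists_bound_of_affine_recursion (fun i => by positivity)
    (fun i => (recCoeff_pos _ _ _ _ _).le) step hx hP (Real.exp_pos _).le exp_neg_half_lt_one
    (by positivity) (fun i hi => key i hi.le _ ?_) (key N le_rfl x hxN)
  exact mul_le_mul_of_nonneg_left (h.expSum_sq_le A.slope_pos.le (hT i hi).1 (hT i hi).2)
    (by positivity)

lemma IsAdmissible.one_le_inv_sq (A : IsAdmissible r e Θ c ε) : 1 ≤ e⁻¹ ^ 2 :=
  one_le_pow₀ ((one_le_inv₀ A.pos).2 A.lt_one.le)

lemma HMM.Record.ratioBound_window (h : M.Record y r C D e Θ a S)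
    (hw : WindowBound r n c ε b a S) (A : IsAdmissible r e Θ c ε) {k N l : ℕ} (hl : l ≤ 2 * r)
    (hkn : k + 2 * r * N + 2 * r ≤ n) :
    RatioBound D (lact (M.window y k (2 * r * N + l)) 1)
      (ENNReal.ofReal (ratioConst r c e * Real.exp ((2 * Θ + 6) * (ε * (n - k) + b)))) := by
  have hle {i : ℕ} (hi : i ≤ N) : 2 * r * i ≤ 2 * r * N := Nat.mul_le_mul_left _ hi
  have hkN : k ≤ k + 2 * r * N + 2 * r * (N + 1) := by omega
  obtain ⟨R, hR, hbound⟩ := hw.exists_bound_of_recursion A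
    (P := fun i R => RatioBound D (lact (M.window y (k + 2 * r * i) (2 * r * (N - i) + l)) 1)
      (ENNReal.ofReal R)) (T := fun i => k + 2 * r * i) (N := N) (k := k)
    (fun i hi R hR hvR => by
      have hstep := h.ratioBound_step A.pos (k + 2 * r * i) (measurable_lact _ measurable_one)
        hR hvR
      rwa [mul_add_one, ← add_assoc, ← M.lact_window_add _ _ _ _ measurable_one, ← add_assoc,
        ← mul_one_add, show 1 + (N - (i + 1)) = N - i by omega] at hstep)
    (sq_nonneg _)
    (by simpa only [Nat.sub_self, mul_zero, zero_add] using h.ratioBound_window_of_le _ hl)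
    ((hw.expSum_sq_le A.slope_pos.le hkN hkn).trans
      (le_mul_of_one_le_left (Real.exp_pos _).le A.one_le_inv_sq))
    (fun i hi => ⟨by omega, by have := hle hi.le; omega⟩)
    (fun i hi => ⟨k, by omega, by have := hle hi; omega, rfl⟩)
  rw [mul_zero, add_zero, Nat.sub_zero] at hbound
  exact fun x x' hx' => (hbound x x' hx').trans
    (mul_le_mul_left (ENNReal.ofReal_le_ofReal hR) _)

lemma prod_range_reflect_blocks (f : ℕ → ℝ) (s r : ℕ) {N i : ℕ} (hi : i ≤ N) :
    ∏ l ∈ Finset.range i, f (s + 2 * r * (N - (l + 1)))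
      = ∏ l ∈ Finset.range i, f (s + 2 * r * (N - i) + 2 * r * l) := by
  rw [← Finset.prod_range_reflect]
  refine Finset.prod_congr rfl fun l hl => ?_
  have hli := Finset.mem_range.1 hl
  rw [add_assoc, ← mul_add, show N - (i - 1 - l + 1) = N - i + l by omega]

/-- The dual of `ratioBound_window`, with the recursion running backwards in time from `k`. -/
lemma HMM.Record.unnormPred_univ_le (h : M.Record y r C D e Θ a S)
    (hw : WindowBound r n c ε b a S) (A : IsAdmissible r e Θ c ε) {χ : Measure 𝒳}
    (hχ : ∀ s < 2 * r, M.unnormPred χ y s Set.univ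
      ≤ ENNReal.ofReal (Real.exp b) * M.unnormPred χ y s D) {k : ℕ} (hkn : k ≤ n) :
    M.unnormPred χ y k Set.univ
      ≤ ENNReal.ofReal (ratioConst r c e * Real.exp ((2 * Θ + 6) * (ε * (n - k) + b)))
        * M.unnormPred χ y k D := by
  obtain ⟨N, s, hs, rfl⟩ : ∃ N s, s < 2 * r ∧ k = s + 2 * r * N :=
    ⟨k / (2 * r), k % (2 * r), Nat.mod_lt _ (by have := h.one_le; omega),
      (Nat.mod_add_div k (2 * r)).symm⟩
  have hblocks {i : ℕ} (hi : i ≤ N) : 2 * r * (N - i) + 2 * r * i = 2 * r * N := by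
    rw [← mul_add, Nat.sub_add_cancel hi]
  have hstart : Real.exp b ≤ e⁻¹ ^ 2 * Real.exp (4 * r * c
      + 2 * (ε * (n - (s + 2 * r * N : ℕ)) + b + ε * (2 * r * (N + 1)))) := by
    refine le_trans (Real.exp_le_exp.2 ?_)
      (le_mul_of_one_le_left (Real.exp_pos _).le A.one_le_inv_sq)
    have hε : 0 ≤ ε * (n - (s + 2 * r * N : ℕ)) :=
      mul_nonneg A.slope_pos.le (sub_nonneg.2 (by exact_mod_cast hkn))
    have hε' : 0 ≤ ε * (2 * r * (N + 1)) := mul_nonneg A.slope_pos.le (by positivity)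
    have hrc : 0 ≤ 4 * r * c := mul_nonneg (by positivity) A.mean_nonneg
    linarith [hw.nonneg]
  obtain ⟨X, hX, hbound⟩ := hw.exists_bound_of_recursion A
    (P := fun i X => M.unnormPred χ y (s + 2 * r * (N - i)) Set.univ
      ≤ ENNReal.ofReal X * M.unnormPred χ y (s + 2 * r * (N - i)) D)
    (T := fun i => s + 2 * r * (N - (i + 1))) (N := N) (k := s + 2 * r * N)
    (fun i hi X hX hχX => by
      have hT : s + 2 * r * (N - i) = s + 2 * r * (N - (i + 1)) + 2 * r := by
        rw [add_assoc, ← mul_add_one, show N - (i + 1) + 1 = N - i by omega]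
      rw [hT, recCoeff]
      exact h.unnormPred_step A.pos _ hX hχX)
    (Real.exp_pos b).le
    (by simpa only [Nat.sub_self, mul_zero, add_zero] using hχ s hs)
    hstart
    (fun i hi => by
      have := hblocks (show i + 1 ≤ N from hi)
      have : 2 * r * (N - (i + 1)) + 2 * r ≤ 2 * r * (N - (i + 1)) + 2 * r * (i + 1) := by
        rw [mul_add_one]; omega
      omega)
    (fun i hi => ⟨s + 2 * r * (N - i), by have := hblocks hi; omega,
      by have := hblocks hi; omega, prod_range_reflect_blocks _ s r hi⟩)
  rw [Nat.sub_zero] at hbound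
  exact hbound.trans (mul_le_mul_left (ENNReal.ofReal_le_ofReal hX) _)

end Bounds

section RatioVar

variable {α : Type*} [MeasurableSpace α] {μ : Measure α}

/-- The asymptotic variance `E[(u - (E u / E v) v)²] / (E v)²` of the ratio estimator
`∑ᵢ u(Xᵢ) / ∑ᵢ v(Xᵢ)`, for independent draws `Xᵢ` from the normalization of the finite measure
`μ`. The outer integral is a lower one, so that measurability in parameters is easy. -/
def ratioVar (μ : Measure α) (u v : α → ℝ≥0∞) : ℝ :=
  ((μ Set.univ)⁻¹ * ∫⁻ x, ENNReal.ofReal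
    ((((u x).toReal - (∫⁻ x', u x' ∂μ).toReal / (∫⁻ x', v x' ∂μ).toReal * (v x).toReal)
      / ((∫⁻ x', v x' ∂μ).toReal / μ.real Set.univ)) ^ 2) ∂μ).toReal

lemma ratioVar_nonneg (μ : Measure α) (u v : α → ℝ≥0∞) : 0 ≤ ratioVar μ u v :=
  ENNReal.toReal_nonneg

lemma ratioVar_eq_integral {u v : α → ℝ≥0∞} (hu : Measurable u) (hv : Measurable v) :
    ratioVar μ u v = ∫ x, (((u x).toReal
        - (∫⁻ x', u x' ∂μ).toReal / (∫⁻ x', v x' ∂μ).toReal * (v x).toReal)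
      / ((∫⁻ x', v x' ∂μ).toReal / μ.real Set.univ)) ^ 2 ∂((μ Set.univ)⁻¹ • μ) := by
  have hmeas : Measurable fun x => (((u x).toReal
        - (∫⁻ x', u x' ∂μ).toReal / (∫⁻ x', v x' ∂μ).toReal * (v x).toReal)
      / ((∫⁻ x', v x' ∂μ).toReal / μ.real Set.univ)) ^ 2 :=
    ((hu.ennreal_toReal.sub (hv.ennreal_toReal.const_mul _)).div_const _).pow_const 2
  rw [ratioVar, integral_eq_lintegral_of_nonneg_ae (.of_forall fun x => sq_nonneg _)
    hmeas.aestronglyMeasurable, lintegral_smul_measure, smul_eq_mul]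

lemma ratioVar_le_sq [IsFiniteMeasure μ] (hμ : μ Set.univ ≠ 0) {u v : α → ℝ≥0∞} {b : ℝ}
    (h : ∀ x, |((u x).toReal
        - (∫⁻ x', u x' ∂μ).toReal / (∫⁻ x', v x' ∂μ).toReal * (v x).toReal)
      / ((∫⁻ x', v x' ∂μ).toReal / μ.real Set.univ)| ≤ b) : ratioVar μ u v ≤ b ^ 2 := by
  refine ENNReal.toReal_le_of_le_ofReal (sq_nonneg _) ?_
  calc _ ≤ (μ Set.univ)⁻¹ * ∫⁻ _, ENNReal.ofReal (b ^ 2) ∂μ := by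
        refine mul_le_mul_right (lintegral_mono fun x => ENNReal.ofReal_le_ofReal ?_) _
        exact sq_le_sq.2 ((h x).trans (le_abs_self b))
    _ = ENNReal.ofReal (b ^ 2) := by
        rw [lintegral_const, mul_left_comm, ENNReal.inv_mul_cancel hμ (measure_ne_top μ _), mul_one]

lemma lintegral_ne_zero_of_forall_pos (hμ : μ Set.univ ≠ 0) {F : α → ℝ≥0∞} (hF : Measurable F)
    (hF0 : ∀ x, 0 < F x) : ∫⁻ x, F x ∂μ ≠ 0 := by
  have hsupp : Function.support F = Set.univ := Set.eq_univ_of_forall fun x => (hF0 x).ne'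
  refine ne_of_gt ((lintegral_pos_iff_support hF).2 ?_)
  rwa [hsupp, pos_iff_ne_zero]

lemma lintegral_ne_top_of_forall_le [IsFiniteMeasure μ] {F : α → ℝ≥0∞} {c : ℝ≥0∞} (hc : c ≠ ∞)
    (hF : ∀ x, F x ≤ c) : ∫⁻ x, F x ∂μ ≠ ∞ :=
  ((lintegral_mono hF).trans_lt
    (by rw [lintegral_const]; exact ENNReal.mul_lt_top hc.lt_top (measure_lt_top μ _))).ne

lemma integrable_toReal_of_forall_le [IsFiniteMeasure μ] {F : α → ℝ≥0∞} (hF : Measurable F)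
    {c : ℝ≥0∞} (hc : c ≠ ∞) (hFc : ∀ x, F x ≤ c) : Integrable (fun x => (F x).toReal) μ :=
  integrable_toReal_of_lintegral_ne_top hF.aemeasurable (lintegral_ne_top_of_forall_le hc hFc)

lemma integral_toReal_of_forall_le {F : α → ℝ≥0∞} (hF : Measurable F) {c : ℝ≥0∞} (hc : c ≠ ∞)
    (hFc : ∀ x, F x ≤ c) : ∫ x, (F x).toReal ∂μ = (∫⁻ x, F x ∂μ).toReal :=
  integral_toReal hF.aemeasurable (.of_forall fun x => (hFc x).trans_lt hc.lt_top)

lemma integral_toReal_sub_const_mul [IsFiniteMeasure μ] {u v : α → ℝ≥0∞} (hu : Measurable u)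
    (hv : Measurable v) {c : ℝ≥0∞} (hc : c ≠ ∞) (huc : ∀ x, u x ≤ c) (hvc : ∀ x, v x ≤ c)
    (ρ : ℝ) : ∫ x, ((u x).toReal - ρ * (v x).toReal) ∂μ
      = (∫⁻ x, u x ∂μ).toReal - ρ * (∫⁻ x, v x ∂μ).toReal := by
  rw [integral_sub (integrable_toReal_of_forall_le hu hc huc)
    ((integrable_toReal_of_forall_le hv hc hvc).const_mul ρ), integral_const_mul,
    integral_toReal_of_forall_le hu hc huc, integral_toReal_of_forall_le hv hc hvc]

end RatioVar

section Variance

variable {𝒳 𝒴 : Type*} [MeasurableSpace 𝒳] [MeasurableSpace 𝒴]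
variable {M : HMM 𝒳 𝒴} {χ : Measure 𝒳} {y : ℕ → 𝒴} {a : ℕ → ℝ}

lemma HMM.measurable_g_left (M : HMM 𝒳 𝒴) (y : 𝒴) : Measurable fun x => M.g x y :=
  M.measurable_g.comp (measurable_id.prodMk measurable_const)

/-- The function `g(·, y_n)` with values in `[0, ∞]`. -/
def HMM.obsDensity (M : HMM 𝒳 𝒴) (y : ℕ → 𝒴) (n : ℕ) (x : 𝒳) : ℝ≥0∞ :=
  ENNReal.ofReal (M.g x (y n))

/-- The function `g(·, y_n) (h + B)` with values in `[0, ∞]`, to be used with a bound `B` of `|h|`: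
the shift makes it nonnegative and does not change variances. -/
def HMM.shiftedDensity (M : HMM 𝒳 𝒴) (y : ℕ → 𝒴) (n : ℕ) (h : 𝒳 → ℝ) (B : ℝ) (x : 𝒳) : ℝ≥0∞ :=
  ENNReal.ofReal (M.g x (y n) * (h x + B))

lemma HMM.measurable_obsDensity (M : HMM 𝒳 𝒴) (y : ℕ → 𝒴) (n : ℕ) :
    Measurable (M.obsDensity y n) := M.measurable_ofReal_g _

lemma HMM.measurable_shiftedDensity (M : HMM 𝒳 𝒴) (y : ℕ → 𝒴) (n : ℕ) {h : 𝒳 → ℝ}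
    (hh : Measurable h) (B : ℝ) : Measurable (M.shiftedDensity y n h B) :=
  ((M.measurable_g_left _).mul (hh.add_const B)).ennreal_ofReal

lemma HMM.obsDensity_pos (hg : ∀ x y, 0 < M.g x y) (n : ℕ) (x : 𝒳) : 0 < M.obsDensity y n x :=
  ENNReal.ofReal_pos.2 (hg x (y n))

lemma HMM.obsDensity_le (ha : ∀ i x, M.g x (y i) ≤ Real.exp (a i)) (n : ℕ) (x : 𝒳) :
    M.obsDensity y n x ≤ ENNReal.ofReal (Real.exp (a n)) :=
  ENNReal.ofReal_le_ofReal (ha n x)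

lemma HMM.shiftedDensity_le_mul (M : HMM 𝒳 𝒴) (y : ℕ → 𝒴) (n : ℕ) {h : 𝒳 → ℝ} {B : ℝ}
    (hB : ∀ x, |h x| ≤ B) (x : 𝒳) :
    M.shiftedDensity y n h B x ≤ ENNReal.ofReal (2 * B) * M.obsDensity y n x := by
  have hx := abs_le.1 (hB x)
  rw [HMM.shiftedDensity, HMM.obsDensity, ← ENNReal.ofReal_mul (by linarith), mul_comm]
  exact ENNReal.ofReal_le_ofReal (mul_le_mul_of_nonneg_right (by linarith) (M.g_nonneg _ _))

lemma HMM.toReal_shiftedDensity (M : HMM 𝒳 𝒴) (y : ℕ → 𝒴) (n : ℕ) {h : 𝒳 → ℝ} {B : ℝ}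
    (hB : ∀ x, |h x| ≤ B) (x : 𝒳) :
    (M.shiftedDensity y n h B x).toReal = M.g x (y n) * (h x + B) :=
  ENNReal.toReal_ofReal (mul_nonneg (M.g_nonneg _ _) (by linarith [(abs_le.1 (hB x)).1]))

lemma HMM.toReal_obsDensity (M : HMM 𝒳 𝒴) (y : ℕ → 𝒴) (n : ℕ) (x : 𝒳) :
    (M.obsDensity y n x).toReal = M.g x (y n) :=
  ENNReal.toReal_ofReal (M.g_nonneg _ _)

lemma HMM.exists_density_bound (ha : ∀ i x, M.g x (y i) ≤ Real.exp (a i)) (n : ℕ) {h : 𝒳 → ℝ}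
    {B : ℝ} (hB : ∀ x, |h x| ≤ B) : ∃ c : ℝ≥0∞, c ≠ ∞ ∧
      (∀ x, M.obsDensity y n x ≤ c) ∧ ∀ x, M.shiftedDensity y n h B x ≤ c := by
  refine ⟨max (ENNReal.ofReal (Real.exp (a n)))
    (ENNReal.ofReal (2 * B) * ENNReal.ofReal (Real.exp (a n))), ?_, fun x => ?_, fun x => ?_⟩
  · exact max_ne_top ENNReal.ofReal_ne_top
      (ENNReal.mul_ne_top ENNReal.ofReal_ne_top ENNReal.ofReal_ne_top)
  · exact (HMM.obsDensity_le ha n x).trans (le_max_left _ _)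
  · exact ((M.shiftedDensity_le_mul y n hB x).trans
      (mul_le_mul_right (HMM.obsDensity_le ha n x) _)).trans (le_max_right _ _)

lemma HMM.pred_eq_smul (M : HMM 𝒳 𝒴) (χ : Measure 𝒳) (y : ℕ → 𝒴) (n : ℕ) :
    M.pred χ y n = (M.unnormPred χ y n Set.univ)⁻¹ • M.unnormPred χ y n := rfl

lemma HMM.lintegral_unnormPred (M : HMM 𝒳 𝒴) (χ : Measure 𝒳) (y : ℕ → 𝒴) {k n : ℕ} (hk : k ≤ n)
    {F : 𝒳 → ℝ≥0∞} (hF : Measurable F) : ∫⁻ x, F x ∂(M.unnormPred χ y n)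
      = ∫⁻ x, lact (M.window y k (n - k)) F x ∂(M.unnormPred χ y k) := by
  rw [← lintegral_bind_kernel _ _ hF, ← M.unnormPred_add, Nat.add_sub_cancel' hk]

lemma HMM.integral_pred (M : HMM 𝒳 𝒴) (χ : Measure 𝒳) (y : ℕ → 𝒴) (n : ℕ) (f : 𝒳 → ℝ) :
    ∫ x, f x ∂(M.pred χ y n)
      = (∫ x, f x ∂(M.unnormPred χ y n)) / (M.unnormPred χ y n).real Set.univ := by
  rw [M.pred_eq_smul, integral_smul_measure, ENNReal.toReal_inv, smul_eq_mul, inv_mul_eq_div,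
    Measure.real]

lemma HMM.isFiniteMeasure_unnormPred [IsFiniteMeasure χ]
    (ha : ∀ i x, M.g x (y i) ≤ Real.exp (a i)) (k : ℕ) : IsFiniteMeasure (M.unnormPred χ y k) := by
  refine ⟨?_⟩
  rw [HMM.unnormPred, Measure.bind_apply .univ (Kernel.aemeasurable _)]
  exact (lintegral_ne_top_of_forall_le ENNReal.ofReal_ne_top (M.window_univ_le ha 0 k)).lt_top

lemma HMM.unnormPred_univ_ne_zero [NeZero χ] (hg : ∀ x y, 0 < M.g x y) (k : ℕ) :
    M.unnormPred χ y k Set.univ ≠ 0 := by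
  rw [HMM.unnormPred, Measure.bind_apply .univ (Kernel.aemeasurable _)]
  simp only [← lact_one]
  exact lintegral_ne_zero_of_forall_pos (by simpa using NeZero.ne χ)
    (measurable_lact _ measurable_one) (M.lact_window_pos hg y 0 k measurable_one fun _ => by simp)

lemma HMM.unnormPred_real_univ_pos [IsFiniteMeasure χ] [NeZero χ] (hg : ∀ x y, 0 < M.g x y)
    (ha : ∀ i x, M.g x (y i) ≤ Real.exp (a i)) (k : ℕ) :
    0 < (M.unnormPred χ y k).real Set.univ :=
  have := HMM.isFiniteMeasure_unnormPred (χ := χ) ha k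
  ENNReal.toReal_pos (HMM.unnormPred_univ_ne_zero hg k) (measure_ne_top _ _)

lemma HMM.lintegral_obsDensity_toReal_pos [IsFiniteMeasure χ] [NeZero χ]
    (hg : ∀ x y, 0 < M.g x y) (ha : ∀ i x, M.g x (y i) ≤ Real.exp (a i)) (n : ℕ) :
    0 < (∫⁻ x, M.obsDensity y n x ∂(M.unnormPred χ y n)).toReal :=
  have := HMM.isFiniteMeasure_unnormPred (χ := χ) ha n
  ENNReal.toReal_pos (lintegral_ne_zero_of_forall_pos (HMM.unnormPred_univ_ne_zero hg n)
    (M.measurable_obsDensity y n) (HMM.obsDensity_pos hg n))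
    (lintegral_ne_top_of_forall_le ENNReal.ofReal_ne_top (HMM.obsDensity_le ha n))

lemma HMM.integral_g_unnormPred (ha : ∀ i x, M.g x (y i) ≤ Real.exp (a i)) (n : ℕ) :
    ∫ x, M.g x (y n) ∂(M.unnormPred χ y n)
      = (∫⁻ x, M.obsDensity y n x ∂(M.unnormPred χ y n)).toReal := by
  simp only [← M.toReal_obsDensity]
  exact integral_toReal_of_forall_le (M.measurable_obsDensity y n) ENNReal.ofReal_ne_top
    (HMM.obsDensity_le ha n)

lemma HMM.integral_filt [IsFiniteMeasure χ] [NeZero χ] (hg : ∀ x y, 0 < M.g x y)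
    (ha : ∀ i x, M.g x (y i) ≤ Real.exp (a i)) (n : ℕ) (f : 𝒳 → ℝ) :
    ∫ x, f x ∂(M.filt χ y n) = (∫ x, M.g x (y n) * f x ∂(M.unnormPred χ y n))
      / ∫ x, M.g x (y n) ∂(M.unnormPred χ y n) := by
  have hmass : (∫⁻ x, ENNReal.ofReal (M.g x (y n)) ∂(M.pred χ y n)).toReal
      = ∫ x, M.g x (y n) ∂(M.pred χ y n) :=
    (integral_eq_lintegral_of_nonneg_ae (.of_forall fun x => M.g_nonneg x _)
      (M.measurable_g_left _).aestronglyMeasurable).symm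
  have hpos := (HMM.unnormPred_real_univ_pos (χ := χ) hg ha n).ne'
  rw [HMM.filt, HMM.update, integral_smul_measure, integral_withDensity_eq_integral_toReal_smul
    (M.measurable_ofReal_g _) (.of_forall fun _ => ENNReal.ofReal_lt_top), ENNReal.toReal_inv,
    hmass]
  simp only [ENNReal.toReal_ofReal (M.g_nonneg _ _), smul_eq_mul]
  rw [M.integral_pred, M.integral_pred, inv_mul_eq_div, div_div_div_cancel_right₀ hpos]

lemma HMM.integral_filt_add [IsFiniteMeasure χ] [NeZero χ] (hg : ∀ x y, 0 < M.g x y)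
    (ha : ∀ i x, M.g x (y i) ≤ Real.exp (a i)) (n : ℕ) {h : 𝒳 → ℝ} (hh : Measurable h) {B : ℝ}
    (hB : ∀ x, |h x| ≤ B) :
    ∫ x, h x ∂(M.filt χ y n) + B
      = (∫⁻ x, M.shiftedDensity y n h B x ∂(M.unnormPred χ y n)).toReal
        / (∫⁻ x, M.obsDensity y n x ∂(M.unnormPred χ y n)).toReal := by
  have := HMM.isFiniteMeasure_unnormPred (χ := χ) ha n
  obtain ⟨c, hc, hobs, hshift⟩ := HMM.exists_density_bound ha n hB
  have hmul : ∀ x, M.g x (y n) * h x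
      = (M.shiftedDensity y n h B x).toReal - B * (M.obsDensity y n x).toReal := fun x => by
    rw [M.toReal_shiftedDensity y n hB, M.toReal_obsDensity]
    ring
  have hpos := HMM.lintegral_obsDensity_toReal_pos (χ := χ) hg ha n
  rw [HMM.integral_filt hg ha, HMM.integral_g_unnormPred ha]
  simp only [hmul]
  rw [integral_toReal_sub_const_mul (M.measurable_shiftedDensity y n hh B)
    (M.measurable_obsDensity y n) hc hshift hobs, sub_div, mul_div_cancel_right₀ _ hpos.ne',
    sub_add_cancel]

lemma HMM.g_mul_sub_integral_filt [IsFiniteMeasure χ] [NeZero χ] (hg : ∀ x y, 0 < M.g x y)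
    (ha : ∀ i x, M.g x (y i) ≤ Real.exp (a i)) (n : ℕ) {h : 𝒳 → ℝ} (hh : Measurable h) {B : ℝ}
    (hB : ∀ x, |h x| ≤ B) (x : 𝒳) :
    M.g x (y n) * (h x - ∫ x', h x' ∂(M.filt χ y n))
      = (M.shiftedDensity y n h B x).toReal
        - (∫⁻ x, M.shiftedDensity y n h B x ∂(M.unnormPred χ y n)).toReal
          / (∫⁻ x, M.obsDensity y n x ∂(M.unnormPred χ y n)).toReal
          * (M.obsDensity y n x).toReal := by
  rw [← HMM.integral_filt_add hg ha n hh hB, M.toReal_shiftedDensity y n hB, M.toReal_obsDensity]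
  ring

lemma HMM.integral_act_one_pred [IsFiniteMeasure χ] (ha : ∀ i x, M.g x (y i) ≤ Real.exp (a i))
    {k n : ℕ} (hk : k ≤ n) :
    ∫ x, act (M.Lseg y k n) (fun _ => 1) x ∂(M.pred χ y k)
      = (M.unnormPred χ y n).real Set.univ / (M.unnormPred χ y k).real Set.univ := by
  have hact : ∀ x, act (M.Lseg y k n) (fun _ => 1) x
      = (lact (M.window y k (n - k)) 1 x).toReal := fun x => by
    rw [act, integral_const, smul_eq_mul, mul_one, lact_one]
    rfl
  simp only [hact]
  rw [M.integral_pred, integral_toReal_of_forall_le (measurable_lact _ measurable_one)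
    ENNReal.ofReal_ne_top fun x => (lact_one _ x).trans_le (M.window_univ_le ha k (n - k) x),
    ← M.lintegral_unnormPred χ y hk measurable_one]
  simp only [Pi.one_apply, lintegral_one, Measure.real]

theorem HMM.filtVar_eq_sum_ratioVar [IsFiniteMeasure χ] [NeZero χ] (hg : ∀ x y, 0 < M.g x y)
    (ha : ∀ i x, M.g x (y i) ≤ Real.exp (a i)) (n : ℕ) {h : 𝒳 → ℝ} (hh : Measurable h) {B : ℝ}
    (hB : ∀ x, |h x| ≤ B) :
    M.filtVar χ y n h = ∑ k ∈ Finset.range (n + 1), ratioVar (M.unnormPred χ y k)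
      (lact (M.window y k (n - k)) (M.shiftedDensity y n h B))
      (lact (M.window y k (n - k)) (M.obsDensity y n)) := by
  obtain ⟨c, hc, hobs, hshift⟩ := HMM.exists_density_bound ha n hB
  have hmobs := M.measurable_obsDensity y n
  have hmshift := M.measurable_shiftedDensity y n hh B
  have hmass := fun k => (HMM.unnormPred_real_univ_pos (χ := χ) hg ha k).ne'
  have hfin := HMM.isFiniteMeasure_unnormPred (χ := χ) ha n
  have hV := (HMM.lintegral_obsDensity_toReal_pos (χ := χ) hg ha n).ne'
  have hmean : ∫ x, M.g x (y n) * (h x - ∫ x', h x' ∂(M.filt χ y n)) ∂(M.pred χ y n) = 0 := by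
    simp only [HMM.g_mul_sub_integral_filt hg ha n hh hB]
    rw [M.integral_pred, integral_toReal_sub_const_mul hmshift hmobs hc hshift hobs,
      div_mul_cancel₀ _ hV, sub_self, zero_div]
  rw [HMM.filtVar, HMM.predVar, hmean, M.integral_pred, HMM.integral_g_unnormPred ha,
    Finset.sum_div]
  refine Finset.sum_congr rfl fun k hk => ?_
  have hkn : k ≤ n := Nat.lt_succ_iff.1 (Finset.mem_range.1 hk)
  rw [HMM.integral_act_one_pred ha hkn, ← integral_div, ratioVar_eq_integral
    (measurable_lact _ hmshift) (measurable_lact _ hmobs), ← M.lintegral_unnormPred χ y hkn hmshift,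
    ← M.lintegral_unnormPred χ y hkn hmobs, ← M.pred_eq_smul]
  refine integral_congr_ae (.of_forall fun x => ?_)
  have hfin : IsFiniteMeasure (M.Lseg y k n x) :=
    ⟨(M.window_univ_le ha k (n - k) x).trans_lt ENNReal.ofReal_lt_top⟩
  have hact : act (M.Lseg y k n) (fun x => M.g x (y n) * (h x - ∫ x', h x' ∂(M.filt χ y n))) x
      = (lact (M.window y k (n - k)) (M.shiftedDensity y n h B) x).toReal
        - (∫⁻ x, M.shiftedDensity y n h B x ∂(M.unnormPred χ y n)).toReal
          / (∫⁻ x, M.obsDensity y n x ∂(M.unnormPred χ y n)).toReal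
          * (lact (M.window y k (n - k)) (M.obsDensity y n) x).toReal := by
    rw [act]
    simp only [HMM.g_mul_sub_integral_filt hg ha n hh hB]
    exact integral_toReal_sub_const_mul hmshift hmobs hc hshift hobs _
  simp only [hact, zero_mul, sub_zero]
  rw [← div_pow, div_div, div_mul_div_cancel₀' (hmass n)]

end Variance

section RatioVarBound

lemma abs_sub_div_mul_div_le {u v U V m α β R T : ℝ} (hV : 0 < V) (hm : 0 < m)
    (hα : 0 ≤ α) (hβ : 0 ≤ β) (hle : u * V ≤ U * v + α * (v * V) + β * m)
    (hge : U * v ≤ u * V + α * (V * v) + β * m) (hR : v * m ≤ R * V) (hT : m ≤ T * V) :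
    |(u - U / V * v) / (V / m)| ≤ α * R + β * T ^ 2 := by
  have hcross : |u * V - U * v| ≤ α * (v * V) + β * m := by
    rw [abs_le]
    constructor <;> linarith [mul_comm V v, congrArg (α * ·) (mul_comm V v)]
  have hquot : (u - U / V * v) / (V / m) = (u * V - U * v) * m / V ^ 2 := by field_simp
  rw [hquot, abs_div, abs_mul, abs_of_pos hm, abs_of_pos (pow_pos hV 2), div_le_iff₀ (pow_pos hV 2)]
  calc |u * V - U * v| * m ≤ (α * (v * V) + β * m) * m := by gcongr
    _ = v * m * (α * V) + β * m ^ 2 := by ring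
    _ ≤ R * V * (α * V) + β * (T * V) ^ 2 := by gcongr
    _ = _ := by ring

lemma toReal_mul_le_of_le_add {u v U V m : ℝ≥0∞} {α β : ℝ} (hu : u ≠ ∞) (hv : v ≠ ∞) (hU : U ≠ ∞)
    (hV : V ≠ ∞) (hm : m ≠ ∞) (hα : 0 ≤ α) (hβ : 0 ≤ β)
    (h : u * V ≤ U * v + ENNReal.ofReal α * (v * V) + ENNReal.ofReal β * m) :
    u.toReal * V.toReal
      ≤ U.toReal * v.toReal + α * (v.toReal * V.toReal) + β * m.toReal := by
  lift u to NNReal using hu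
  lift v to NNReal using hv
  lift U to NNReal using hU
  lift V to NNReal using hV
  lift m to NNReal using hm
  lift α to NNReal using hα
  lift β to NNReal using hβ
  simp only [ENNReal.ofReal_coe_nnreal, ENNReal.coe_toReal] at h ⊢
  exact_mod_cast h

variable {α : Type*} [MeasurableSpace α] {μ : Measure α} [IsFiniteMeasure μ]

lemma PairBound.ratioVar_le {u v : α → ℝ≥0∞} {a b R T : ℝ} (ha : 0 ≤ a) (hb : 0 ≤ b) (hR : 0 ≤ R)
    (hT : 0 ≤ T) (h : PairBound u v (ENNReal.ofReal a) (ENNReal.ofReal b)) (hu : Measurable u)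
    (hv : Measurable v) {c : ℝ≥0∞} (hc : c ≠ ∞) (huc : ∀ x, u x ≤ c) (hvc : ∀ x, v x ≤ c)
    (hμ : μ Set.univ ≠ 0) (hvR : ∀ x, v x * μ Set.univ ≤ ENNReal.ofReal R * ∫⁻ x', v x' ∂μ)
    (hvT : μ Set.univ ≤ ENNReal.ofReal T * ∫⁻ x, v x ∂μ) :
    ratioVar μ u v ≤ (a * R + b * T ^ 2) ^ 2 := by
  have hU := lintegral_ne_top_of_forall_le (μ := μ) hc huc
  have hV := lintegral_ne_top_of_forall_le (μ := μ) hc hvc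
  have hV0 : ∫⁻ x, v x ∂μ ≠ 0 := fun h0 => hμ (by simpa [h0] using hvT)
  have hm := measure_ne_top μ Set.univ
  refine ratioVar_le_sq hμ fun x => ?_
  have hux := ne_top_of_le_ne_top hc (huc x)
  have hvx := ne_top_of_le_ne_top hc (hvc x)
  have hle := h.lintegral_mul_le hu hv (Measure.dirac x) μ
  have hge := h.lintegral_mul_le hu hv μ (Measure.dirac x)
  simp only [lintegral_dirac' _ hu, lintegral_dirac' _ hv, measure_univ, one_mul, mul_one]
    at hle hge
  have hRx := ENNReal.toReal_mono (ENNReal.mul_ne_top ENNReal.ofReal_ne_top hV) (hvR x)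
  have hTm := ENNReal.toReal_mono (ENNReal.mul_ne_top ENNReal.ofReal_ne_top hV) hvT
  rw [ENNReal.toReal_mul, ENNReal.toReal_mul, ENNReal.toReal_ofReal hR] at hRx
  rw [ENNReal.toReal_mul, ENNReal.toReal_ofReal hT] at hTm
  exact abs_sub_div_mul_div_le (ENNReal.toReal_pos hV0 hV)
    (ENNReal.toReal_pos hμ hm) ha hb (toReal_mul_le_of_le_add hux hvx hU hV hm ha hb hle)
    (toReal_mul_le_of_le_add hU hV hux hvx hm ha hb hge) hRx hTm

end RatioVarBound

section VarianceBound

lemma TradeBound.pairBound_ofReal {α : Type*} {u v : α → ℝ≥0∞} {θ ρ B W W' : ℝ} {g p : ℕ}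
    (hθ : 0 < θ) (hρ : 0 ≤ ρ) (hB : 0 ≤ B) (hW : 0 ≤ W) (hWW' : W ≤ W')
    (h : TradeBound u v (ENNReal.ofReal θ) (ENNReal.ofReal ρ) (ENNReal.ofReal B)
      (ENNReal.ofReal W) g p) :
    PairBound u v (ENNReal.ofReal (B * ρ ^ p))
      (ENNReal.ofReal (B * ((2 * θ) ^ g * θ⁻¹ ^ p * W' ^ 2))) := by
  have htwo : (2 : ℝ≥0∞) * ENNReal.ofReal θ = ENNReal.ofReal (2 * θ) := by
    rw [ENNReal.ofReal_mul zero_le_two, ENNReal.ofReal_ofNat]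
  refine PairBound.mono h ?_ ?_
  · rw [ENNReal.ofReal_mul hB, ENNReal.ofReal_pow hρ]
  · rw [htwo, ← ENNReal.ofReal_inv_of_pos hθ, ← ENNReal.ofReal_pow (by positivity),
      ← ENNReal.ofReal_pow (by positivity), ← ENNReal.ofReal_pow hW,
      ← ENNReal.ofReal_mul (by positivity), ← ENNReal.ofReal_mul (by positivity),
      ← ENNReal.ofReal_mul hB]
    exact ENNReal.ofReal_le_ofReal (by gcongr)

variable {𝒳 𝒴 : Type*} [MeasurableSpace 𝒳] [MeasurableSpace 𝒴]

lemma IsReturnBound.comp {κ₀ κ₁ : Kernel 𝒳 𝒳} {D : Set 𝒳} {q₀ q₁ : ℝ≥0∞}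
    (h₁ : IsReturnBound κ₁ D q₁) (h₀ : IsReturnBound κ₀ D q₀) :
    IsReturnBound (κ₁ ∘ₖ κ₀) D (q₀ * q₁) where
  measurableSet := h₀.measurableSet
  univ_le x := by
    rw [Kernel.comp_apply' _ _ _ .univ]
    refine (lintegral_mono fun z => h₁.univ_le z).trans ?_
    rw [lintegral_const, mul_comm]
    exact mul_le_mul_left (h₀.univ_le x) _
  one_le x hx := by
    have hreturn : κ₀ x D ≤ q₁ * (κ₁ ∘ₖ κ₀) x D := by
      rw [← one_mul (κ₀ x D), Kernel.comp_apply' _ _ _ h₀.measurableSet,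
        ← lintegral_const_mul _ (κ₁.measurable_coe h₀.measurableSet)]
      exact mul_measure_le_lact h₀.measurableSet h₁.one_le x
    calc (1 : ℝ≥0∞) ≤ q₀ * κ₀ x D := h₀.one_le x hx
      _ ≤ q₀ * (q₁ * (κ₁ ∘ₖ κ₀) x D) := mul_le_mul_right hreturn _
      _ = _ := (mul_assoc _ _ _).symm

lemma mul_measure_univ_le_mul_lintegral {μ : Measure 𝒳} {D : Set 𝒳} (hD : MeasurableSet D)
    {X c : ℝ≥0∞} (hX : μ Set.univ ≤ X * μ D) {F : 𝒳 → ℝ≥0∞} (hF : ∀ x ∈ D, c ≤ F x) :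
    c * μ Set.univ ≤ X * ∫⁻ x, F x ∂μ := by
  calc c * μ Set.univ ≤ c * (X * μ D) := mul_le_mul_right hX c
    _ = X * ∫⁻ _ in D, c ∂μ := by rw [setLIntegral_const]; ring
    _ ≤ X * ∫⁻ x, F x ∂μ := mul_le_mul_right
        ((setLIntegral_mono_ae' hD (.of_forall hF)).trans (setLIntegral_le_lintegral _ _)) X

variable {M : HMM 𝒳 𝒴} {χ : Measure 𝒳} {y : ℕ → 𝒴} {r : ℕ} {C D : Set 𝒳} {e Θ : ℝ} {a : ℕ → ℝ}
  {S : Set ℕ}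

lemma HMM.lact_window_obsDensity (M : HMM 𝒳 𝒴) (y : ℕ → 𝒴) {k n : ℕ} (hk : k ≤ n) :
    lact (M.window y k (n - k)) (M.obsDensity y n) = lact (M.window y k (n - k + 1)) 1 :=
  funext fun x => by
    rw [lact_one, ← M.lact_window_g, Nat.add_sub_cancel' hk]
    rfl

namespace HMM.Record

lemma expSum_le_expSum (h : M.Record y r C D e Θ a S) {k s m : ℕ} (hks : k ≤ s) (hsm : s ≤ m) :
    expSum a k s ≤ expSum a k m := by
  rw [← expSum_mul a hks hsm]
  exact le_mul_of_one_le_right (expSum_pos _ _ _).le (h.one_le_expSum _ _)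

lemma isReturnBound_mul (h : M.Record y r C D e Θ a S) (k N : ℕ) :
    IsReturnBound (M.window y k (2 * r * N)) D (ENNReal.ofReal (expSum a k (k + 2 * r * N))) := by
  induction N generalizing k with
  | zero =>
    refine ⟨h.measD, h.window_univ_le _ _, fun x hx => ?_⟩
    simp [M.window_zero, Kernel.id_apply, expSum, hx, h.measD]
  | succ N ih =>
    have hcomp := (ih (k + 2 * r)).comp (h.isReturnBound k)
    rwa [ofReal_expSum_mul a (by omega) (by omega), ← M.window_add,
      show 2 * r + 2 * r * N = 2 * r * (N + 1) by ring,
      show k + 2 * r + 2 * r * N = k + 2 * r * (N + 1) by ring] at hcomp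

lemma one_le_mul_window_univ (h : M.Record y r C D e Θ a S) {N k l : ℕ} (hl : l ≤ 2 * r * N)
    {x : 𝒳} (hx : x ∈ D) :
    1 ≤ ENNReal.ofReal (expSum a k (k + 2 * r * N) ^ 2) * M.window y k l x Set.univ := by
  set E := expSum a k (k + 2 * r * N) with hE
  have hrest : ∀ z, M.window y (k + l) (2 * r * N - l) z Set.univ ≤ ENNReal.ofReal E := fun z => by
    refine (h.window_univ_le _ _ z).trans (ENNReal.ofReal_le_ofReal ?_)
    rw [hE, ← expSum_mul a (Nat.le_add_right k l) (Nat.add_le_add_left hl k), add_assoc,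
      Nat.add_sub_cancel' hl]
    exact le_mul_of_one_le_left (expSum_pos _ _ _).le (h.one_le_expSum _ _)
  have hsplit : M.window y k (2 * r * N) x Set.univ
      ≤ M.window y k l x Set.univ * ENNReal.ofReal E := by
    rw [← Nat.add_sub_cancel' hl, ← lact_one, M.lact_window_add _ _ _ _ measurable_one]
    exact lact_le (fun z => (lact_one _ z).trans_le (hrest z)) x
  calc (1 : ℝ≥0∞) ≤ ENNReal.ofReal E * M.window y k (2 * r * N) x Set.univ :=
        (h.isReturnBound_mul k N).one_le_mul_univ hx
    _ ≤ ENNReal.ofReal E * (M.window y k l x Set.univ * ENNReal.ofReal E) :=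
        mul_le_mul_right hsplit _
    _ = _ := by rw [sq, ENNReal.ofReal_mul (expSum_pos _ _ _).le]; ring

lemma pairBound_density (he : 0 ≤ e) (he1 : e ≤ 1) (hΘ : 0 ≤ Θ) (h : M.Record y r C D e Θ a S)
    {k n N l : ℕ} (hl : l < 2 * r) (hn : n = k + 2 * r * N + l) {f : 𝒳 → ℝ}
    (hf : Measurable f) {B : ℝ} (hB0 : 0 ≤ B) (hB : ∀ x, |f x| ≤ B) (p : ℕ) :
    PairBound (lact (M.window y k (n - k)) (M.shiftedDensity y n f B))
      (lact (M.window y k (n - k)) (M.obsDensity y n))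
      (ENNReal.ofReal (2 * B * (1 - e ^ 2) ^ p))
      (ENNReal.ofReal (2 * B * ((2 * Real.exp (-Θ)) ^ goodPairs S r k N * (Real.exp (-Θ))⁻¹ ^ p
        * expSum a k (k + 2 * r * (N + 1)) ^ 2))) := by
  have he2 : 0 ≤ 1 - e ^ 2 := sub_nonneg.2 (pow_le_one₀ he he1)
  have hsum : ENNReal.ofReal (1 - e ^ 2) + ENNReal.ofReal e ^ 2 = 1 := by
    rw [← ENNReal.ofReal_pow he, ← ENNReal.ofReal_add he2 (sq_nonneg e), sub_add_cancel,
      ENNReal.ofReal_one]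
  have hmobs := M.measurable_obsDensity y n
  have hmshift := M.measurable_shiftedDensity y n hf B
  have hmass : ∀ x, lact (M.window y (k + 2 * r * N) l) (M.obsDensity y n) x
      ≤ ENNReal.ofReal (expSum a (k + 2 * r * N) (n + 1)) := fun x => by
    have hobs := M.lact_window_g y (k + 2 * r * N) l x
    rw [← hn] at hobs
    refine (hobs.trans_le (h.window_univ_le _ _ x)).trans_eq ?_
    rw [← add_assoc, ← hn]
  have htrade := h.tradeBound hΘ hsum ENNReal.ofReal_ne_top (measurable_lact _ hmshift)
    (measurable_lact _ hmobs) (lact_le_const_mul hmobs (M.shiftedDensity_le_mul y n hB)) hmass N k p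
  rw [← M.lact_window_add _ _ _ _ hmshift, ← M.lact_window_add _ _ _ _ hmobs,
    ofReal_expSum_mul a (by omega) (by omega), show 2 * r * N + l = n - k by omega] at htrade
  refine htrade.pairBound_ofReal (Real.exp_pos _) he2 (by positivity) (expSum_pos _ _ _).le ?_
  exact h.expSum_le_expSum (by omega) (by rw [mul_add_one]; omega)

lemma ratioVar_le [IsFiniteMeasure χ] [NeZero χ] (hg : ∀ x y, 0 < M.g x y) (he : 0 ≤ e)
    (he1 : e ≤ 1) (hΘ : 0 ≤ Θ) (h : M.Record y r C D e Θ a S) {k n N l : ℕ} (hl : l < 2 * r)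
    (hn : n = k + 2 * r * N + l) {f : 𝒳 → ℝ} (hf : Measurable f) {B : ℝ} (hB : ∀ x, |f x| ≤ B)
    {X R : ℝ} (hX : 0 ≤ X) (hR : 0 ≤ R)
    (hXk : M.unnormPred χ y k Set.univ ≤ ENNReal.ofReal X * M.unnormPred χ y k D)
    (hRk : RatioBound D (lact (M.window y k (n - k + 1)) 1) (ENNReal.ofReal R)) (p : ℕ) :
    ratioVar (M.unnormPred χ y k) (lact (M.window y k (n - k)) (M.shiftedDensity y n f B))
        (lact (M.window y k (n - k)) (M.obsDensity y n))
      ≤ (2 * B * ((1 - e ^ 2) ^ p * (X * R)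
        + (2 * Real.exp (-Θ)) ^ goodPairs S r k N * (Real.exp (-Θ))⁻¹ ^ p
          * (X * expSum a k (k + 2 * r * (N + 1)) ^ 3) ^ 2)) ^ 2 := by
  obtain ⟨x₀, -⟩ := h.nonempty
  have hB0 : 0 ≤ B := (abs_nonneg _).trans (hB x₀)
  have he2 : 0 ≤ 1 - e ^ 2 := sub_nonneg.2 (pow_le_one₀ he he1)
  have hfin := HMM.isFiniteMeasure_unnormPred (χ := χ) h.g_le k
  obtain ⟨c, hc, hobs, hshift⟩ := HMM.exists_density_bound h.g_le n hB
  have hlact : ∀ {F : 𝒳 → ℝ≥0∞}, (∀ x, F x ≤ c) → ∀ x, lact (M.window y k (n - k)) F x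
      ≤ ENNReal.ofReal (expSum a k (k + (n - k))) * c := fun hF x =>
    (lact_le hF x).trans (mul_le_mul_left (h.window_univ_le _ _ x) c)
  have hv := M.lact_window_obsDensity y (show k ≤ n by omega)
  have hlower : ∀ x ∈ D, 1 ≤ ENNReal.ofReal (expSum a k (k + 2 * r * (N + 1)) ^ 2)
      * lact (M.window y k (n - k + 1)) 1 x := fun x hx => by
    rw [lact_one]
    exact h.one_le_mul_window_univ (by rw [mul_add_one]; omega) hx
  have hmeas := measurable_lact (M.window y k (n - k + 1)) measurable_one
  have hR' : ∀ x, lact (M.window y k (n - k + 1)) 1 x * M.unnormPred χ y k Set.univ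
      ≤ ENNReal.ofReal (X * R)
        * ∫⁻ x', lact (M.window y k (n - k + 1)) 1 x' ∂(M.unnormPred χ y k) := fun x => by
    rw [ENNReal.ofReal_mul hX, mul_assoc, ← lintegral_const_mul _ hmeas]
    exact mul_measure_univ_le_mul_lintegral h.measD hXk (hRk x)
  have hT' : M.unnormPred χ y k Set.univ
      ≤ ENNReal.ofReal (X * expSum a k (k + 2 * r * (N + 1)) ^ 2)
        * ∫⁻ x', lact (M.window y k (n - k + 1)) 1 x' ∂(M.unnormPred χ y k) := by
    rw [ENNReal.ofReal_mul hX, mul_assoc, ← lintegral_const_mul _ hmeas,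
      ← one_mul (M.unnormPred χ y k Set.univ)]
    exact mul_measure_univ_le_mul_lintegral h.measD hXk hlower
  refine ((h.pairBound_density he he1 hΘ hl hn hf hB0 hB p).ratioVar_le (R := X * R)
    (T := X * expSum a k (k + 2 * r * (N + 1)) ^ 2) (by positivity)
    (by have := (Real.exp_pos (-Θ)).le; positivity) (mul_nonneg hX hR) (by positivity)
    (measurable_lact _ (M.measurable_shiftedDensity y n hf B))
    (measurable_lact _ (M.measurable_obsDensity y n))
    (ENNReal.mul_ne_top ENNReal.ofReal_ne_top hc) (hlact hshift) (hlact hobs)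
    (HMM.unnormPred_univ_ne_zero hg k) (by rw [hv]; exact hR') (by rw [hv]; exact hT')).trans_eq ?_
  ring

end HMM.Record

end VarianceBound

section Decay

variable {r N j m : ℕ} {c e Θ ε b d w : ℝ}

/-- The exponential rate at which the `k`-th term of the asymptotic variance at time `n` decays in
`n - k`: the first rate comes from the mixing over good pairs of blocks, the second one from the
small mass outside the Doeblin set. -/
def decayRate (r : ℕ) (e : ℝ) : ℝ := min (mixRate e / (24 * r)) (1 / (4 * r))

/-- The factor in front of the exponential decay in the square root of a term of the asymptotic
variance of a test function bounded by `B`. -/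
def decayConst (r : ℕ) (c e Θ b B : ℝ) : ℝ :=
  2 * B * ratioConst r c e ^ 2 *
    (Real.exp (mixRate e + (mixRate e / 2 + 2 * (2 * Θ + 6)) * b)
      + Real.exp (12 * r * c + 1 + (3 * (12 * r * c + 1) + 2 * (2 * Θ + 6) + 6) * b))

lemma decayRate_pos (hr : 1 ≤ r) (he : 0 < e) (he1 : e < 1) : 0 < decayRate r e := by
  have := mixRate_pos he he1
  rw [decayRate]
  positivity

lemma div_two_mul_le_add_one (hr : 1 ≤ r) (hN : j < 2 * r * (N + 1)) :
    (j : ℝ) / (2 * r) ≤ N + 1 := by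
  rw [div_le_iff₀ (by positivity), mul_comm]
  exact_mod_cast hN.le

lemma IsAdmissible.mixed_term_le (A : IsAdmissible r e Θ c ε) (hN : j < 2 * r * (N + 1))
    (hw : w = ε * j + b) (hm : (N : ℝ) / 3 - w ≤ m) (d : ℝ) :
    (1 - e ^ 2) ^ (m / 2) * (d * Real.exp ((2 * Θ + 6) * w) * (d * Real.exp ((2 * Θ + 6) * w)))
      ≤ d ^ 2 * Real.exp (mixRate e + (mixRate e / 2 + 2 * (2 * Θ + 6)) * b)
        * Real.exp (-(mixRate e / (24 * r)) * j) := by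
  have hr : (0 : ℝ) < r := by exact_mod_cast A.one_le
  have hblocks := div_two_mul_le_add_one A.one_le hN
  have hhalf : (m : ℝ) ≤ 2 * (m / 2 : ℕ) + 1 := by exact_mod_cast (by omega : m ≤ 2 * (m / 2) + 1)
  set l := mixRate e with hl
  set q := 2 * Θ + 6
  set p := m / 2
  have hp : (j : ℝ) / (12 * r) - w / 2 - 1 ≤ p := by
    have : (j : ℝ) / (12 * r) = (j : ℝ) / (2 * r) / 6 := by field_simp; ring
    linarith
  have hmix : l * ((j : ℝ) / (12 * r) - w / 2 - 1) ≤ l * p :=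
    mul_le_mul_of_nonneg_left hp (mixRate_pos A.pos A.lt_one).le
  have hslope : ε * (l / 2 + 2 * q) * j ≤ l / (24 * r) * j :=
    mul_le_mul_of_nonneg_right A.slope_le_mixed (Nat.cast_nonneg _)
  have hrate : l * ((j : ℝ) / (12 * r)) = 2 * (l / (24 * r) * j) := by field_simp; ring
  rw [← exp_neg_mixRate A.pos A.lt_one, ← hl, ← Real.exp_nat_mul]
  calc Real.exp (p * -l) * (d * Real.exp (q * w) * (d * Real.exp (q * w)))
      = d ^ 2 * Real.exp (p * -l + q * w + q * w) := by rw [Real.exp_add, Real.exp_add]; ring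
    _ ≤ d ^ 2 * Real.exp (l + (l / 2 + 2 * q) * b + -(l / (24 * r)) * j) := by
        refine mul_le_mul_of_nonneg_left (Real.exp_le_exp.2 ?_) (sq_nonneg d)
        subst hw
        linarith
    _ = _ := by rw [Real.exp_add]; ring

lemma two_mul_exp_neg_pow_mul_le {v : ℝ} (hv : 0 ≤ v) (hΘ : 2 * (1 + 3 * v) ≤ Θ)
    (hm : (N : ℝ) / 3 - w ≤ m) :
    (2 * Real.exp (-Θ)) ^ m * (Real.exp (-Θ))⁻¹ ^ (m / 2) ≤ Real.exp (-v * N + 3 * v * w) := by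
  have hhalf : (2 : ℝ) * (m / 2 : ℕ) ≤ m := by exact_mod_cast Nat.mul_div_le m 2
  have htwo : 2 * Real.exp (-Θ) ≤ Real.exp (1 + -Θ) := by
    rw [Real.exp_add]
    gcongr
    linarith [Real.add_one_le_exp 1]
  calc (2 * Real.exp (-Θ)) ^ m * (Real.exp (-Θ))⁻¹ ^ (m / 2)
      ≤ Real.exp (1 + -Θ) ^ m * (Real.exp (-Θ))⁻¹ ^ (m / 2) := by gcongr
    _ = Real.exp (m * (1 + -Θ) + (m / 2 : ℕ) * Θ) := by
        rw [Real.exp_neg, inv_inv, ← Real.exp_nat_mul, ← Real.exp_nat_mul, ← Real.exp_add]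
    _ ≤ Real.exp (-v * N + 3 * v * w) := by
        have hgain : 2 * (m / 2 : ℕ) * Θ ≤ m * Θ := mul_le_mul_of_nonneg_right hhalf (by linarith)
        have hmean : m * (2 * (1 + 3 * v)) ≤ m * Θ := by gcongr
        have hgood : v * ((N : ℝ) / 3 - w) ≤ v * m := by gcongr
        have := Nat.cast_nonneg (α := ℝ) m
        exact Real.exp_le_exp.2 (by linarith)

lemma IsAdmissible.small_term_le (A : IsAdmissible r e Θ c ε) (hN : j < 2 * r * (N + 1))
    (hw : w = ε * j + b) (hm : (N : ℝ) / 3 - w ≤ m) {E : ℝ} (hE0 : 0 ≤ E)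
    (hE : E ≤ Real.exp (2 * r * c * (N + 1) + w)) (d : ℝ) :
    (2 * Real.exp (-Θ)) ^ m * (Real.exp (-Θ))⁻¹ ^ (m / 2)
        * (d * Real.exp ((2 * Θ + 6) * w) * E ^ 3) ^ 2
      ≤ d ^ 2 * Real.exp (12 * r * c + 1 + (3 * (12 * r * c + 1) + 2 * (2 * Θ + 6) + 6) * b)
        * Real.exp (-(1 / (4 * r)) * j) := by
  have hr : (0 : ℝ) < r := by exact_mod_cast A.one_le
  have hc := A.mean_nonneg
  have hblocks := div_two_mul_le_add_one A.one_le hN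
  set v := 12 * r * c + 1 with hv
  set q := 2 * Θ + 6
  have hgain := two_mul_exp_neg_pow_mul_le (v := v) (by positivity) A.mean_le_gain hm
  have hslope : ε * (3 * v + 2 * q + 6) * j ≤ 1 / (4 * r) * j :=
    mul_le_mul_of_nonneg_right A.slope_le_small (Nat.cast_nonneg _)
  have hrate : (j : ℝ) / (2 * r) = 2 * (1 / (4 * r) * j) := by field_simp; ring
  calc (2 * Real.exp (-Θ)) ^ m * (Real.exp (-Θ))⁻¹ ^ (m / 2) * (d * Real.exp (q * w) * E ^ 3) ^ 2
      = (2 * Real.exp (-Θ)) ^ m * (Real.exp (-Θ))⁻¹ ^ (m / 2)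
          * (d ^ 2 * Real.exp (q * w) ^ 2) * E ^ 6 := by ring
    _ ≤ Real.exp (-v * N + 3 * v * w) * (d ^ 2 * Real.exp (q * w) ^ 2)
          * Real.exp (2 * r * c * (N + 1) + w) ^ 6 := by gcongr
    _ = d ^ 2 * Real.exp (-v * N + 3 * v * w + 2 * (q * w) + 6 * (2 * r * c * (N + 1) + w)) := by
        rw [← Real.exp_nat_mul, ← Real.exp_nat_mul, Real.exp_add _ (6 * _), Real.exp_add _ (2 * _)]
        push_cast
        ring
    _ ≤ d ^ 2 * Real.exp (12 * r * c + 1 + (3 * v + 2 * q + 6) * b + -(1 / (4 * r)) * j) := by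
        refine mul_le_mul_of_nonneg_left (Real.exp_le_exp.2 ?_) (sq_nonneg d)
        clear_value v
        subst hw hv
        linarith
    _ = _ := by rw [Real.exp_add]; ring

lemma IsAdmissible.mixed_add_small_le (A : IsAdmissible r e Θ c ε) (hN : j < 2 * r * (N + 1))
    (hw : w = ε * j + b) (hm : (N : ℝ) / 3 - w ≤ m) {E : ℝ} (hE0 : 0 ≤ E)
    (hE : E ≤ Real.exp (2 * r * c * (N + 1) + w)) {B : ℝ} (hB : 0 ≤ B) (hd : d = ratioConst r c e) :
    2 * B * ((1 - e ^ 2) ^ (m / 2)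
          * (d * Real.exp ((2 * Θ + 6) * w) * (d * Real.exp ((2 * Θ + 6) * w)))
        + (2 * Real.exp (-Θ)) ^ m * (Real.exp (-Θ))⁻¹ ^ (m / 2)
          * (d * Real.exp ((2 * Θ + 6) * w) * E ^ 3) ^ 2)
      ≤ decayConst r c e Θ b B * Real.exp (-decayRate r e * j) := by
  have hmixed : Real.exp (-(mixRate e / (24 * r)) * j) ≤ Real.exp (-decayRate r e * j) := by
    gcongr
    exact min_le_left _ _
  have hsmall : Real.exp (-(1 / (4 * r)) * j) ≤ Real.exp (-decayRate r e * j) := by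
    gcongr
    exact min_le_right _ _
  calc 2 * B * _ ≤ 2 * B * (_ + _) := mul_le_mul_of_nonneg_left
        (add_le_add ((A.mixed_term_le hN hw hm d).trans (mul_le_mul_of_nonneg_left hmixed
          (by positivity))) ((A.small_term_le hN hw hm hE0 hE d).trans
            (mul_le_mul_of_nonneg_left hsmall (by positivity)))) (by positivity)
    _ = _ := by rw [decayConst, hd]; ring

lemma sum_range_pow_sub_le {τ : ℝ} (h0 : 0 ≤ τ) (h1 : τ < 1) (n : ℕ) :
    ∑ k ∈ Finset.range (n + 1), τ ^ (n - k) ≤ (1 - τ)⁻¹ := by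
  have hreflect := Finset.sum_range_reflect (fun i => τ ^ i) (n + 1)
  simp only [Nat.add_sub_cancel] at hreflect
  rw [hreflect, ← tsum_geometric_of_lt_one h0 h1]
  exact (summable_geometric_of_lt_one h0 h1).sum_le_tsum _ fun i _ => pow_nonneg h0 i

end Decay

section UniformBound

variable {𝒳 𝒴 : Type*} [MeasurableSpace 𝒳] [MeasurableSpace 𝒴] {M : HMM 𝒳 𝒴} {χ : Measure 𝒳}
  [IsFiniteMeasure χ] [NeZero χ] {y : ℕ → 𝒴} {r n : ℕ} {C D : Set 𝒳} {e Θ c ε b : ℝ} {a : ℕ → ℝ}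
  {S : Set ℕ} {f : 𝒳 → ℝ} {B : ℝ}

namespace HMM.Record

lemma ratioVar_le_decay (hg : ∀ x y, 0 < M.g x y) (h : M.Record y r C D e Θ a S)
    (hw : WindowBound r (n + 2 * r) c ε b a S) (A : IsAdmissible r e Θ c ε)
    (hχ : ∀ s < 2 * r,
      M.unnormPred χ y s Set.univ ≤ ENNReal.ofReal (Real.exp b) * M.unnormPred χ y s D)
    (hf : Measurable f) (hB : ∀ x, |f x| ≤ B) {k : ℕ} (hk : k ≤ n) :
    ratioVar (M.unnormPred χ y k) (lact (M.window y k (n - k)) (M.shiftedDensity y n f B))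
        (lact (M.window y k (n - k)) (M.obsDensity y n))
      ≤ (decayConst r c e Θ (ε * (2 * r) + b) B * Real.exp (-decayRate r e * (n - k : ℕ))) ^ 2 := by
  obtain ⟨x₀, -⟩ := h.nonempty
  have hB0 : 0 ≤ B := (abs_nonneg _).trans (hB x₀)
  have hd0 := ratioConst_nonneg r c e
  have he2 : 0 ≤ 1 - e ^ 2 := sub_nonneg.2 (pow_le_one₀ A.pos.le A.lt_one.le)
  have hr := h.one_le
  set N := (n - k) / (2 * r)
  have hdiv : 2 * r * N + (n - k) % (2 * r) = n - k := Nat.div_add_mod (n - k) (2 * r)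
  have hmod : (n - k) % (2 * r) < 2 * r := Nat.mod_lt _ (by omega)
  have hblock : 2 * r * (N + 1) = 2 * r * N + 2 * r := mul_add_one _ _
  have hfluct : ε * (((n + 2 * r : ℕ) : ℝ) - k) + b = ε * (n - k : ℕ) + (ε * (2 * r) + b) := by
    push_cast [Nat.cast_sub hk]
    ring
  have hX := h.unnormPred_univ_le hw A hχ (k := k) (by omega)
  have hR := h.ratioBound_window hw A (k := k) (N := N) (l := (n - k) % (2 * r) + 1)
    (by omega) (by omega)
  have hgood := hw.goodPairs_ge (t := k) (N := N) (by omega)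
  have hE := hw.expSum_le (j := k) (k := k + 2 * r * (N + 1)) (by omega) (by omega)
  have hmean : c * (((k + 2 * r * (N + 1) : ℕ) : ℝ) - k) = 2 * r * c * (N + 1) := by
    push_cast
    ring
  rw [hfluct] at hX hR hgood
  rw [hfluct, hmean] at hE
  rw [← add_assoc, hdiv] at hR
  refine (h.ratioVar_le (N := N) hg A.pos.le A.lt_one.le A.gain_nonneg hmod (by omega) hf hB
    (by positivity) (by positivity) hX hR (goodPairs S r k N / 2)).trans ?_
  have hE0 := (expSum_pos a k (k + 2 * r * (N + 1))).le
  refine pow_le_pow_left₀ (by positivity) ?_ 2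
  exact A.mixed_add_small_le (N := N) (by omega) rfl hgood hE0 hE hB0 rfl

lemma abs_filtVar_le (hg : ∀ x y, 0 < M.g x y) (h : M.Record y r C D e Θ a S)
    (hw : WindowBound r (n + 2 * r) c ε b a S) (A : IsAdmissible r e Θ c ε)
    (hχ : ∀ s < 2 * r,
      M.unnormPred χ y s Set.univ ≤ ENNReal.ofReal (Real.exp b) * M.unnormPred χ y s D)
    (hf : Measurable f) (hB : ∀ x, |f x| ≤ B) :
    |M.filtVar χ y n f| ≤ decayConst r c e Θ (ε * (2 * r) + b) B ^ 2
      * (1 - Real.exp (-(2 * decayRate r e)))⁻¹ := by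
  have hrate := decayRate_pos A.one_le A.pos A.lt_one
  rw [HMM.filtVar_eq_sum_ratioVar hg h.g_le n hf hB,
    abs_of_nonneg (Finset.sum_nonneg fun k _ => ratioVar_nonneg _ _ _)]
  have hterm : ∀ k ∈ Finset.range (n + 1),
      ratioVar (M.unnormPred χ y k) (lact (M.window y k (n - k)) (M.shiftedDensity y n f B))
          (lact (M.window y k (n - k)) (M.obsDensity y n))
        ≤ decayConst r c e Θ (ε * (2 * r) + b) B ^ 2
          * Real.exp (-(2 * decayRate r e)) ^ (n - k) := fun k hk => by
    refine (h.ratioVar_le_decay hg hw A hχ hf hB (Finset.mem_range_succ_iff.1 hk)).trans_eq ?_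
    rw [mul_pow, ← Real.exp_nat_mul, ← Real.exp_nat_mul]
    congr 2
    push_cast
    ring
  refine (Finset.sum_le_sum hterm).trans ?_
  rw [← Finset.mul_sum]
  exact mul_le_mul_of_nonneg_left (sum_range_pow_sub_le (Real.exp_pos _).le
    (Real.exp_lt_one_iff.2 (by linarith)) n) (sq_nonneg _)

end HMM.Record

end UniformBound

section UnionBound

variable {Ω : Type*} [MeasurableSpace Ω] {P : Measure Ω} {θ : ℝ}

lemma measure_not_le_of_imp {p q : Ω → Prop} (h : ∀ ω, p ω → q ω) :
    P {ω | ¬ q ω} ≤ P {ω | ¬ p ω} :=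
  measure_mono fun ω => mt (h ω)

lemma measure_not_and_le (hθ : 0 ≤ θ) {p q : Ω → Prop}
    (hp : P {ω | ¬ p ω} ≤ ENNReal.ofReal (θ / 2)) (hq : P {ω | ¬ q ω} ≤ ENNReal.ofReal (θ / 2)) :
    P {ω | ¬ (p ω ∧ q ω)} ≤ ENNReal.ofReal θ := by
  have hsub : {ω | ¬ (p ω ∧ q ω)} ⊆ {ω | ¬ p ω} ∪ {ω | ¬ q ω} := fun ω h => not_and_or.1 h
  rw [← add_halves θ, ENNReal.ofReal_add (by positivity) (by positivity)]
  exact (measure_mono hsub).trans ((measure_union_le _ _).trans (add_le_add hp hq))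

lemma measure_not_forall_lt_le (hθ : 0 ≤ θ) {m : ℕ} {p : ℕ → Ω → Prop}
    (hp : ∀ s < m, P {ω | ¬ p s ω} ≤ ENNReal.ofReal (θ / m)) :
    P {ω | ¬ ∀ s < m, p s ω} ≤ ENNReal.ofReal θ := by
  have hsub : {ω | ¬ ∀ s < m, p s ω} ⊆ ⋃ s ∈ Finset.range m, {ω | ¬ p s ω} := fun ω h => by
    simpa using h
  calc P {ω | ¬ ∀ s < m, p s ω} ≤ ∑ s ∈ Finset.range m, P {ω | ¬ p s ω} :=
        (measure_mono hsub).trans (measure_biUnion_finset_le _ _)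
    _ ≤ ∑ _s ∈ Finset.range m, ENNReal.ofReal (θ / m) :=
        Finset.sum_le_sum fun s hs => hp s (Finset.mem_range.1 hs)
    _ = ENNReal.ofReal (m * (θ / m)) := by
        rw [Finset.sum_const, Finset.card_range, nsmul_eq_mul, ← ENNReal.ofReal_natCast,
          ← ENNReal.ofReal_mul (Nat.cast_nonneg _)]
    _ ≤ ENNReal.ofReal θ := by
        refine ENNReal.ofReal_le_ofReal ?_
        rcases eq_or_ne (m : ℝ) 0 with hm | hm
        · simpa [hm] using hθ
        · rw [mul_div_cancel₀ _ hm]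

end UnionBound

section WindowBounds

lemma iterate_shift {β : Type*} (i : ℕ) (u : ℕ → β) :
    (fun (u : ℕ → β) (n : ℕ) => u (n + 1))^[i] u = fun n => u (n + i) := by
  induction i generalizing u with
  | zero => rfl
  | succ i ih =>
    rw [Function.iterate_succ_apply, ih]
    funext n
    rw [add_assoc]

lemma integral_indicator_compl_one_le {α : Type*} [MeasurableSpace α] {μ : Measure α}
    [IsProbabilityMeasure μ] {s : Set α} (hs : MeasurableSet s) {t : ℝ}
    (h : ENNReal.ofReal t ≤ μ s) : ∫ x, sᶜ.indicator 1 x ∂μ ≤ 1 - t := by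
  rw [integral_indicator_one hs.compl, measureReal_compl hs, probReal_univ]
  exact sub_le_sub_left ((ENNReal.ofReal_le_iff_le_toReal (measure_ne_top _ _)).1 h) 1

lemma sum_progression_le_of_residues {bad : ℕ → ℝ} {r n : ℕ} (hr : 1 ≤ r) {c ε : ℝ} (hε : 0 ≤ ε)
    {b : ℕ → ℝ} (hb : ∀ s, 0 ≤ b s)
    (h : ∀ s < r, ∀ q N, q + N ≤ (n - s) / r → ∑ i ∈ Finset.range N, bad (s + (q + i) * r)
      ≤ c * N + (ε * (((n - s) / r : ℕ) - q) + b s)) {j N : ℕ} (hjN : j + N * r ≤ n) :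
    ∑ i ∈ Finset.range N, bad (j + i * r)
      ≤ c * N + (ε * (n - j) + ∑ s ∈ Finset.range r, b s) := by
  set s := j % r
  set q := j / r
  have hsr : s < r := Nat.mod_lt _ (by omega)
  have hj : r * q + s = j := Nat.div_add_mod j r
  set J := (n - s) / r with hJ
  have hqN : q + N ≤ J := by
    rw [hJ, Nat.le_div_iff_mul_le (by omega), add_mul, mul_comm q]
    omega
  have hhorizon : (J : ℝ) - q ≤ n - j := by
    have hJn : r * J ≤ n - s := Nat.mul_div_le _ _
    have hJq : r * (J - q) ≤ n - j := by
      rw [Nat.mul_sub]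
      omega
    rw [← Nat.cast_sub (by omega : q ≤ J), ← Nat.cast_sub (by omega : j ≤ n)]
    exact_mod_cast (Nat.le_mul_of_pos_left _ (by omega)).trans hJq
  have hbs : b s ≤ ∑ s ∈ Finset.range r, b s :=
    Finset.single_le_sum (fun s _ => hb s) (Finset.mem_range.2 hsr)
  have hsum := h s hsr q N hqN
  have hterm : ∀ i, s + (q + i) * r = j + i * r := fun i => by
    rw [← hj]
    ring
  simp only [hterm] at hsum
  linarith [mul_le_mul_of_nonneg_left hhorizon hε]

variable {Ω α 𝒴 : Type*} [MeasurableSpace Ω] [MeasurableSpace α] [MeasurableSpace 𝒴]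
  {P : Measure Ω} {U : ℕ → Ω → α} {Y : ℕ → Ω → 𝒴} {r : ℕ} {K : Set (Fin r → 𝒴)} {ε θ : ℝ}

namespace IsStationaryErgodic

lemma exists_sum_Ico_le [IsProbabilityMeasure P] (hU : ∀ n, Measurable (U n))
    (hE : IsStationaryErgodic P U) {f : (ℕ → α) → ℝ}
    (hf : Integrable f (P.map fun ω n => U n ω)) (hε : 0 < ε) (hθ : 0 < θ) :
    ∃ b : ℝ, 0 ≤ b ∧ ∀ n, P {ω | ¬ ∀ j k, j ≤ k → k ≤ n →
      ∑ i ∈ Finset.Ico j k, f (fun m => U (m + i) ω)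
        ≤ (∫ u, f u ∂(P.map fun ω n => U n ω)) * (k - j) + (ε * (n - j) + b)}
      ≤ ENNReal.ofReal θ := by
  have hm : Measurable fun ω n => U n ω := measurable_pi_lambda _ hU
  have := Measure.isProbabilityMeasure_map (μ := P) hm.aemeasurable
  obtain ⟨b, hb⟩ := exists_window_sum_bound hE hf (half_pos hε) hθ
  refine ⟨2 * |b|, by positivity, fun n => le_trans (measure_not_le_of_imp fun ω h => ?_)
    ((Measure.le_map_apply hm.aemeasurable _).trans (hb n))⟩
  intro j k hjk hkn
  have hj := h j (hjk.trans hkn)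
  have hk := h k hkn
  simp only [iterate_shift] at hj hk
  have hsplit := Finset.sum_Ico_consecutive (fun i => f (fun m => U (m + i) ω)) hjk hkn
  have hjk' : (j : ℝ) ≤ k := by exact_mod_cast hjk
  have hslope : ε / 2 * (n - k) ≤ ε / 2 * (n - j) := by gcongr
  have := le_abs_self b
  rw [abs_le] at hj hk
  linarith [hj.2, hk.1]

lemma map_add (hU : ∀ n, Measurable (U n)) (hE : IsStationaryErgodic P U) (s : ℕ) :
    P.map (fun ω n => U (n + s) ω) = P.map fun ω n => U n ω := by
  have h := (hE.toMeasurePreserving.iterate s).map_eq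
  rw [Measure.map_map (hE.measurable.iterate s) (measurable_pi_lambda _ hU)] at h
  rw [← h]
  congr 1
  funext ω
  simp only [Function.comp_apply, iterate_shift]

lemma map_blockProc_add (hY : ∀ n, Measurable (Y n)) (hE : IsStationaryErgodic P Y) (r s : ℕ) :
    P.map (fun ω n => blockProc (fun m => Y (m + s)) r n ω)
      = P.map fun ω n => blockProc Y r n ω := by
  have hb : Measurable fun (u : ℕ → 𝒴) (n : ℕ) (i : Fin r) => u (n * r + i) := by fun_prop
  have h := congrArg (Measure.map fun (u : ℕ → 𝒴) (n : ℕ) (i : Fin r) => u (n * r + i))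
    (hE.map_add hY s)
  rwa [Measure.map_map hb (measurable_pi_lambda _ fun n => hY _),
    Measure.map_map hb (measurable_pi_lambda _ hY)] at h

end IsStationaryErgodic

lemma measurable_blockProc (hY : ∀ n, Measurable (Y n)) (r n : ℕ) :
    Measurable (blockProc Y r n) := measurable_pi_lambda _ fun _ => hY _

lemma exists_bad_blocks_le_of_residue [IsProbabilityMeasure P] (hY : ∀ n, Measurable (Y n))
    (hE : IsStationaryErgodic P Y) (hZ : IsStationaryErgodic P (blockProc Y r))
    (hK : MeasurableSet K) (hPK : 2 / 3 < P {ω | blockProc Y r 0 ω ∈ K}) (hε : 0 < ε)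
    (hθ : 0 < θ) (s : ℕ) :
    ∃ b : ℝ, 0 ≤ b ∧ ∀ n, P {ω | ¬ ∀ q N : ℕ, q + N ≤ n →
      (∑ i ∈ Finset.range N, open Classical in
        if (fun l : Fin r => Y (s + (q + i) * r + l) ω) ∈ K then (0 : ℝ) else 1)
      ≤ 1 / 3 * N + (ε * (n - q) + b)} ≤ ENNReal.ofReal θ := by
  classical
  set good : Set (ℕ → Fin r → 𝒴) := {u | u 0 ∈ K}
  have hgood : MeasurableSet good := measurable_pi_apply 0 hK
  have hZm : Measurable fun ω n => blockProc Y r n ω :=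
    measurable_pi_lambda _ (measurable_blockProc hY r)
  have hlaw := hE.map_blockProc_add hY r s
  have := Measure.isProbabilityMeasure_map (μ := P) hZm.aemeasurable
  have hmean : ∫ u, goodᶜ.indicator (1 : (ℕ → Fin r → 𝒴) → ℝ) u
      ∂(P.map fun ω n => blockProc Y r n ω) ≤ 1 - 2 / 3 := by
    refine integral_indicator_compl_one_le hgood ?_
    rw [Measure.map_apply hZm hgood, ENNReal.ofReal_div_of_pos (by norm_num),
      ENNReal.ofReal_ofNat, ENNReal.ofReal_ofNat]
    exact hPK.le
  obtain ⟨b, hb0, hb⟩ := IsStationaryErgodic.exists_sum_Ico_le (P := P)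
    (U := blockProc (fun m => Y (m + s)) r) (measurable_blockProc (fun _ => hY _) r)
    (by rwa [IsStationaryErgodic, hlaw]) (f := goodᶜ.indicator 1)
    ((integrable_const (1 : ℝ)).indicator hgood.compl) hε hθ
  rw [hlaw] at hb
  refine ⟨b, hb0, fun n => (measure_not_le_of_imp fun ω h q N hqN => ?_).trans (hb n)⟩
  have hblock : ∀ i, blockProc (fun m => Y (m + s)) r (0 + (q + i)) ω
      = fun l : Fin r => Y (s + (q + i) * r + l) ω := fun i => by
    funext l
    simp only [blockProc, zero_add]
    congr 1
    ring
  have hsum := (h q (q + N) (by omega) hqN).trans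
    (add_le_add_left (mul_le_mul_of_nonneg_right hmean (by simp)) _)
  rw [Finset.sum_Ico_eq_sum_range, Nat.add_sub_cancel_left] at hsum
  simp only [Set.indicator, Set.mem_compl_iff, good, Set.mem_ofPred_eq, hblock, Pi.one_apply,
    ite_not] at hsum
  push_cast at hsum
  linarith

lemma exists_bad_blocks_le [IsProbabilityMeasure P] (hY : ∀ n, Measurable (Y n))
    (hE : IsStationaryErgodic P Y) (hr : 1 ≤ r) (hZ : IsStationaryErgodic P (blockProc Y r))
    (hK : MeasurableSet K) (hPK : 2 / 3 < P {ω | blockProc Y r 0 ω ∈ K}) (hε : 0 < ε)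
    (hθ : 0 < θ) :
    ∃ b : ℝ, 0 ≤ b ∧ ∀ n, P {ω | ¬ ∀ j N, j + N * r ≤ n →
      (∑ i ∈ Finset.range N, open Classical in
        if (fun l : Fin r => Y (j + i * r + l) ω) ∈ K then (0 : ℝ) else 1)
      ≤ 1 / 3 * N + (ε * (n - j) + b)} ≤ ENNReal.ofReal θ := by
  classical
  choose b hb0 hb using exists_bad_blocks_le_of_residue hY hE hZ hK hPK hε
    (θ := θ / r) (by positivity)
  refine ⟨∑ s ∈ Finset.range r, b s, Finset.sum_nonneg fun s _ => hb0 s, fun n => ?_⟩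
  refine (measure_not_le_of_imp fun ω h j N hjN => ?_).trans
    (measure_not_forall_lt_le hθ.le fun s _ => hb s ((n - s) / r))
  exact sum_progression_le_of_residues
    (bad := fun j => if (fun l : Fin r => Y (j + l) ω) ∈ K then 0 else 1) hr hε.le hb0 h hjN

lemma exists_windowBound [IsProbabilityMeasure P] (hY : ∀ n, Measurable (Y n))
    (hE : IsStationaryErgodic P Y) (hr : 1 ≤ r) (hZ : IsStationaryErgodic P (blockProc Y r))
    (hK : MeasurableSet K) (hPK : 2 / 3 < P {ω | blockProc Y r 0 ω ∈ K}) {f : (ℕ → 𝒴) → ℝ}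
    (hf : Integrable f (P.map fun ω n => Y n ω)) (hε : 0 < ε) (hθ : 0 < θ) :
    ∃ b : ℝ, ∀ n, P {ω | ¬ WindowBound r n (∫ u, f u ∂(P.map fun ω n => Y n ω)) ε b
      (fun i => f fun m => Y (m + i) ω) {i | (fun l : Fin r => Y (i + l) ω) ∈ K}}
      ≤ ENNReal.ofReal θ := by
  obtain ⟨b₁, hb₁, hsum⟩ := hE.exists_sum_Ico_le hY hf hε (half_pos hθ)
  obtain ⟨b₂, hb₂, hbad⟩ := exists_bad_blocks_le hY hE hr hZ hK hPK hε (half_pos hθ)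
  refine ⟨b₁ + b₂, fun n => (measure_not_le_of_imp fun ω h => ?_).trans
    (measure_not_and_le hθ.le (hsum n) (hbad n))⟩
  exact ⟨by positivity, fun j k hjk hk => (h.1 j k hjk hk).trans (by linarith),
    fun j N hjN => (h.2 j N hjN).trans (by linarith)⟩

lemma WindowBound.mono {n : ℕ} {c b b' : ℝ} {a : ℕ → ℝ} {S : Set ℕ}
    (h : WindowBound r n c ε b a S) (hb : b ≤ b') : WindowBound r n c ε b' a S where
  nonneg := h.nonneg.trans hb
  sum_le j k hjk hk := (h.sum_le j k hjk hk).trans (by linarith)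
  bad_le j N hj := (h.bad_le j N hj).trans (by linarith)

end WindowBounds

section Log

variable {t : ℝ≥0∞}

lemma le_coe_toReal_toENNReal {x : EReal} (hx : x.toENNReal ≠ ∞) :
    x ≤ (x.toENNReal.toReal : EReal) := by
  have h : ((x.toENNReal : ℝ≥0∞) : EReal) = max 0 x := EReal.coe_toENNReal_eq_max
  rw [← ENNReal.ofReal_toReal hx, EReal.coe_ennreal_ofReal, max_eq_left ENNReal.toReal_nonneg] at h
  rw [h]
  exact le_max_right _ _

lemma le_exp_lnPos (h : lnPos t ≠ ∞) : t ≤ ENNReal.ofReal (Real.exp (lnPos t).toReal) := by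
  rw [← EReal.exp_coe]
  conv_lhs => rw [← ENNReal.exp_log t]
  exact EReal.exp_monotone (le_coe_toReal_toENNReal h)

lemma exp_neg_lnNeg_le (h : lnNeg t ≠ ∞) :
    ENNReal.ofReal (Real.exp (-(lnNeg t).toReal)) ≤ t := by
  rw [← EReal.exp_coe]
  conv_rhs => rw [← ENNReal.exp_log t]
  refine EReal.exp_monotone ?_
  rw [EReal.coe_neg]
  exact EReal.neg_le_of_neg_le (le_coe_toReal_toENNReal h)

lemma pos_of_lnNeg_ne_top (h : lnNeg t ≠ ∞) : 0 < t :=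
  lt_of_lt_of_le (ENNReal.ofReal_pos.2 (Real.exp_pos _)) (exp_neg_lnNeg_le h)

end Log

section FiniteMean

variable {α β : Type*} [MeasurableSpace α] [MeasurableSpace β] {μ : Measure α}

lemma FiniteMean.of_map {φ : α → β} (hφ : Measurable φ) {f : β → ℝ≥0∞}
    (h : FiniteMean (μ.map φ) f) : FiniteMean μ fun a => f (φ a) :=
  ⟨h.1.comp_measurable hφ, by simpa only [← lintegral_map' h.1 hφ.aemeasurable] using h.2⟩

lemma FiniteMean.integrable {f : α → ℝ≥0∞} (h : FiniteMean μ f) :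
    Integrable (fun a => (f a).toReal) μ :=
  integrable_toReal_of_lintegral_ne_top h.1 h.2.ne

lemma FiniteMean.ae_ne_top {f : α → ℝ≥0∞} (h : FiniteMean μ f) : ∀ᵐ a ∂μ, f a ≠ ∞ :=
  (ae_lt_top' h.1 h.2.ne).mono fun _ => ne_of_lt

variable {Y : ℕ → α → β}

lemma FiniteMean.of_eval_zero (hY : ∀ n, Measurable (Y n)) {f : β → ℝ≥0∞}
    (h : FiniteMean (μ.map (Y 0)) f) : FiniteMean (μ.map fun ω n => Y n ω) fun u => f (u 0) := by
  refine FiniteMean.of_map (φ := fun u : ℕ → β => u 0) (measurable_pi_apply 0) ?_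
  rwa [Measure.map_map (measurable_pi_apply 0) (measurable_pi_lambda _ hY)]

lemma FiniteMean.of_initLaw (hY : ∀ n, Measurable (Y n)) {ℓ : ℕ} {f : (Fin ℓ → β) → ℝ≥0∞}
    (h : FiniteMean (initLaw μ Y ℓ) f) :
    FiniteMean (μ.map fun ω n => Y n ω) fun u => f fun i => u i := by
  have hm : Measurable fun (u : ℕ → β) (i : Fin ℓ) => u i := by fun_prop
  refine FiniteMean.of_map (φ := fun (u : ℕ → β) (i : Fin ℓ) => u i) hm ?_
  rwa [Measure.map_map hm (measurable_pi_lambda _ hY)]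

lemma IsStationaryErgodic.ae_forall_shift (hY : ∀ n, Measurable (Y n))
    (hE : IsStationaryErgodic μ Y) {p : (ℕ → β) → Prop}
    (hp : ∀ᵐ u ∂(μ.map fun ω n => Y n ω), p u) : ∀ᵐ ω ∂μ, ∀ i, p fun n => Y (n + i) ω := by
  refine ae_all_iff.2 fun i => ?_
  rw [← hE.map_add hY i] at hp
  exact ae_of_ae_map (measurable_pi_lambda _ fun n => hY _).aemeasurable hp

end FiniteMean

section Regular

variable {𝒳 𝒴 : Type*} [MeasurableSpace 𝒳] [MeasurableSpace 𝒴] {M : HMM 𝒳 𝒴} {χ : Measure 𝒳}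
  {r : ℕ} {D : Set 𝒳} {y : ℕ → 𝒴}

/-- The logarithmic bound at time `i` of the observation density and of the return mass to `D`. -/
def HMM.logBound (M : HMM 𝒳 𝒴) (r : ℕ) (D : Set 𝒳) (y : ℕ → 𝒴) (i : ℕ) : ℝ :=
  (lnPos (⨆ x, ENNReal.ofReal (M.g x (y i)))).toReal
    + (lnNeg (⨅ x ∈ D, M.window y i r x D)).toReal

lemma HMM.window_shift (M : HMM 𝒳 𝒴) (y : ℕ → 𝒴) (i l : ℕ) :
    M.window (fun m => y (m + i)) 0 l = M.window y i l := by
  simp only [HMM.window, zero_add, add_comm i]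

lemma HMM.logBound_shift (M : HMM 𝒳 𝒴) (r : ℕ) (D : Set 𝒳) (y : ℕ → 𝒴) (i : ℕ) :
    M.logBound r D (fun m => y (m + i)) 0 = M.logBound r D y i := by
  simp only [HMM.logBound, M.window_shift, zero_add]

lemma HMM.logBound_nonneg (M : HMM 𝒳 𝒴) (r : ℕ) (D : Set 𝒳) (y : ℕ → 𝒴) (i : ℕ) :
    0 ≤ M.logBound r D y i := add_nonneg ENNReal.toReal_nonneg ENNReal.toReal_nonneg

/-- The finiteness along a record of the logarithms whose means (A1), (A2) and `ℳ(D, r)` control. -/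
structure HMM.HasFiniteLogs (M : HMM 𝒳 𝒴) (χ : Measure 𝒳) (r : ℕ) (D : Set 𝒳) (y : ℕ → 𝒴) :
    Prop where
  density : ∀ i, lnPos (⨆ x, ENNReal.ofReal (M.g x (y i))) ≠ ∞
  return_mass : ∀ i, lnNeg (⨅ x ∈ D, M.window y i r x D) ≠ ∞
  start : ∀ l ≤ r, lnNeg (M.unnormPred χ y l D) ≠ ∞

namespace HMM.HasFiniteLogs

lemma g_le (h : M.HasFiniteLogs χ r D y) (i : ℕ) (x : 𝒳) :
    M.g x (y i) ≤ Real.exp (M.logBound r D y i) := by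
  have hx := (le_iSup (fun x => ENNReal.ofReal (M.g x (y i))) x).trans (le_exp_lnPos (h.density i))
  rw [ENNReal.ofReal_le_ofReal_iff (Real.exp_pos _).le] at hx
  exact hx.trans (Real.exp_le_exp.2 (le_add_of_nonneg_right ENNReal.toReal_nonneg))

lemma le_return (h : M.HasFiniteLogs χ r D y) (i : ℕ) {x : 𝒳} (hx : x ∈ D) :
    ENNReal.ofReal (Real.exp (-M.logBound r D y i)) ≤ M.window y i r x D := by
  refine le_trans ?_ ((exp_neg_lnNeg_le (h.return_mass i)).trans (iInf₂_le x hx))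
  refine ENNReal.ofReal_le_ofReal (Real.exp_le_exp.2 (neg_le_neg ?_))
  exact le_add_of_nonneg_left ENNReal.toReal_nonneg

lemma unnormPred_pos (hD : MeasurableSet D) (h : M.HasFiniteLogs χ r D y) {s : ℕ}
    (hs : s < 2 * r) : 0 < M.unnormPred χ y s D := by
  rcases le_or_gt s r with hsr | hrs
  · exact pos_of_lnNeg_ne_top (h.start s hsr)
  · obtain ⟨t, rfl⟩ : ∃ t, s = t + r := ⟨s - r, by omega⟩
    rw [M.unnormPred_add, Measure.bind_apply hD (Kernel.aemeasurable _)]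
    calc 0 < ENNReal.ofReal (Real.exp (-M.logBound r D y t)) * M.unnormPred χ y t D :=
          ENNReal.mul_pos (ENNReal.ofReal_pos.2 (Real.exp_pos _)).ne'
            (pos_of_lnNeg_ne_top (h.start t (by omega))).ne'
      _ = ∫⁻ _x in D, ENNReal.ofReal (Real.exp (-M.logBound r D y t)) ∂(M.unnormPred χ y t) :=
          (setLIntegral_const _ _).symm
      _ ≤ ∫⁻ x in D, M.window y t r x D ∂(M.unnormPred χ y t) :=
          setLIntegral_mono (Kernel.measurable_coe _ hD) fun _ hx => h.le_return t hx
      _ ≤ ∫⁻ x, M.window y t r x D ∂(M.unnormPred χ y t) := setLIntegral_le_lintegral _ _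

lemma nonempty (h : M.HasFiniteLogs χ r D y) : D.Nonempty :=
  nonempty_of_measure_ne_zero (pos_of_lnNeg_ne_top (h.start 0 r.zero_le)).ne'

end HMM.HasFiniteLogs

lemma isDoeblinOn_of_le {κ : Kernel 𝒳 𝒳} {C : Set 𝒳} {lam : Measure 𝒳} [IsFiniteMeasure lam]
    {φ : 𝒳 → ℝ} (hφ : ∀ x, 0 ≤ φ x) {s t e : ℝ} (he : 0 ≤ e) (ht : 0 < t) (hes : e ≤ s / t)
    (h : ∀ A, MeasurableSet A → ∀ x ∈ C, ENNReal.ofReal (s * φ x) * lam A ≤ κ x (A ∩ C) ∧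
      κ x (A ∩ C) ≤ ENNReal.ofReal (t * φ x) * lam A) :
    IsDoeblinOn κ C (ENNReal.ofReal e) := by
  refine ⟨lam, fun x => ENNReal.ofReal (t * φ x), inferInstance, fun x => ENNReal.ofReal_ne_top,
    fun x hx => ⟨Measure.le_iff.2 fun A hA => ?_, Measure.le_iff.2 fun A hA => ?_⟩⟩
  · rw [Measure.restrict_apply hA, Measure.smul_apply, smul_eq_mul, ← ENNReal.ofReal_mul he]
    refine le_trans (mul_le_mul_left (ENNReal.ofReal_le_ofReal ?_) _) (h A hA x hx).1
    rw [← mul_assoc]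
    exact mul_le_mul_of_nonneg_right ((le_div_iff₀ ht).1 hes) (hφ x)
  · rw [Measure.restrict_apply hA, Measure.smul_apply, smul_eq_mul]
    exact (h A hA x hx).2

lemma HMM.IsLocalDoeblinWith.record {C : Set 𝒳} {εl εu : (Fin r → 𝒴) → ℝ}
    (hC : M.IsLocalDoeblinWith r C εl εu) (hD : MeasurableSet D) (hr : 1 ≤ r)
    {K : Set (Fin r → 𝒴)} {e Θ : ℝ} (he : 0 ≤ e)
    (heK : ENNReal.ofReal e ≤ ⨅ z ∈ K, ENNReal.ofReal (εl z / εu z))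
    (hK : ∀ z ∈ K, (⨆ x ∈ Cᶜ, M.L r z x Set.univ)
      ≤ ENNReal.ofReal (Real.exp (-Θ) ^ 2) * (⨆ x, M.L r z x Set.univ))
    (h : M.HasFiniteLogs χ r D y) :
    M.Record y r C D e Θ (M.logBound r D y) {i | (fun l : Fin r => y (i + l)) ∈ K} := by
  obtain ⟨hCm, hl, hu, lam, φ, hlam, hφ, -, hdoe⟩ := hC
  refine ⟨hCm, hD, h.nonempty, hr, M.logBound_nonneg r D y, h.g_le,
    fun i x hx => h.le_return i hx, fun i hi => ?_, fun i hi x hx => ?_⟩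
  · refine isDoeblinOn_of_le (fun x => (hφ _ x).le) he (hu _) ?_ (hdoe fun l => y (i + l))
    have hratio := heK.trans (iInf₂_le (fun l : Fin r => y (i + l)) hi)
    rwa [ENNReal.ofReal_le_ofReal_iff (div_pos (hl _) (hu _)).le] at hratio
  · rw [← ENNReal.ofReal_pow (Real.exp_pos _).le]
    have hsup : (⨆ x, M.window y i r x Set.univ)
        ≤ ENNReal.ofReal (expSum (M.logBound r D y) i (i + r)) :=
      iSup_le (M.window_univ_le h.g_le i r)
    exact (le_iSup₂ (f := fun x (_ : x ∈ Cᶜ) => M.window y i r x Set.univ) x hx).trans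
      ((hK _ hi).trans (mul_le_mul_right hsup _))

lemma exists_record_of_localDoeblin {K : Set (Fin r → 𝒴)}
    (hloc : ∀ η : ℝ, 0 < η → ∃ (C : Set 𝒳) (εl εu : (Fin r → 𝒴) → ℝ),
      M.IsLocalDoeblinWith r C εl εu ∧
      (∀ z ∈ K, (⨆ x ∈ Cᶜ, M.L r z x Set.univ)
        ≤ ENNReal.ofReal η * (⨆ x, M.L r z x Set.univ)) ∧
      0 < ⨅ z ∈ K, ENNReal.ofReal (εl z / εu z))
    (hD : MeasurableSet D) (hr : 1 ≤ r) {c : ℝ} (hc : 0 ≤ c) :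
    ∃ (C : Set 𝒳) (e Θ ε : ℝ), IsAdmissible r e Θ c ε ∧ ∀ y, M.HasFiniteLogs χ r D y →
      M.Record y r C D e Θ (M.logBound r D y) {i | (fun l : Fin r => y (i + l)) ∈ K} := by
  set Θ : ℝ := 2 * (1 + 3 * (12 * r * c + 1))
  obtain ⟨C, εl, εu, hC, hCK, hratio⟩ := hloc (Real.exp (-Θ) ^ 2) (by positivity)
  obtain ⟨q, hq0, hq⟩ := ENNReal.lt_iff_exists_nnreal_btwn.1 hratio
  set e : ℝ := min q (1 / 2)
  have he0 : 0 < e := lt_min (by simpa using hq0) (by norm_num)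
  have he1 : e < 1 := (min_le_right _ _).trans_lt (by norm_num)
  have heK : ENNReal.ofReal e ≤ ⨅ z ∈ K, ENNReal.ofReal (εl z / εu z) :=
    (ENNReal.ofReal_le_ofReal (min_le_left _ _)).trans (by simpa using hq.le)
  obtain ⟨ε, hε⟩ := exists_isAdmissible hr he0 he1 hc le_rfl
  exact ⟨C, e, Θ, ε, hε, fun y hy => hC.record hD hr he0.le heK hCK hy⟩

end Regular

section Measurability

variable {Ω α 𝒳 𝒴 : Type*} [MeasurableSpace Ω] [MeasurableSpace α] [MeasurableSpace 𝒳]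
  [MeasurableSpace 𝒴]

lemma measurable_ratioVar {μ : Ω → Measure α}
    (hμ : ∀ F : Ω × α → ℝ≥0∞, Measurable F → Measurable fun ω => ∫⁻ x, F (ω, x) ∂(μ ω))
    {u v : Ω × α → ℝ≥0∞} (hu : Measurable u) (hv : Measurable v) :
    Measurable fun ω => ratioVar (μ ω) (fun x => u (ω, x)) (fun x => v (ω, x)) := by
  have hmass : Measurable fun ω => μ ω Set.univ := by
    simpa only [Pi.one_apply, lintegral_one] using hμ 1 measurable_one
  have hmass' : Measurable fun p : Ω × α => (μ p.1 Set.univ).toReal :=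
    hmass.ennreal_toReal.comp measurable_fst
  have hU : Measurable fun p : Ω × α => (∫⁻ x, u (p.1, x) ∂(μ p.1)).toReal :=
    (hμ u hu).ennreal_toReal.comp measurable_fst
  have hV : Measurable fun p : Ω × α => (∫⁻ x, v (p.1, x) ∂(μ p.1)).toReal :=
    (hμ v hv).ennreal_toReal.comp measurable_fst
  have hsq := (((hu.ennreal_toReal.sub ((hU.div hV).mul hv.ennreal_toReal)).div
    (hV.div hmass')).pow_const 2).ennreal_ofReal
  exact (hmass.inv.mul (hμ _ hsq)).ennreal_toReal

variable {P : Measure Ω} {M : HMM 𝒳 𝒴} {χ : Measure 𝒳} {r : ℕ} {D : Set 𝒳} {y : Ω → ℕ → 𝒴}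

lemma HMM.measurable_lintegral_unnormPred [SFinite χ] (M : HMM 𝒳 𝒴)
    (hy : ∀ i, Measurable fun ω => y ω i) (k : ℕ) {F : Ω × 𝒳 → ℝ≥0∞} (hF : Measurable F) :
    Measurable fun ω => ∫⁻ x, F (ω, x) ∂(M.unnormPred χ (y ω) k) := by
  have hbind : ∀ ω, ∫⁻ x, F (ω, x) ∂(M.unnormPred χ (y ω) k)
      = ∫⁻ x, lact (M.window (y ω) 0 k) (fun x => F (ω, x)) x ∂χ :=
    fun ω => lintegral_bind_kernel _ _ (hF.comp measurable_prodMk_left)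
  simp only [hbind]
  exact (M.measurable_lact_window_prod hy 0 k hF).lintegral_prod_right'

lemma HMM.measurable_unnormPred_apply [SFinite χ] (M : HMM 𝒳 𝒴)
    (hy : ∀ i, Measurable fun ω => y ω i) (k : ℕ) {A : Set 𝒳} (hA : MeasurableSet A) :
    Measurable fun ω => M.unnormPred χ (y ω) k A := by
  simpa only [Function.comp_apply, lintegral_indicator_one hA] using
    M.measurable_lintegral_unnormPred (χ := χ) hy k
      ((measurable_one.indicator hA).comp measurable_snd)

lemma HMM.aemeasurable_filtVar [IsFiniteMeasure χ] [NeZero χ] (hg : ∀ x y, 0 < M.g x y)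
    (hy : ∀ i, Measurable fun ω => y ω i) (hlog : ∀ᵐ ω ∂P, M.HasFiniteLogs χ r D (y ω)) (n : ℕ)
    {f : 𝒳 → ℝ} (hf : Measurable f) {B : ℝ} (hB : ∀ x, |f x| ≤ B) :
    AEMeasurable (fun ω => M.filtVar χ (y ω) n f) P := by
  have hg_prod : Measurable fun p : Ω × 𝒳 => M.g p.2 (y p.1 n) :=
    M.measurable_g.comp (measurable_snd.prodMk ((hy n).comp measurable_fst))
  refine ⟨_, Finset.measurable_sum (Finset.range (n + 1)) fun k _ => measurable_ratioVar
    (fun F hF => M.measurable_lintegral_unnormPred (χ := χ) hy k hF)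
    (M.measurable_lact_window_prod hy k (n - k)
      (F := fun p => M.shiftedDensity (y p.1) n f B p.2)
      (hg_prod.mul ((hf.comp measurable_snd).add_const B)).ennreal_ofReal)
    (M.measurable_lact_window_prod hy k (n - k) (F := fun p => M.obsDensity (y p.1) n p.2)
      hg_prod.ennreal_ofReal), ?_⟩
  filter_upwards [hlog] with ω hω
  exact HMM.filtVar_eq_sum_ratioVar hg hω.g_le n hf hB

end Measurability

section Tightness

variable {Ω : Type*} [MeasurableSpace Ω] {P : Measure Ω}

lemma isTightFamily_of_forall {ι : Type*} {V : ι → Ω → ℝ} (hV : ∀ i, AEMeasurable (V i) P)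
    (h : ∀ θ : ℝ, 0 < θ → ∃ a : ℝ, ∀ i, P {ω | ¬ |V i ω| ≤ a} ≤ ENNReal.ofReal θ) :
    IsTightFamily P V := by
  refine ⟨hV, fun θ hθ => (h θ hθ).imp fun a ha i => ?_⟩
  rw [Measure.map_apply_of_aemeasurable (hV i) measurableSet_Icc.compl]
  have hsub : V i ⁻¹' (Set.Icc (-a) a)ᶜ ⊆ {ω | ¬ |V i ω| ≤ a} := fun ω hω hle => hω (abs_le.1 hle)
  exact (measure_mono hsub).trans (ha i)

lemma exists_measure_not_le_exp_le [IsFiniteMeasure P] {F : Ω → ℝ≥0∞} (hF : Measurable F)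
    (hfin : ∀ᵐ ω ∂P, F ω ≠ ∞) {θ : ℝ} (hθ : 0 < θ) :
    ∃ b : ℝ, P {ω | ¬ F ω ≤ ENNReal.ofReal (Real.exp b)} ≤ ENNReal.ofReal θ := by
  set s : ℕ → Set Ω := fun m => {ω | ¬ F ω ≤ ENNReal.ofReal (Real.exp m)}
  have hmeas : ∀ m, MeasurableSet (s m) := fun m => (measurableSet_le hF measurable_const).compl
  have hanti : Antitone s := fun m m' h ω hω hle => hω (hle.trans
    (ENNReal.ofReal_le_ofReal (Real.exp_le_exp.2 (by exact_mod_cast h))))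
  have hlim := tendsto_measure_iInter_atTop (μ := P) (fun m => (hmeas m).nullMeasurableSet) hanti
    ⟨0, measure_ne_top _ _⟩
  have hzero : P (⋂ m, s m) = 0 := by
    refine measure_mono_null (t := {ω | ¬ F ω ≠ ∞}) (fun ω hω hne => ?_) (ae_iff.1 hfin)
    rw [Set.mem_iInter] at hω
    obtain ⟨m, hm⟩ := exists_nat_ge (F ω).toReal
    refine hω m ?_
    rw [← ENNReal.ofReal_toReal hne]
    exact ENNReal.ofReal_le_ofReal (by linarith [Real.add_one_le_exp (m : ℝ)])
  rw [hzero] at hlim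
  obtain ⟨m, hm⟩ := (hlim.eventually_le_const (by simpa using hθ : 0 < ENNReal.ofReal θ)).exists
  exact ⟨m, hm⟩

variable {𝒳 𝒴 : Type*} [MeasurableSpace 𝒳] [MeasurableSpace 𝒴] {M : HMM 𝒳 𝒴} {χ : Measure 𝒳}
  {r : ℕ} {D : Set 𝒳} {Y : ℕ → Ω → 𝒴} {y : Ω → ℕ → 𝒴} {θ : ℝ}

namespace HMM

lemma ae_hasFiniteLogs (hY : ∀ n, Measurable (Y n)) (hE : IsStationaryErgodic P Y)
    (hsup : FiniteMean (P.map (Y 0)) fun y => lnPos (⨆ x, ENNReal.ofReal (M.g x y)))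
    (hret : FiniteMean (initLaw P Y r) fun z => lnNeg (⨅ x ∈ D, M.L r z x D))
    (hstart : ∀ ℓ ≤ r, FiniteMean (initLaw P Y ℓ) fun z => lnNeg (χ.bind (M.L ℓ z) D)) :
    ∀ᵐ ω ∂P, M.HasFiniteLogs χ r D fun n => Y n ω := by
  have hm : Measurable fun ω n => Y n ω := measurable_pi_lambda _ hY
  have hinit : ∀ᵐ ω ∂P, ∀ ℓ, ℓ ≤ r → lnNeg (χ.bind (M.L ℓ fun i => Y i ω) D) ≠ ∞ :=
    ae_all_iff.2 fun ℓ => Filter.eventually_imp_distrib_left.2 fun hℓ =>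
      ae_of_ae_map hm.aemeasurable (hstart ℓ hℓ |>.of_initLaw hY).ae_ne_top
  filter_upwards [hE.ae_forall_shift hY (hsup.of_eval_zero hY).ae_ne_top,
    hE.ae_forall_shift hY (hret.of_initLaw hY).ae_ne_top, hinit] with ω hdensity hreturn hinit
  refine ⟨fun i => ?_, fun i => ?_, fun ℓ hℓ => ?_⟩
  · simpa only [zero_add] using hdensity i
  · simpa only [window, add_comm i] using hreturn i
  · simpa only [unnormPred, window, zero_add] using hinit ℓ hℓ

lemma integrable_logBound (hY : ∀ n, Measurable (Y n))
    (hsup : FiniteMean (P.map (Y 0)) fun y => lnPos (⨆ x, ENNReal.ofReal (M.g x y)))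
    (hret : FiniteMean (initLaw P Y r) fun z => lnNeg (⨅ x ∈ D, M.L r z x D)) :
    Integrable (fun u => M.logBound r D u 0) (P.map fun ω n => Y n ω) := by
  simp only [logBound, window, zero_add]
  exact (hsup.of_eval_zero hY).integrable.add (hret.of_initLaw hY).integrable

lemma exists_measure_not_unnormPred_le [IsFiniteMeasure P] [IsFiniteMeasure χ]
    (hy : ∀ i, Measurable fun ω => y ω i) (hD : MeasurableSet D)
    (hlog : ∀ᵐ ω ∂P, M.HasFiniteLogs χ r D (y ω)) (hθ : 0 < θ) :
    ∃ b : ℝ, P {ω | ¬ ∀ s < 2 * r, M.unnormPred χ (y ω) s Set.univ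
      ≤ ENNReal.ofReal (Real.exp b) * M.unnormPred χ (y ω) s D} ≤ ENNReal.ofReal θ := by
  have hmeas : Measurable fun ω => ∑ s ∈ Finset.range (2 * r),
      M.unnormPred χ (y ω) s Set.univ / M.unnormPred χ (y ω) s D :=
    Finset.measurable_sum _ fun s _ => (M.measurable_unnormPred_apply hy s .univ).div
      (M.measurable_unnormPred_apply hy s hD)
  refine (exists_measure_not_le_exp_le hmeas ?_ hθ).imp fun b hb =>
    (measure_not_le_of_imp fun ω hω s hs => ?_).trans hb
  · filter_upwards [hlog] with ω hω
    refine ENNReal.sum_ne_top.2 fun s hs => ?_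
    have := isFiniteMeasure_unnormPred (χ := χ) hω.g_le s
    exact ENNReal.div_ne_top (measure_ne_top _ _)
      (hω.unnormPred_pos hD (Finset.mem_range.1 hs)).ne'
  · rw [← ENNReal.div_le_iff_le_mul (.inr ENNReal.ofReal_ne_top)
      (.inr (ENNReal.ofReal_pos.2 (Real.exp_pos b)).ne')]
    exact (Finset.single_le_sum (f := fun s => M.unnormPred χ (y ω) s Set.univ
      / M.unnormPred χ (y ω) s D) (fun _ _ => zero_le) (Finset.mem_range.2 hs)).trans hω

lemma exists_measure_not_windowBound_le [IsProbabilityMeasure P] [IsFiniteMeasure χ]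
    (hY : ∀ n, Measurable (Y n)) (hE : IsStationaryErgodic P Y) (hr : 1 ≤ r)
    (hZ : IsStationaryErgodic P (blockProc Y r)) {K : Set (Fin r → 𝒴)} (hK : MeasurableSet K)
    (hPK : 2 / 3 < P {ω | blockProc Y r 0 ω ∈ K}) (hD : MeasurableSet D)
    (hint : Integrable (fun u => M.logBound r D u 0) (P.map fun ω n => Y n ω))
    (hlog : ∀ᵐ ω ∂P, M.HasFiniteLogs χ r D fun n => Y n ω) {ε : ℝ} (hε : 0 < ε) (hθ : 0 < θ) :
    ∃ b : ℝ, ∀ n, P {ω | ¬ (WindowBound r n (∫ u, M.logBound r D u 0 ∂(P.map fun ω n => Y n ω))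
        ε b (M.logBound r D fun k => Y k ω) {i | (fun l : Fin r => Y (i + l) ω) ∈ K} ∧
      ∀ s < 2 * r, M.unnormPred χ (fun k => Y k ω) s Set.univ
        ≤ ENNReal.ofReal (Real.exp b) * M.unnormPred χ (fun k => Y k ω) s D)}
      ≤ ENNReal.ofReal θ := by
  obtain ⟨b₁, hb₁⟩ := exists_windowBound hY hE hr hZ hK hPK hint hε (half_pos hθ)
  obtain ⟨b₂, hb₂⟩ := exists_measure_not_unnormPred_le (y := fun ω k => Y k ω) hY hD hlog
    (half_pos hθ)
  refine ⟨max b₁ b₂, fun n => measure_not_and_le hθ.le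
    ((measure_not_le_of_imp fun ω hω => ?_).trans (hb₁ n))
    ((measure_not_le_of_imp fun ω hω s hs => (hω s hs).trans ?_).trans hb₂)⟩
  · refine WindowBound.mono ?_ (le_max_left b₁ b₂)
    have hshift : ∀ i, M.logBound r D (fun m => Y (m + i) ω) 0
        = M.logBound r D (fun k => Y k ω) i := M.logBound_shift r D fun k => Y k ω
    simpa only [hshift] using hω
  · exact mul_le_mul_left (ENNReal.ofReal_le_ofReal (Real.exp_le_exp.2 (le_max_right b₁ b₂))) _

end HMM

end Tightness

end ParticleFilter

end

theorem mainTheorem2 {𝒳 𝒴 Ω : Type*} [MeasurableSpace 𝒳] [MeasurableSpace 𝒴] [MeasurableSpace Ω]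
    (M : ParticleFilter.HMM 𝒳 𝒴) (P : MeasureTheory.Measure Ω)
    [MeasureTheory.IsProbabilityMeasure P]
    (Y : ℕ → Ω → 𝒴) (hY : ∀ n, Measurable (Y n))
    (r : ℕ) (D : Set 𝒳) (hA1 : M.A1 P Y r D) (hA2 : M.A2 P Y)
    (χ : MeasureTheory.Measure 𝒳) (hχ : χ ∈ M.initClass P Y D r)
    (h : 𝒳 → ℝ) (hmeas : Measurable h) (hbdd : ∃ B : ℝ, ∀ x, |h x| ≤ B) :
    ParticleFilter.IsTightFamily P
      (fun (n : ℕ+) (ω : Ω) => M.filtVar χ (fun k => Y k ω) n h) := by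
  obtain ⟨hE, hr, K, hK, ⟨hZ, hPK⟩, hloc, hD, hret⟩ := hA1
  obtain ⟨hg, hsup⟩ := hA2
  obtain ⟨hprob, hstart⟩ := hχ
  obtain ⟨B, hB⟩ := hbdd
  have hlog := ParticleFilter.HMM.ae_hasFiniteLogs hY hE hsup hret hstart
  have hint := ParticleFilter.HMM.integrable_logBound hY hsup hret
  let c := ∫ u, M.logBound r D u 0 ∂(P.map fun ω n => Y n ω)
  have hc : 0 ≤ c := integral_nonneg fun u => M.logBound_nonneg r D u 0
  obtain ⟨C, e, Θ, ε, hadm, hrec⟩ := ParticleFilter.exists_record_of_localDoeblin (χ := χ)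
    (fun η hη => let ⟨C, l, u, hC, hCK, hpos⟩ := hloc η hη
      ⟨C, l, u, hC, fun z hz => (hCK z hz).1, hpos⟩)
    hD hr hc
  refine ParticleFilter.isTightFamily_of_forall
    (fun n => ParticleFilter.HMM.aemeasurable_filtVar hg hY hlog n hmeas hB) fun θ hθ => ?_
  obtain ⟨b, hb⟩ := ParticleFilter.HMM.exists_measure_not_windowBound_le hY hE hr hZ hK hPK hD
    hint hlog hadm.slope_pos hθ
  refine ⟨ParticleFilter.decayConst r c e Θ (ε * (2 * r) + b) B ^ 2
    * (1 - Real.exp (-(2 * ParticleFilter.decayRate r e)))⁻¹,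
    fun n => (measure_mono_ae ?_).trans (hb (n + 2 * r))⟩
  filter_upwards [hlog] with ω hω
  exact mt fun hgood => (hrec _ hω).abs_filtVar_le hg hgood.1 hadm hgood.2 hmeas hB
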